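/- **Setting.** A *financial network* $\mathcal F$ consists of a finite directed multigraph without self-loops whose nodes are banks and whose edges are claims. Each edge $e$ has a debtor $\mathrm{de}(e)$, a creditor $\mathrm{cr}(e)$ and a liability $\ell_e\in\mathbb N_{>0}$. Each bank $u$ has external assets $a^x_u\in\mathbb Q_{\ge 0}$. Write $E^-(u)$ for the incoming and $E^+(u)$ for the outgoing edges of $u$, and $L_u=\sum_{e\in E^+(u)}\ell_e$. Each edge $e\in E^+(u)$ has a *monotone payment function* $f_e:\mathbb R\to[0,\ell_e]$, non-decreasing on $[0,\infty)$, with $\sum_{e\in E^+(u)}f_e(b)=\min\{b,L_u\}$ for all $b\ge 0$. The *clearing state* is the pointwise maximal solution $p$ of $p_e=f_e(a_{\mathrm{de}(e)})$, where $a_u=a^x_u+\sum_{e\in E^-(u)}p_e$ are the *total assets* of $u$. For distinct banks $v,w$, a *multi-trade of incoming edges* of $v$ to $w$ is a set $C\subseteq E^-(v)\setminus E^+(w)$ with haircut rates $\alpha_e\in[0,1]$ $(e\in C)$ and return $\rho=\sum_{e\in C}\alpha_e\ell_e\le a^x_w$. It makes $w$ the creditor of all edges in $C$, raises $a^x_v$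 by $\rho$ and lowers $a^x_w$ by $\rho$. Primes denote total assets in the clearing state after the trade. The trade is *creditor-positive* if $a'_v>a_v$ and $a'_w\ge a_w$. Let $A^*$ be the supremum of $a'_v$ over all creditor-positive multi-trades of incoming edges of $v$ to $w$. An *$\varepsilon$-approximate* trade is defined in the same way, but with $\alpha_e\in[0,1+\varepsilon]$ and $0<\rho\le(1+\varepsilon)\sum_{e\in C}\ell_e$ (and still $\rho\le a^x_w$). A trade is *$\delta$-optimal* if $a'_v\ge A^*-\delta$. Payment functions are given by finite descriptions, one per bank, which a fixed payment scheme interprets as functions. The scheme has an *efficient clearing oracle* if some algorithm computes, for every network over the scheme, its clearing state (which is thus rational) in time polynomial in the representation size of the network. Running times are measured on programs over rational numbers with cost proportional to bit length (polynomially equivalent to Turing machines). **Theorem.** Fix a payment scheme with an efficient clearing oracle. There is an algorithm with the following property. Let $\mathcal F$ be a network with monotone payment functions over this scheme, $v\ne w$ banks such that a creditor-positive multi-trade of incoming edges of $v$ to $w$ exists, and $\varepsilon,\delta>0$ real. Given $\mathcal F,v,w$ and the integers $\lceil1/\varepsilon\rceil,\lceil1/\delta\rceil$, the algorithm computes an $\varepsilon$-approximate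 $\delta$-optimal trade of incoming edges of $v$ to $w$, with rational rates, in time polynomial in the size of $\mathcal F$, $1/\varepsilon$ and $\max\{0,\log(1/\delta)\}$. This trade is moreover creditor-positive whenever some exact creditor-positive multi-trade of incoming edges of $v$ to $w$ achieves $a'_v\ge a_v+\delta$. -/

import Mathlib

namespace ClaimsTrade

open Finset

/-! ### Model of computation

Programs compute on finite binary trees whose leaves are rational numbers. Every primitive
operation is charged the bit length of its argument and of its result (logarithmic cost), so that
the number of steps is polynomially related to the running time of a Turing machine. -/

/-- Binary trees with rational leaves. -/
inductive Data : Type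
  | num (q : ℚ) : Data
  | pair (a b : Data) : Data

/-- Number of symbols of a binary representation. -/
def Data.size : Data → ℕ
  | .num q => q.num.natAbs.size + q.den.size + 1
  | .pair a b => a.size + b.size + 1

/-- A list is a chain of pairs that ends in the leaf `0`. -/
def Data.ofList : List Data → Data
  | [] => .num 0
  | a :: l => .pair a (Data.ofList l)

/-- Primitive operations. -/
inductive Op : Type
  | id
  | const (d : Data)
  | fst
  | snd
  | isPair
  | add
  | sub
  | mul
  | div
  | lt
  | floor

/-- Effect of a primitive operation; the result is the leaf `0` on arguments of the wrong shape. -/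
def Op.eval : Op → Data → Data
  | .id, x => x
  | .const d, _ => d
  | .fst, .pair a _ => a
  | .snd, .pair _ b => b
  | .isPair, .pair _ _ => .num 1
  | .add, .pair (.num a) (.num b) => .num (a + b)
  | .sub, .pair (.num a) (.num b) => .num (a - b)
  | .mul, .pair (.num a) (.num b) => .num (a * b)
  | .div, .pair (.num a) (.num b) => .num (a / b)
  | .lt, .pair (.num a) (.num b) => .num (if a < b then 1 else 0)
  | .floor, .num a => .num (⌊a⌋ : ℤ)
  | _, _ => .num 0

/-- Programs. A test succeeds when its value is not the leaf `0`. -/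
inductive Code : Type
  /-- a primitive operation -/
  | prim (o : Op) : Code
  /-- run both programs on the input and pair the results -/
  | pair (f g : Code) : Code
  /-- first `f`, then `g` on the result -/
  | seq (f g : Code) : Code
  /-- if the test `c` succeeds then `f`, else `g` -/
  | ite (c f g : Code) : Code
  /-- while the test `c` succeeds on the current value, replace the value by its image under `f` -/
  | loop (c f : Code) : Code

/-- `Run P x y t`: the program `P` halts on input `x` with output `y` after `t` steps. -/
inductive Run : Code → Data → Data → ℕ → Prop
  | prim (o : Op) (x : Data) :
      Run (.prim o) x (o.eval x) (1 + x.size + (o.eval x).size)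
  | pair {f g : Code} {x a b : Data} {s t : ℕ} :
      Run f x a s → Run g x b t → Run (.pair f g) x (.pair a b) (s + t + 1)
  | seq {f g : Code} {x y z : Data} {s t : ℕ} :
      Run f x y s → Run g y z t → Run (.seq f g) x z (s + t + 1)
  | ite_true {c f g : Code} {x b y : Data} {s t : ℕ} :
      Run c x b s → b ≠ .num 0 → Run f x y t → Run (.ite c f g) x y (s + t + 1)
  | ite_false {c f g : Code} {x y : Data} {s t : ℕ} :
      Run c x (.num 0) s → Run g x y t → Run (.ite c f g) x y (s + t + 1)
  | loop_stop {c f : Code} {x : Data} {s : ℕ} :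
      Run c x (.num 0) s → Run (.loop c f) x x (s + x.size + 1)
  | loop_step {c f : Code} {x b y z : Data} {s t r : ℕ} :
      Run c x b s → b ≠ .num 0 → Run f x y t → Run (.loop c f) y z r →
        Run (.loop c f) x z (s + t + r + 1)

/-! ### Financial networks -/

/-- A payment scheme says which functions are written down by a description: `S d i` is the
payment function of the `i`-th outgoing claim of a bank that carries the description `d`. -/
abbrev PaymentScheme : Type := Data → ℕ → ℝ → ℝ

/-- A financial network on a directed multigraph with banks `Fin n` and claims `Fin m`; `rule u`
is the description of the payment functions of the bank `u`. -/
structure Network (K : Type) (n m : ℕ) where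
  debtor : Fin m → Fin n
  creditor : Fin m → Fin n
  liability : Fin m → ℕ
  external : Fin n → K
  rule : Fin n → Data

/-- A network with rational external assets, viewed over the reals. -/
def Network.toReal {n m : ℕ} (F : Network ℚ n m) : Network ℝ n m where
  debtor := F.debtor
  creditor := F.creditor
  liability := F.liability
  external := fun u => (F.external u : ℝ)
  rule := F.rule

/-- The number of the claim `e` among the outgoing claims of its debtor, counted from zero. -/
def Network.slot {K : Type} {n m : ℕ} (F : Network K n m) (e : Fin m) : ℕ :=
  #{e' : Fin m | e' < e ∧ F.debtor e' = F.debtor e}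

/-- The payment function of the claim `e`. -/
def Network.pay {K : Type} {n m : ℕ} (S : PaymentScheme) (F : Network K n m) (e : Fin m) : ℝ → ℝ :=
  S (F.rule (F.debtor e)) (F.slot e)

/-- The standing assumptions on a financial network with monotone payment functions. -/
structure Network.Valid {n m : ℕ} (S : PaymentScheme) (F : Network ℝ n m) : Prop where
  no_loop : ∀ e, F.debtor e ≠ F.creditor e
  liability_pos : ∀ e, 0 < F.liability e
  external_nonneg : ∀ u, 0 ≤ F.external u
  pay_mem : ∀ e b, 0 ≤ F.pay S e b ∧ F.pay S e b ≤ F.liability e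
  pay_mono : ∀ e x y, 0 ≤ y → y ≤ x → F.pay S e y ≤ F.pay S e x
  pay_sum : ∀ u b, 0 ≤ b →
    ∑ e with F.debtor e = u, F.pay S e b = min b (∑ e with F.debtor e = u, (F.liability e : ℝ))

/-- Assets of the bank `u` under the payments `p`: external assets plus incoming payments. -/
def Network.assets {n m : ℕ} (F : Network ℝ n m) (p : Fin m → ℝ) (u : Fin n) : ℝ :=
  F.external u + ∑ e with F.creditor e = u, p e

/-- The fixed-point constraints. -/
def Network.Feasible {n m : ℕ} (S : PaymentScheme) (F : Network ℝ n m) (p : Fin m → ℝ) : Prop :=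
  ∀ e, p e = F.pay S e (F.assets p (F.debtor e))

/-- The clearing state that arises: the pointwise maximal solution of the constraints. -/
def Network.IsClearingState {n m : ℕ} (S : PaymentScheme) (F : Network ℝ n m)
    (p : Fin m → ℝ) : Prop :=
  IsGreatest {q | F.Feasible S q} p

/-- In a valid network the maximal clearing state exists. -/
theorem Network.Valid.exists_isClearingState {n m : ℕ} {S : PaymentScheme} {F : Network ℝ n m}
    (hF : F.Valid S) : ∃ p, F.IsClearingState S p := by
  let Φ : (Fin m → ℝ) → Fin m → ℝ := fun q e => F.pay S e (F.assets q (F.debtor e))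
  let P : Set (Fin m → ℝ) := {q | 0 ≤ q ∧ q ≤ Φ q}
  have hA : ∀ q : Fin m → ℝ, 0 ≤ q → ∀ u, 0 ≤ F.assets q u := fun q hq u =>
    add_nonneg (hF.external_nonneg u) (Finset.sum_nonneg fun e _ => hq e)
  have hmono : ∀ q r : Fin m → ℝ, 0 ≤ q → q ≤ r → Φ q ≤ Φ r := by
    intro q r hq hqr e
    refine hF.pay_mono e _ _ (hA q hq _) ?_
    exact add_le_add le_rfl (Finset.sum_le_sum fun e _ => hqr e)
  have hΦ0 : ∀ q, 0 ≤ Φ q := fun q e => (hF.pay_mem e _).1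
  have hne : P.Nonempty := ⟨0, le_rfl, hΦ0 0⟩
  have hbd : BddAbove P := ⟨fun e => (F.liability e : ℝ), fun q hq e =>
    (hq.2 e).trans (hF.pay_mem e _).2⟩
  obtain ⟨p, hp⟩ : ∃ p, IsLUB P p := ⟨sSup P, isLUB_csSup hne hbd⟩
  have hp0 : 0 ≤ p := hp.1 ⟨le_rfl, hΦ0 0⟩
  have h1 : p ≤ Φ p := hp.2 fun q hq => hq.2.trans (hmono q p hq.1 (hp.1 hq))
  have h2 : Φ p ≤ p := hp.1 ⟨hΦ0 p, hmono p (Φ p) hp0 h1⟩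
  refine ⟨p, fun e => (le_antisymm h1 h2 ▸ rfl : p e = Φ p e), fun q hq => ?_⟩
  have hq' : q = Φ q := funext hq
  exact hp.1 ⟨hq' ▸ hΦ0 q, hq'.le⟩

open Classical in
/-- The clearing state of a network (`0` if there is none, which never happens for valid ones). -/
noncomputable def Network.clearing {n m : ℕ} (S : PaymentScheme) (F : Network ℝ n m) :
    Fin m → ℝ :=
  if h : ∃ p, F.IsClearingState S p then h.choose else 0

theorem Network.Valid.isClearingState_clearing {n m : ℕ} {S : PaymentScheme} {F : Network ℝ n m}
    (hF : F.Valid S) : F.IsClearingState S (F.clearing S) := by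
  have h := hF.exists_isClearingState
  rw [Network.clearing, dif_pos h]
  exact h.choose_spec

/-- Total assets of the bank `u` in the clearing state. -/
noncomputable def Network.totalAssets {n m : ℕ} (S : PaymentScheme) (F : Network ℝ n m)
    (u : Fin n) : ℝ :=
  F.assets (F.clearing S) u

/-! ### Trades -/

/-- A set of claims with haircut rates; rates of claims outside the set are irrelevant. -/
structure MultiTrade (K : Type) (m : ℕ) where
  claims : Finset (Fin m)
  rate : Fin m → K

/-- A multi-trade with rational rates, viewed over the reals. -/
def MultiTrade.toReal {m : ℕ} (T : MultiTrade ℚ m) : MultiTrade ℝ m where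
  claims := T.claims
  rate := fun e => (T.rate e : ℝ)

/-- The return paid by the buyer. -/
def Network.tradeReturn {n m : ℕ} (F : Network ℝ n m) (T : MultiTrade ℝ m) : ℝ :=
  ∑ e ∈ T.claims, T.rate e * F.liability e

/-- The network after the claims of `T` have been traded from the creditor `v` to the buyer `w`. -/
def Network.afterTrade {n m : ℕ} (F : Network ℝ n m) (v w : Fin n) (T : MultiTrade ℝ m) :
    Network ℝ n m where
  debtor := F.debtor
  creditor := fun e => if e ∈ T.claims then w else F.creditor e
  liability := F.liability
  external := fun u =>
    if u = v then F.external v + F.tradeReturn T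
    else if u = w then F.external w - F.tradeReturn T
    else F.external u
  rule := F.rule

/-- `T` is a multi-trade of incoming edges of `v` to `w` with haircut rates in `[0, r]`, whose
return can be funded by the external assets of `w`. -/
structure Network.IsMultiTrade {n m : ℕ} (F : Network ℝ n m) (v w : Fin n) (r : ℝ)
    (T : MultiTrade ℝ m) : Prop where
  distinct : v ≠ w
  incoming : ∀ e ∈ T.claims, F.creditor e = v
  debtor_ne : ∀ e ∈ T.claims, F.debtor e ≠ w
  rate_mem : ∀ e ∈ T.claims, 0 ≤ T.rate e ∧ T.rate e ≤ r
  affordable : F.tradeReturn T ≤ F.external w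

/-- The trade strictly improves the creditor `v` and does not harm the buyer `w`. -/
def Network.CreditorPositive {n m : ℕ} (S : PaymentScheme) (F : Network ℝ n m) (v w : Fin n)
    (T : MultiTrade ℝ m) : Prop :=
  F.totalAssets S v < (F.afterTrade v w T).totalAssets S v ∧
    F.totalAssets S w ≤ (F.afterTrade v w T).totalAssets S w

/-- Exact creditor-positive multi-trades of incoming edges: all haircut rates lie in `[0, 1]`. -/
def Network.IsExactPositive {n m : ℕ} (S : PaymentScheme) (F : Network ℝ n m) (v w : Fin n)
    (T : MultiTrade ℝ m) : Prop :=
  F.IsMultiTrade v w 1 T ∧ F.CreditorPositive S v w T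

/-- `ε`-approximate multi-trades: haircut rates up to `1 + ε`. -/
def Network.IsApproxTrade {n m : ℕ} (F : Network ℝ n m) (v w : Fin n) (ε : ℝ)
    (T : MultiTrade ℝ m) : Prop :=
  F.IsMultiTrade v w (1 + ε) T ∧ 0 < F.tradeReturn T ∧
    F.tradeReturn T ≤ (1 + ε) * ∑ e ∈ T.claims, (F.liability e : ℝ)

/-- The assets of `v` after the trade are at least those after any exact creditor-positive
multi-trade, up to `δ`. -/
def Network.IsDeltaOptimal {n m : ℕ} (S : PaymentScheme) (F : Network ℝ n m) (v w : Fin n) (δ : ℝ)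
    (T : MultiTrade ℝ m) : Prop :=
  ∀ T' : MultiTrade ℝ m, F.IsExactPositive S v w T' →
    (F.afterTrade v w T').totalAssets S v - δ ≤ (F.afterTrade v w T).totalAssets S v

/-! ### Encodings and the clearing oracle -/

/-- The representation of a network with rational external assets. -/
def Network.encode {n m : ℕ} (F : Network ℚ n m) : Data :=
  .pair (Data.ofList (List.ofFn fun u => .pair (.num (F.external u)) (F.rule u)))
    (Data.ofList (List.ofFn fun e =>
      .pair (.num (F.debtor e : ℕ)) (.pair (.num (F.creditor e : ℕ)) (.num (F.liability e)))))

/-- The representation of a vector of payments. -/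
def encodePayments {m : ℕ} (p : Fin m → ℚ) : Data :=
  Data.ofList (List.ofFn fun e => .num (p e))

/-- The representation of a multi-trade: a list with one entry per claim of the network, which is
`0` for a claim that is not traded and the pair of `1` and the haircut rate for a traded one. -/
def MultiTrade.encode {m : ℕ} (T : MultiTrade ℚ m) : Data :=
  Data.ofList (List.ofFn fun e =>
    if e ∈ T.claims then .pair (.num 1) (.num (T.rate e)) else .num 0)

/-- The input of the trading problem. The accuracies are handed over as positive integers `N` and
`D`, to be read as `ε = 1 / N` and `δ = 1 / D`. -/
def encodeInstance {n m : ℕ} (F : Network ℚ n m) (v w : Fin n) (N D : ℕ) : Data :=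
  .pair F.encode
    (.pair (.pair (.num (v : ℕ)) (.num (w : ℕ))) (.pair (.num (N : ℚ)) (.num (D : ℚ))))

/-- An efficient clearing oracle for the payment scheme `S`: one program that computes the clearing
state of every valid network, in time polynomial in the size of the network. -/
def HasClearingOracle (S : PaymentScheme) : Prop :=
  ∃ (Q : Code) (c k : ℕ), ∀ (n m : ℕ) (F : Network ℚ n m), F.toReal.Valid S →
    ∃ (p : Fin m → ℚ) (t : ℕ), F.toReal.IsClearingState S (fun e => (p e : ℝ)) ∧
      Run Q F.encode (encodePayments p) t ∧ t ≤ c * F.encode.size ^ k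

end ClaimsTrade

/-!
The construction rests on a description of the assets `b` to which the creditor `v` can be lifted.
Let `r` be the clearing state of the network in which `v` is held at the assets `b` and `w` at its
assets before the trade (`Network.FixedClearing`, obtained by giving the two banks external assets
and redirecting what they receive). The amount `x` that `v` lacks, namely `b` minus its external
assets and its incoming payments in `r`, is the net transfer from `w` that has to accompany the
trade; it does not harm `w` if `w` receives at least `x` more in `r` than before. Then a set `C` of
claims lifts `v` to `b` if its return can be `x + ∑ e ∈ C, r e`, that is if the unpaid parts `ℓ_e -
r e` of `C` sum to at least `x` and the payments `r e` of `C` to at most the external assets of `w`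
minus `x`. That such a set lifts `v` to `b` holds because the clearing state dominates all payments
that the banks could afford (`achieves_level`). Conversely, a creditor-positive trade leaves the
assets of `w` unchanged and no bank keeps any of its additional assets: conservation of money forces
`w` to receive exactly what it transfers (`Network.IsExactPositive.structure`). Hence the set of
claims of a trade that reaches some level also serves for all lower ones above the old assets of `v`
(`Network.IsExactPositive.lower_level`).

Testing a level is thus a covering knapsack problem. Its weights, the unpaid parts, are rounded down
to multiples of `x / (m (N + 1))`, so that dynamic programming solves it in polynomial time
(`knapsack`); the rounding costs a factor `1 + 1 / N`, which the haircut rates up to `1 + ε` absorb.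
Every level that an exact trade reaches is accepted (`Oracle.accepts_of_exact`) and every accepted
level comes with an approximate trade that reaches it (`Oracle.Accepts.sound`).

Acceptance need not be monotone, but bisection maintains an interval whose left end is accepted and
beyond which no exact trade gets, and this is all that is needed. An accepted level to start from is
found among the levels `a_v + 2 ^ (-j)`, and polynomially many of them suffice because some exact
trade gains at least `2 ^ (-K)` with `K` polynomial in the size of the network
(`Oracle.exists_gain`). The reason is that a small additional amount paid to `v` flows back to `w`
in full as long as every bank it reaches stays below a threshold up to which all of its additional
assets go out along claims that already react to an arbitrarily small increase (`Network.Threshold`,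
`level_of_small`). Such thresholds, and the amounts that come back if a bank is held at its
threshold, are read off clearing states of networks of polynomial size
(`Network.Threshold.doubled`), so the oracle bounds their bit lengths. Because the search starts
strictly above the old assets of `v`, the trade that it returns is creditor-positive in any case.

The running time is treated compositionally. `Comp μ x y` states that one program turns `x i` into
`y i` in time polynomial in `μ i`, for all instances `i`; it is closed under the arithmetic
operations, bounded loops and operations on vectors that the algorithm is made of.
-/

namespace ClaimsTrade

open Finset

/-! ### Conservation of money and clearing states -/

section Balance

variable {n m : ℕ} {S : PaymentScheme}

/-- The payments that reach the bank `u` in the state `q`. -/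
def Network.inflow {K : Type} [AddCommMonoid K] (F : Network K n m) (q : Fin m → K)
    (u : Fin n) : K :=
  ∑ e with F.creditor e = u, q e

/-- The total liabilities of the bank `u`. -/
def Network.debt {K : Type} (F : Network K n m) (u : Fin n) : ℝ :=
  ∑ e with F.debtor e = u, (F.liability e : ℝ)

/-- `q` is the vector of payments of banks whose assets are prescribed by `A`. -/
def Network.Follows (S : PaymentScheme) (F : Network ℝ n m) (A : Fin n → ℝ) (q : Fin m → ℝ) :
    Prop :=
  ∀ e, q e = F.pay S e (A (F.debtor e))

theorem Network.assets_eq (F : Network ℝ n m) (q : Fin m → ℝ) (u : Fin n) :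
    F.assets q u = F.external u + F.inflow q u := rfl

theorem Network.inflow_mono (F : Network ℝ n m) {q r : Fin m → ℝ} (h : q ≤ r) (u : Fin n) :
    F.inflow q u ≤ F.inflow r u :=
  Finset.sum_le_sum fun e _ => h e

theorem Network.assets_mono (F : Network ℝ n m) {q r : Fin m → ℝ} (h : q ≤ r) (u : Fin n) :
    F.assets q u ≤ F.assets r u :=
  add_le_add le_rfl (F.inflow_mono h u)

theorem Network.Valid.assets_nonneg {F : Network ℝ n m} (hF : F.Valid S) {q : Fin m → ℝ}
    (hq : 0 ≤ q) (u : Fin n) : 0 ≤ F.assets q u :=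
  add_nonneg (hF.external_nonneg u) (Finset.sum_nonneg fun e _ => hq e)

theorem Network.Follows.nonneg {F : Network ℝ n m} (hF : F.Valid S) {A : Fin n → ℝ}
    {q : Fin m → ℝ} (h : F.Follows S A q) : 0 ≤ q := fun e => by
  rw [h e]; exact (hF.pay_mem e _).1

theorem Network.Follows.outflow {F : Network ℝ n m} (hF : F.Valid S) {A : Fin n → ℝ}
    {q : Fin m → ℝ} (h : F.Follows S A q) {u : Fin n} (hA : 0 ≤ A u) :
    ∑ e with F.debtor e = u, q e = min (A u) (F.debt u) := by
  rw [Network.debt, ← hF.pay_sum u (A u) hA]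
  refine Finset.sum_congr rfl fun e he => ?_
  rw [h e, (Finset.mem_filter.1 he).2]

theorem Network.sum_inflow (F : Network ℝ n m) (q : Fin m → ℝ) :
    ∑ u, F.inflow q u = ∑ e, q e :=
  Finset.sum_fiberwise _ _ _

/-- Conservation of money: what the banks pay is what the banks receive. -/
theorem Network.Follows.balance {F : Network ℝ n m} (hF : F.Valid S) {A : Fin n → ℝ}
    {q : Fin m → ℝ} (h : F.Follows S A q) (hA : ∀ u, 0 ≤ A u) :
    ∑ u, min (A u) (F.debt u) = ∑ u, F.inflow q u := by
  rw [F.sum_inflow, ← Finset.sum_fiberwise Finset.univ F.debtor]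
  exact Finset.sum_congr rfl fun u _ => (h.outflow hF (hA u)).symm

/-- A vector of payments between `p` and `q` that a monotone self-map of the interval fixes. -/
theorem exists_fixed_between {m : ℕ} {p q : Fin m → ℝ} (hpq : p ≤ q)
    (Φ : (Fin m → ℝ) → Fin m → ℝ)
    (hmono : ∀ a b, p ≤ a → a ≤ b → b ≤ q → Φ a ≤ Φ b) (hp : p ≤ Φ p) (hq : Φ q ≤ q) :
    ∃ r, p ≤ r ∧ r ≤ q ∧ Φ r = r ∧ ∀ a, p ≤ a → a ≤ q → a ≤ Φ a → a ≤ r := by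
  let P : Set (Fin m → ℝ) := {a | p ≤ a ∧ a ≤ q ∧ a ≤ Φ a}
  have hne : P.Nonempty := ⟨p, le_rfl, hpq, hp⟩
  have hbd : BddAbove P := ⟨q, fun a ha => ha.2.1⟩
  obtain ⟨r, hr⟩ : ∃ r, IsLUB P r := ⟨sSup P, isLUB_csSup hne hbd⟩
  have hpr : p ≤ r := hr.1 ⟨le_rfl, hpq, hp⟩
  have hrq : r ≤ q := hr.2 fun a ha => ha.2.1
  have h1 : r ≤ Φ r := hr.2 fun a ha => ha.2.2.trans (hmono a r ha.1 (hr.1 ha) hrq)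
  have h2 : Φ r ≤ r := hr.1 ⟨hpr.trans h1, (hmono r q hpr hrq le_rfl).trans hq,
    hmono r (Φ r) hpr h1 ((hmono r q hpr hrq le_rfl).trans hq)⟩
  exact ⟨r, hpr, hrq, le_antisymm h2 h1, fun a h1 h2 h3 => hr.1 ⟨h1, h2, h3⟩⟩

theorem Network.IsClearingState.follows {F : Network ℝ n m} {p : Fin m → ℝ}
    (hp : F.IsClearingState S p) : F.Follows S (F.assets p) p := hp.1

theorem Network.IsClearingState.nonneg {F : Network ℝ n m} (hF : F.Valid S) {p : Fin m → ℝ}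
    (hp : F.IsClearingState S p) : 0 ≤ p := hp.follows.nonneg hF

/-- The clearing state dominates every vector of payments that the banks could afford. -/
theorem Network.IsClearingState.ge {F : Network ℝ n m} (hF : F.Valid S) {p : Fin m → ℝ}
    (hp : F.IsClearingState S p) {q : Fin m → ℝ} (hq0 : 0 ≤ q)
    (hq : ∀ e, q e ≤ F.pay S e (F.assets q (F.debtor e))) : q ≤ p := by
  obtain ⟨r, -, -, hr, hmax⟩ := exists_fixed_between
    (p := q) (q := fun e => (F.liability e : ℝ)) (fun e => (hq e).trans (hF.pay_mem e _).2)
    (fun q e => F.pay S e (F.assets q (F.debtor e)))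
    (fun a b ha hab _ e => hF.pay_mono e _ _ (hF.assets_nonneg (hq0.trans ha) _)
      (F.assets_mono hab _)) hq (fun e => (hF.pay_mem e _).2)
  have h1 : q ≤ r := hmax q le_rfl (fun e => (hq e).trans (hF.pay_mem e _).2) hq
  exact h1.trans (hp.2 fun e => (congrFun hr e).symm)

theorem Network.IsClearingState.unique {F : Network ℝ n m} {p q : Fin m → ℝ}
    (hp : F.IsClearingState S p) (hq : F.IsClearingState S q) : p = q :=
  IsGreatest.unique hp hq

theorem Network.IsClearingState.clearing_eq {F : Network ℝ n m} (hF : F.Valid S)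
    {p : Fin m → ℝ} (hp : F.IsClearingState S p) : F.clearing S = p :=
  hF.isClearingState_clearing.unique hp

end Balance

/-! ### Networks in which some banks are held at fixed levels -/

section Fixed

variable {n m : ℕ} {S : PaymentScheme}

/-- The network in which each bank `u` of `X` holds the assets `lev u` whatever it receives: its
incoming claims are redirected to an additional bank without debts. -/
def Network.fixed {K : Type} [Zero K] (F : Network K n m) (X : Finset (Fin n)) (lev : Fin n → K) :
    Network K (n + 1) m where
  debtor := fun e => (F.debtor e).castSucc
  creditor := fun e => if F.creditor e ∈ X then Fin.last n else (F.creditor e).castSucc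
  liability := F.liability
  external := Fin.lastCases 0 fun u => if u ∈ X then lev u else F.external u
  rule := Fin.lastCases (.num 0) F.rule

/-- The assets of the bank `u` when the banks in `X` are held at the levels `lev`. -/
def Network.level (F : Network ℝ n m) (X : Finset (Fin n)) (lev : Fin n → ℝ) (q : Fin m → ℝ)
    (u : Fin n) : ℝ :=
  if u ∈ X then lev u else F.assets q u

theorem Network.level_of_mem (F : Network ℝ n m) {X : Finset (Fin n)} {lev : Fin n → ℝ}
    {q : Fin m → ℝ} {u : Fin n} (h : u ∈ X) : F.level X lev q u = lev u := if_pos h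

theorem Network.level_of_notMem (F : Network ℝ n m) {X : Finset (Fin n)} {lev : Fin n → ℝ}
    {q : Fin m → ℝ} {u : Fin n} (h : u ∉ X) : F.level X lev q u = F.assets q u := if_neg h

theorem Network.level_mono (F : Network ℝ n m) (X : Finset (Fin n)) {lev lev' : Fin n → ℝ}
    {q r : Fin m → ℝ} (hl : ∀ u ∈ X, lev u ≤ lev' u) (h : q ≤ r) :
    F.level X lev q ≤ F.level X lev' r := fun u => by
  unfold Network.level
  split_ifs with hu
  · exact hl u hu
  · exact F.assets_mono h u

theorem Network.Valid.level_nonneg {F : Network ℝ n m} (hF : F.Valid S) {X : Finset (Fin n)}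
    {lev : Fin n → ℝ} (hl : ∀ u ∈ X, 0 ≤ lev u) {q : Fin m → ℝ} (hq : 0 ≤ q) (u : Fin n) :
    0 ≤ F.level X lev q u := by
  unfold Network.level
  split_ifs with hu
  · exact hl u hu
  · exact hF.assets_nonneg hq u

theorem Network.fixed_pay (F : Network ℝ n m) (X : Finset (Fin n)) (lev : Fin n → ℝ) (e : Fin m) :
    (F.fixed X lev).pay S e = F.pay S e := by
  simp [Network.pay, Network.slot, Network.fixed]

theorem Network.fixed_assets (F : Network ℝ n m) (X : Finset (Fin n)) (lev : Fin n → ℝ)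
    (q : Fin m → ℝ) (u : Fin n) :
    (F.fixed X lev).assets q u.castSucc = F.level X lev q u := by
  unfold Network.assets Network.level
  by_cases hu : u ∈ X
  · have h : ∀ e, (F.fixed X lev).creditor e ≠ u.castSucc := fun e he => by
      simp only [Network.fixed] at he
      split_ifs at he with h1
      · exact (Fin.castSucc_lt_last u).ne he.symm
      · exact h1 (Fin.castSucc_injective _ he ▸ hu)
    rw [Finset.sum_eq_zero fun e he => absurd (Finset.mem_filter.1 he).2 (h e)]
    simp [hu, Network.fixed]
  · have h : ∀ e, (F.fixed X lev).creditor e = u.castSucc ↔ F.creditor e = u := fun e => by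
      simp only [Network.fixed]
      split_ifs with h1
      · refine ⟨fun he => ((Fin.castSucc_lt_last u).ne he.symm).elim, ?_⟩
        rintro rfl; exact (hu h1).elim
      · simp
    rw [if_neg hu, Network.assets]
    simp only [h]
    simp [Network.fixed, hu]

theorem Network.Valid.fixed {F : Network ℝ n m} (hF : F.Valid S) (X : Finset (Fin n))
    (lev : Fin n → ℝ) (hl : ∀ u ∈ X, 0 ≤ lev u) : (F.fixed X lev).Valid S where
  no_loop := fun e => by
    simp only [Network.fixed]
    split_ifs
    · exact (Fin.castSucc_lt_last _).ne
    · simpa using hF.no_loop e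
  liability_pos := hF.liability_pos
  external_nonneg := fun u => by
    induction u using Fin.lastCases with
    | last => simp [Network.fixed]
    | cast u =>
      simp only [Network.fixed, Fin.lastCases_castSucc]
      split_ifs with h
      · exact hl u h
      · exact hF.external_nonneg u
  pay_mem := fun e b => by rw [F.fixed_pay]; exact hF.pay_mem e b
  pay_mono := fun e x y => by rw [F.fixed_pay]; exact hF.pay_mono e x y
  pay_sum := fun u b hb => by
    simp only [F.fixed_pay]
    induction u using Fin.lastCases with
    | last => simp [Network.fixed, (Fin.castSucc_lt_last _).ne, hb]
    | cast u => simpa [Network.fixed] using hF.pay_sum u b hb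

/-- What it means for `r` to be the clearing state when the banks in `X` are held at the levels
`lev`. -/
structure Network.FixedClearing (S : PaymentScheme) (F : Network ℝ n m) (X : Finset (Fin n))
    (lev : Fin n → ℝ) (r : Fin m → ℝ) : Prop where
  follows : F.Follows S (F.level X lev r) r
  ge : ∀ q, 0 ≤ q → (∀ e, q e ≤ F.pay S e (F.level X lev q (F.debtor e))) → q ≤ r

theorem Network.IsClearingState.fixedClearing {F : Network ℝ n m} (hF : F.Valid S)
    {X : Finset (Fin n)} {lev : Fin n → ℝ} (hl : ∀ u ∈ X, 0 ≤ lev u) {r : Fin m → ℝ}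
    (hr : (F.fixed X lev).IsClearingState S r) : F.FixedClearing S X lev r where
  follows := fun e => by
    have := hr.1 e
    rw [F.fixed_pay] at this
    exact this.trans (congrArg _ (F.fixed_assets X lev r _))
  ge := fun q hq0 hq => hr.ge (hF.fixed X lev hl) hq0 fun e => by
    rw [F.fixed_pay]
    exact (hq e).trans_eq (congrArg _ (F.fixed_assets X lev q _).symm)

theorem Network.Valid.exists_fixedClearing {F : Network ℝ n m} (hF : F.Valid S)
    (X : Finset (Fin n)) (lev : Fin n → ℝ) (hl : ∀ u ∈ X, 0 ≤ lev u) :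
    ∃ r, F.FixedClearing S X lev r :=
  let ⟨r, hr⟩ := (hF.fixed X lev hl).exists_isClearingState
  ⟨r, hr.fixedClearing hF hl⟩

theorem Network.FixedClearing.mono {F : Network ℝ n m} (hF : F.Valid S) {X : Finset (Fin n)}
    {lev lev' : Fin n → ℝ} (hl : ∀ u ∈ X, 0 ≤ lev u) (hle : ∀ u ∈ X, lev u ≤ lev' u)
    {r r' : Fin m → ℝ} (hr : F.FixedClearing S X lev r) (hr' : F.FixedClearing S X lev' r') :
    r ≤ r' :=
  hr'.ge r (hr.follows.nonneg hF) fun e => (hr.follows e).trans_le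
    (hF.pay_mono e _ _ (hF.level_nonneg hl (hr.follows.nonneg hF) _)
      (F.level_mono X hle le_rfl _))

/-- A clearing state stays below the clearing state with some banks held at higher levels. -/
theorem Network.FixedClearing.ge_clearing {F : Network ℝ n m} (hF : F.Valid S)
    {X : Finset (Fin n)} {lev : Fin n → ℝ} {p r : Fin m → ℝ} (hp : F.IsClearingState S p)
    (hr : F.FixedClearing S X lev r) (hle : ∀ u ∈ X, F.assets p u ≤ lev u) : p ≤ r :=
  hr.ge p (hp.nonneg hF) fun e => (hp.1 e).trans_le
    (hF.pay_mono e _ _ (hF.assets_nonneg (hp.nonneg hF) _) (by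
      unfold Network.level
      split_ifs with h
      · exact hle _ h
      · exact le_rfl))

end Fixed


/-! ### Levels that a trade achieves -/

section Trades

variable {n m : ℕ} {S : PaymentScheme}

/-- A bank with debt `L` and assets `a` pays `min a L`. If it passes on all of an increase of its
assets from `a` to `c`, then also all of a smaller increase. -/
theorem min_sub_min_of_between {a b c L : ℝ} (hab : a ≤ b) (hbc : b ≤ c)
    (h : min c L - min a L = c - a) : min b L - min a L = b - a := by
  rcases le_total a L with h1 | h1 <;> rcases le_total b L with h2 | h2 <;>
  rcases le_total c L with h3 | h3 <;> simp only [min_eq_left, min_eq_right, h1, h2, h3] at h ⊢ <;>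
  linarith

theorem min_sub_min_le {a b : ℝ} (L : ℝ) (hab : a ≤ b) : min b L - min a L ≤ b - a := by
  rcases le_total a L with h1 | h1 <;> rcases le_total b L with h2 | h2 <;>
  simp only [min_eq_left, min_eq_right, h1, h2] <;> linarith

theorem sum_eq_add_add_sum_erase {n : ℕ} {v w : Fin n} (hvw : v ≠ w) (f : Fin n → ℝ) :
    ∑ u, f u = f v + f w + ∑ u ∈ (univ.erase v).erase w, f u := by
  rw [← Finset.add_sum_erase univ f (mem_univ v),
    ← Finset.add_sum_erase (univ.erase v) f (mem_erase.2 ⟨hvw.symm, mem_univ w⟩), add_assoc]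

/-- If a transfer from `w` to `v` makes nobody worse off, and no bank keeps any of its additional
assets, then the assets of `w` do not change at all: otherwise the payments that `w` would make from
its higher assets could circulate without the transfer, and `p` would not be maximal. -/
theorem Network.IsClearingState.payer_assets_eq {F : Network ℝ n m} (hF : F.Valid S)
    {p : Fin m → ℝ} (hp : F.IsClearingState S p) {v w : Fin n} {x : ℝ} (hx : 0 ≤ x)
    {q : Fin m → ℝ} {A : Fin n → ℝ} (hpq : p ≤ q)
    (hA : ∀ u, A u = F.assets q u + (if u = v then x else 0) - (if u = w then x else 0))
    (hq : F.Follows S A q) (hle : ∀ u, F.assets p u ≤ A u)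
    (hsave : ∀ u, min (A u) (F.debt u) - min (F.assets p u) (F.debt u) = A u - F.assets p u) :
    A w = F.assets p w := by
  have hp0 := hp.nonneg hF
  have hl : ∀ u ∈ ({w} : Finset (Fin n)), 0 ≤ A u := fun u _ =>
    (hF.assets_nonneg hp0 u).trans (hle u)
  have hlevA : ∀ {a : Fin m → ℝ}, a ≤ q → ∀ u, F.level {w} A a u ≤ A u := fun {a} haq u => by
    unfold Network.level
    split_ifs with h
    · exact le_rfl
    · rw [hA u, if_neg (c := u = w) (by simpa using h)]
      have := F.assets_mono haq u
      split_ifs <;> linarith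
  have hlevp : ∀ {a : Fin m → ℝ}, p ≤ a → ∀ u, F.assets p u ≤ F.level {w} A a u :=
    fun {a} hpa u => by
      unfold Network.level
      split_ifs with h
      · exact hle u
      · exact F.assets_mono hpa u
  obtain ⟨r, hpr, hrq, hr, -⟩ := exists_fixed_between hpq
    (fun a e => F.pay S e (F.level {w} A a (F.debtor e)))
    (fun a b ha hab _ e => hF.pay_mono e _ _ (hF.level_nonneg hl (hp0.trans ha) _)
      (F.level_mono _ (fun _ _ => le_rfl) hab _))
    (fun e => (hp.1 e).trans_le (hF.pay_mono e _ _ (hF.assets_nonneg hp0 _) (hlevp le_rfl _)))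
    (fun e => (hF.pay_mono e _ _ (hF.level_nonneg hl (hp0.trans hpq) _)
      (hlevA le_rfl _)).trans_eq (hq e).symm)
  have hrF : F.Follows S (F.level {w} A r) r := fun e => (congrFun hr e).symm
  have hB := hrF.balance hF (hF.level_nonneg hl (hp0.trans hpr))
  have hA0 := hp.follows.balance hF (hF.assets_nonneg hp0)
  have hnos : ∀ u, min (F.level {w} A r u) (F.debt u) - min (F.assets p u) (F.debt u)
      = F.level {w} A r u - F.assets p u := fun u =>
    min_sub_min_of_between (hlevp hpr u) (hlevA hrq u) (hsave u)
  have hsum : ∑ u, (F.level {w} A r u - F.assets p u) = ∑ u, (F.inflow r u - F.inflow p u) := by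
    rw [Finset.sum_sub_distrib (f := F.inflow r), ← hB, ← hA0, ← Finset.sum_sub_distrib]
    exact Finset.sum_congr rfl fun u _ => (hnos u).symm
  have hw : F.assets r w = A w := by
    rw [← Finset.add_sum_erase univ _ (mem_univ w), ← Finset.add_sum_erase univ _ (mem_univ w)]
      at hsum
    have h1 : ∑ u ∈ univ.erase w, (F.level {w} A r u - F.assets p u)
        = ∑ u ∈ univ.erase w, (F.inflow r u - F.inflow p u) := by
      refine Finset.sum_congr rfl fun u hu => ?_
      rw [F.level_of_notMem (by simpa using (mem_erase.1 hu).1), F.assets_eq, F.assets_eq]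
      ring
    rw [h1, F.level_of_mem (mem_singleton_self w), F.assets_eq p] at hsum
    rw [F.assets_eq]
    linarith
  have hlev : F.level {w} A r = F.assets r := funext fun u => by
    unfold Network.level
    split_ifs with h
    · rw [mem_singleton.1 h, hw]
    · rfl
  have hrp : r ≤ p := hp.2 fun e => by rw [hrF e, hlev]
  rw [← hw, le_antisymm hrp hpr]

theorem Network.IsMultiTrade.valid {F : Network ℝ n m} (hF : F.Valid S) {v w : Fin n} {ρ : ℝ}
    {T : MultiTrade ℝ m} (hT : F.IsMultiTrade v w ρ T) : (F.afterTrade v w T).Valid S where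
  no_loop := fun e => by
    simp only [Network.afterTrade]
    split_ifs with h
    · exact hT.debtor_ne e h
    · exact hF.no_loop e
  liability_pos := hF.liability_pos
  external_nonneg := fun u => by
    have h0 : 0 ≤ F.tradeReturn T := Finset.sum_nonneg fun e he =>
      mul_nonneg (hT.rate_mem e he).1 (Nat.cast_nonneg _)
    have h1 := hT.affordable
    have h2 := hF.external_nonneg v
    simp only [Network.afterTrade]
    split_ifs
    · linarith
    · linarith
    · exact hF.external_nonneg u
  pay_mem := hF.pay_mem
  pay_mono := hF.pay_mono
  pay_sum := hF.pay_sum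

/-- Total assets after a trade: `v` receives the return and loses the payments of the traded
claims, and conversely for `w`. -/
theorem Network.IsMultiTrade.assets_afterTrade {F : Network ℝ n m} {v w : Fin n} {ρ : ℝ}
    {T : MultiTrade ℝ m} (hT : F.IsMultiTrade v w ρ T) (q : Fin m → ℝ) (u : Fin n) :
    (F.afterTrade v w T).assets q u = F.assets q u
      + (if u = v then F.tradeReturn T - ∑ e ∈ T.claims, q e else 0)
      - (if u = w then F.tradeReturn T - ∑ e ∈ T.claims, q e else 0) := by
  have hin : ∑ e with (F.afterTrade v w T).creditor e = u, q e
      = ∑ e with F.creditor e = u, q e - (if u = v then ∑ e ∈ T.claims, q e else 0)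
        + (if u = w then ∑ e ∈ T.claims, q e else 0) := by
    have key : ∀ e, (if (F.afterTrade v w T).creditor e = u then q e else 0)
        = (if F.creditor e = u then q e else 0)
          - (if u = v then (if e ∈ T.claims then q e else 0) else 0)
          + (if u = w then (if e ∈ T.claims then q e else 0) else 0) := fun e => by
      simp only [Network.afterTrade]
      by_cases he : e ∈ T.claims
      · have h1 := hT.incoming e he
        have h2 := hT.distinct
        simp only [he, if_true, h1, eq_comm (a := u)]
        split_ifs <;> simp
      · simp [he]
    rw [Finset.sum_filter, Finset.sum_congr rfl fun e _ => key e, Finset.sum_add_distrib,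
      Finset.sum_sub_distrib, ← Finset.sum_filter]
    congr 1
    · congr 1
      split_ifs <;> simp
    · split_ifs <;> simp
  have hvw := hT.distinct
  unfold Network.assets
  rw [hin]
  simp only [Network.afterTrade]
  by_cases h1 : u = v
  · subst h1; simp [hvw]; ring
  · by_cases h2 : u = w
    · subst h2; simp [h1]; ring
    · simp [h1, h2]

/-- The shape of a trade that makes neither of its partners worse off and strictly improves `v`:
all payments grow, no bank keeps any of its additional assets, the net transfer from `w` to `v` is
positive and the assets of `w` do not change. -/
theorem Network.IsExactPositive.structure {F : Network ℝ n m} (hF : F.Valid S) {v w : Fin n}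
    {p q : Fin m → ℝ} (hp : F.IsClearingState S p) {T : MultiTrade ℝ m}
    (hT : F.IsExactPositive S v w T) (hq : (F.afterTrade v w T).IsClearingState S q) :
    p ≤ q ∧ F.assets p v < (F.afterTrade v w T).assets q v ∧
    (∀ u, F.assets p u ≤ (F.afterTrade v w T).assets q u) ∧
    (∀ u, min ((F.afterTrade v w T).assets q u) (F.debt u) - min (F.assets p u) (F.debt u)
      = (F.afterTrade v w T).assets q u - F.assets p u) ∧
    0 < F.tradeReturn T - ∑ e ∈ T.claims, q e ∧
    (F.afterTrade v w T).assets q w = F.assets p w := by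
  obtain ⟨hM, hv, hw⟩ := hT
  have hF' := hM.valid hF
  unfold Network.totalAssets at hv hw
  rw [hp.clearing_eq hF, hq.clearing_eq hF'] at hv hw
  set A := (F.afterTrade v w T).assets q with hA
  have hq0 := hq.nonneg hF'
  have hp0 := hp.nonneg hF
  have hother : ∀ a u, u ≠ v → u ≠ w → (F.afterTrade v w T).assets a u = F.assets a u :=
    fun a u h1 h2 => by rw [hM.assets_afterTrade]; simp [h1, h2]
  have hpq : p ≤ q := by
    refine le_sup_left.trans (hq.ge hF' (q := p ⊔ q) (hp0.trans le_sup_left) fun e => ?_)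
    set u := F.debtor e with hu
    have h2 : A u ≤ (F.afterTrade v w T).assets (p ⊔ q) u :=
      Network.assets_mono _ le_sup_right u
    have h1 : F.assets p u ≤ (F.afterTrade v w T).assets (p ⊔ q) u := by
      by_cases h1 : u = v
      · rw [h1] at h2 ⊢; exact hv.le.trans h2
      by_cases h3 : u = w
      · rw [h3] at h2 ⊢; exact hw.trans h2
      rw [hother _ _ h1 h3]
      exact F.assets_mono le_sup_left u
    refine sup_le ?_ ?_
    · rw [hp.1 e]; exact hF.pay_mono e _ _ (hF.assets_nonneg hp0 _) h1
    · rw [hq.1 e]; exact hF.pay_mono e _ _ (hF'.assets_nonneg hq0 _) h2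
  have hle : ∀ u, F.assets p u ≤ A u := fun u => by
    by_cases h1 : u = v
    · rw [h1]; exact hv.le
    by_cases h3 : u = w
    · rw [h3]; exact hw
    rw [hA, hother _ _ h1 h3]
    exact F.assets_mono hpq u
  have hfol : F.Follows S A q := hq.follows
  set x := F.tradeReturn T - ∑ e ∈ T.claims, q e with hx
  have hform : ∀ u, A u = F.assets q u + (if u = v then x else 0) - (if u = w then x else 0) :=
    hM.assets_afterTrade q
  have hA0 : ∀ u, 0 ≤ A u := hF'.assets_nonneg hq0
  have hsum : ∑ u, (min (A u) (F.debt u) - min (F.assets p u) (F.debt u))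
      = ∑ u, (A u - F.assets p u) := by
    rw [Finset.sum_sub_distrib, hfol.balance hF hA0,
      hp.follows.balance hF (hF.assets_nonneg hp0), ← Finset.sum_sub_distrib]
    have : ∀ u, A u - F.assets p u = F.inflow q u - F.inflow p u
        + (if u = v then x else 0) - (if u = w then x else 0) := fun u => by
      rw [hform u, F.assets_eq, F.assets_eq]; ring
    rw [Finset.sum_congr rfl fun u _ => this u]
    simp [Finset.sum_sub_distrib, Finset.sum_add_distrib]
  have hsave : ∀ u, min (A u) (F.debt u) - min (F.assets p u) (F.debt u) = A u - F.assets p u :=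
    fun u => (Finset.sum_eq_sum_iff_of_le fun u _ => min_sub_min_le _ (hle u)).1 hsum u
      (mem_univ u)
  have hxpos : 0 < x := by
    by_contra hx0
    rcases eq_or_lt_of_le (not_lt.1 hx0) with h0 | h0
    · have hAF : A = F.assets q := funext fun u => by rw [hform u, h0]; simp
      have := hp.2 (show F.Follows S (F.assets q) q from hAF ▸ hfol)
      exact absurd (F.assets_mono this v) (not_le.2 (hAF ▸ hv))
    · have := hp.payer_assets_eq hF (v := w) (w := v) (x := -x) (by linarith) hpq
        (fun u => by rw [hform u]; split_ifs <;> ring) hfol hle hsave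
      exact hv.ne' this
  exact ⟨hpq, hv, hle, hsave, hxpos, hp.payer_assets_eq hF hxpos.le hpq hform hfol hle hsave⟩

/-- The assets at which the trading partners are held: `b` for `v`, and `c` for the other one. The
values at further banks play no role. -/
def partnerLevel {K : Type} {n : ℕ} (v : Fin n) (b c : K) (u : Fin n) : K :=
  if u = v then b else c

theorem level_partner_left (F : Network ℝ n m) (v w : Fin n) (b c : ℝ) (q : Fin m → ℝ) :
    F.level {v, w} (partnerLevel v b c) q v = b := by
  simp [Network.level, partnerLevel]

theorem level_partner_right (F : Network ℝ n m) {v w : Fin n} (hvw : v ≠ w) (b c : ℝ)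
    (q : Fin m → ℝ) : F.level {v, w} (partnerLevel v b c) q w = c := by
  simp [Network.level, partnerLevel, hvw.symm]

theorem level_partner_other (F : Network ℝ n m) {v w u : Fin n} (hv : u ≠ v) (hw : u ≠ w)
    (b c : ℝ) (q : Fin m → ℝ) :
    F.level {v, w} (partnerLevel v b c) q u = F.assets q u := by
  simp [Network.level, hv, hw]

/-- The net transfer from the buyer that lifts the assets of `v` to the level `b`. -/
def Network.transfer {K : Type} [AddCommGroup K] (F : Network K n m) (v : Fin n) (b : K)
    (r : Fin m → K) : K :=
  b - F.external v - F.inflow r v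

/-- Money conservation between the clearing state and a state with `v` held at the level `b`. -/
theorem balance_partner {F : Network ℝ n m} (hF : F.Valid S) {p r : Fin m → ℝ}
    (hp : F.IsClearingState S p) {v w : Fin n} (hvw : v ≠ w) {b : ℝ} (hb : F.assets p v ≤ b)
    (hr : F.Follows S (F.level {v, w} (partnerLevel v b (F.assets p w)) r) r) :
    F.inflow r v - F.inflow p v + (F.inflow r w - F.inflow p w)
      = (min b (F.debt v) - min (F.assets p v) (F.debt v))
        - ∑ u ∈ (univ.erase v).erase w, (F.inflow r u - F.inflow p u
          - (min (F.assets r u) (F.debt u) - min (F.assets p u) (F.debt u))) := by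
  have hp0 := hp.nonneg hF
  have hl : ∀ u ∈ ({v, w} : Finset (Fin n)), 0 ≤ partnerLevel v b (F.assets p w) u := fun u _ => by
    unfold partnerLevel
    split_ifs
    · exact (hF.assets_nonneg hp0 v).trans hb
    · exact hF.assets_nonneg hp0 w
  have h1 := hr.balance hF (hF.level_nonneg hl (hr.nonneg hF))
  have h2 := hp.follows.balance hF (hF.assets_nonneg hp0)
  rw [sum_eq_add_add_sum_erase hvw, sum_eq_add_add_sum_erase hvw (F.inflow r),
    level_partner_left, level_partner_right F hvw] at h1
  rw [sum_eq_add_add_sum_erase hvw, sum_eq_add_add_sum_erase hvw (F.inflow p)] at h2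
  have h3 : ∑ u ∈ (univ.erase v).erase w,
      min (F.level {v, w} (partnerLevel v b (F.assets p w)) r u) (F.debt u)
      = ∑ u ∈ (univ.erase v).erase w, min (F.assets r u) (F.debt u) := by
    refine Finset.sum_congr rfl fun u hu => ?_
    rw [level_partner_other F (mem_erase.1 (mem_erase.1 hu).2).1 (mem_erase.1 hu).1]
  rw [h3] at h1
  simp only [Finset.sum_sub_distrib]
  linarith

/-- Without savings the transfer comes back to the buyer in full. -/
theorem transfer_eq_inflow {F : Network ℝ n m} (hF : F.Valid S) {p r : Fin m → ℝ}
    (hp : F.IsClearingState S p) {v w : Fin n} (hvw : v ≠ w) {b : ℝ} (hb : F.assets p v ≤ b)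
    (hr : F.Follows S (F.level {v, w} (partnerLevel v b (F.assets p w)) r) r)
    (hv : min b (F.debt v) - min (F.assets p v) (F.debt v) = b - F.assets p v)
    (hu : ∀ u, u ≠ v → u ≠ w → min (F.assets r u) (F.debt u) - min (F.assets p u) (F.debt u)
      = F.assets r u - F.assets p u) :
    F.transfer v b r = F.inflow r w - F.inflow p w := by
  have h := balance_partner hF hp hvw hb hr
  rw [Finset.sum_eq_zero, hv, F.assets_eq] at h
  · unfold Network.transfer; linarith
  · intro u hu'
    rw [hu u (mem_erase.1 (mem_erase.1 hu').2).1 (mem_erase.1 hu').1, F.assets_eq, F.assets_eq]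
    ring

/-- A transfer that comes back to the buyer in full and lifts `v` is positive, since otherwise the
higher payments were possible without it. -/
theorem transfer_pos {F : Network ℝ n m} {p r : Fin m → ℝ}
    (hp : F.IsClearingState S p) {v w : Fin n} (hvw : v ≠ w) {b : ℝ} (hb : F.assets p v < b)
    (hr : F.Follows S (F.level {v, w} (partnerLevel v b (F.assets p w)) r) r) (hpr : p ≤ r)
    (hx : F.transfer v b r = F.inflow r w - F.inflow p w) : 0 < F.transfer v b r := by
  refine lt_of_le_of_ne (hx ▸ sub_nonneg.2 (F.inflow_mono hpr w)) fun h0 => ?_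
  have hv : F.assets r v = b := by
    rw [F.assets_eq]; unfold Network.transfer at h0; linarith
  have hw : F.assets r w = F.assets p w := by
    rw [F.assets_eq, F.assets_eq]; linarith
  have hlev : F.level {v, w} (partnerLevel v b (F.assets p w)) r = F.assets r := funext fun u => by
    by_cases h1 : u = v
    · rw [h1, level_partner_left, hv]
    by_cases h2 : u = w
    · rw [h2, level_partner_right F hvw, hw]
    exact level_partner_other F h1 h2 _ _ _
  have := F.assets_mono (hp.2 (show F.Follows S (F.assets r) r from hlev ▸ hr)) v
  linarith

/-- Every level of `v` up to the one that an exact creditor-positive trade achieves is achieved by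
the same set of claims, with a return that is not larger. -/
theorem Network.IsExactPositive.lower_level {F : Network ℝ n m} (hF : F.Valid S) {v w : Fin n}
    {p : Fin m → ℝ} (hp : F.IsClearingState S p) {T : MultiTrade ℝ m}
    (hT : F.IsExactPositive S v w T) {b : ℝ} (hb : F.assets p v < b)
    (hb' : b ≤ (F.afterTrade v w T).totalAssets S v) {r : Fin m → ℝ}
    (hr : F.FixedClearing S {v, w} (partnerLevel v b (F.assets p w)) r) :
    p ≤ r ∧ F.transfer v b r = F.inflow r w - F.inflow p w ∧ 0 < F.transfer v b r ∧
    b ≤ F.debt v ∧ (∀ u, u ≠ v → u ≠ w → min (F.assets r u) (F.debt u)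
      - min (F.assets p u) (F.debt u) = F.assets r u - F.assets p u) ∧
    F.transfer v b r + ∑ e ∈ T.claims, r e ≤ F.tradeReturn T := by
  have hM := hT.1
  have hvw := hM.distinct
  have hF' := hM.valid hF
  obtain ⟨q, hq⟩ := hF'.exists_isClearingState
  obtain ⟨hpq, hv, hle, hsave, hx, hw⟩ := hT.structure hF hp hq
  unfold Network.totalAssets at hb'
  rw [hq.clearing_eq hF'] at hb'
  have hp0 := hp.nonneg hF
  have hq0 := hq.nonneg hF'
  have hr0 := hr.follows.nonneg hF
  have hother : ∀ a u, u ≠ v → u ≠ w → (F.afterTrade v w T).assets a u = F.assets a u :=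
    fun a u h1 h2 => by rw [hM.assets_afterTrade]; simp [h1, h2]
  have hpr : p ≤ r := hr.ge_clearing hF hp fun u hu => by
    unfold partnerLevel
    split_ifs with h
    · rw [h]; exact hb.le
    · rw [(mem_insert.1 hu).resolve_left h |> mem_singleton.1]
  have hl : ∀ u ∈ ({v, w} : Finset (Fin n)), 0 ≤ partnerLevel v b (F.assets p w) u := fun u _ => by
    unfold partnerLevel
    split_ifs
    · exact (hF.assets_nonneg hp0 v).trans hb.le
    · exact hF.assets_nonneg hp0 w
  have hrq : r ≤ q := by
    refine le_sup_left.trans (hq.ge hF' (q := r ⊔ q) (hr0.trans le_sup_left) fun e => ?_)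
    set u := F.debtor e with hu
    have h2 : (F.afterTrade v w T).assets q u ≤ (F.afterTrade v w T).assets (r ⊔ q) u :=
      Network.assets_mono _ le_sup_right u
    have h1 : F.level {v, w} (partnerLevel v b (F.assets p w)) r u
        ≤ (F.afterTrade v w T).assets (r ⊔ q) u := by
      by_cases h1 : u = v
      · rw [h1] at h2 ⊢
        rw [level_partner_left]
        exact hb'.trans h2
      by_cases h3 : u = w
      · rw [h3] at h2 ⊢
        rw [level_partner_right F hvw]
        exact (hle w).trans h2
      rw [hother _ _ h1 h3, level_partner_other F h1 h3]
      exact F.assets_mono le_sup_left u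
    refine sup_le ?_ ?_
    · rw [hr.follows e]; exact hF.pay_mono e _ _ (hF.level_nonneg hl hr0 _) h1
    · rw [hq.1 e]; exact hF.pay_mono e _ _ (hF'.assets_nonneg hq0 _) h2
  have hnos : ∀ u, u ≠ v → u ≠ w → min (F.assets r u) (F.debt u)
      - min (F.assets p u) (F.debt u) = F.assets r u - F.assets p u := fun u h1 h2 => by
    refine min_sub_min_of_between (F.assets_mono hpr u) (F.assets_mono hrq u) ?_
    rw [← hother q u h1 h2]; exact hsave u
  have htr := transfer_eq_inflow hF hp hvw hb.le hr.follows
    (min_sub_min_of_between hb.le hb' (hsave v)) hnos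
  have hdv : b ≤ F.debt v := by
    have := hsave v
    by_contra hcon
    rw [min_eq_right (by linarith)] at this
    rcases min_choice (F.assets p v) (F.debt v) with h | h <;> rw [h] at this <;> linarith
  refine ⟨hpr, htr, transfer_pos hp hvw hb hr.follows hpr htr, hdv, hnos, ?_⟩
  -- The additional inflow of `v` is at most the additional assets of `v`.
  have hfv := hM.assets_afterTrade q v
  have hfw := hM.assets_afterTrade q w
  rw [hw] at hfw
  simp only [if_true, hvw, hvw.symm, if_false] at hfv hfw
  have hsplit : ∀ a : Fin m → ℝ, F.inflow a v
      = ∑ e ∈ T.claims, a e + ∑ e ∈ ({e | F.creditor e = v} : Finset (Fin m)) \ T.claims, a e :=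
    fun a => by
      rw [Network.inflow, add_comm]
      exact (Finset.sum_sdiff fun e he => by simpa using hM.incoming e he).symm
  have hrest : ∑ e ∈ ({e | F.creditor e = v} : Finset (Fin m)) \ T.claims, r e
      ≤ ∑ e ∈ ({e | F.creditor e = v} : Finset (Fin m)) \ T.claims, q e :=
    Finset.sum_le_sum fun e _ => hrq e
  have hrw := F.inflow_mono hrq w
  have hClaims : ∑ e ∈ T.claims, r e ≤ ∑ e ∈ T.claims, q e := Finset.sum_le_sum fun e _ => hrq e
  rw [F.assets_eq] at hfv hfw
  rw [F.assets_eq] at hfw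
  have h3 := hsplit r
  have h4 := hsplit q
  unfold Network.transfer at htr ⊢
  linarith

/-- A trade whose return makes up for the payments that `v` gives up and for the missing assets
achieves the level `b`, since the payments `r` can then be afforded. -/
theorem achieves_level {F : Network ℝ n m} (hF : F.Valid S) {v w : Fin n} {p : Fin m → ℝ}
    (hp : F.IsClearingState S p) {b : ℝ} (hb : 0 ≤ b) {r : Fin m → ℝ}
    (hr : F.FixedClearing S {v, w} (partnerLevel v b (F.assets p w)) r)
    (hw : F.assets p w ≤ F.external w - F.transfer v b r + F.inflow r w)
    {T : MultiTrade ℝ m} {ρ : ℝ} (hM : F.IsMultiTrade v w ρ T)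
    (hT : F.tradeReturn T = F.transfer v b r + ∑ e ∈ T.claims, r e) :
    b ≤ (F.afterTrade v w T).totalAssets S v ∧
      F.totalAssets S w ≤ (F.afterTrade v w T).totalAssets S w := by
  have hvw := hM.distinct
  have hF' := hM.valid hF
  obtain ⟨q, hq⟩ := hF'.exists_isClearingState
  unfold Network.totalAssets
  rw [hp.clearing_eq hF, hq.clearing_eq hF']
  have hp0 := hp.nonneg hF
  have hr0 := hr.follows.nonneg hF
  have hl : ∀ u ∈ ({v, w} : Finset (Fin n)), 0 ≤ partnerLevel v b (F.assets p w) u := fun u _ => by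
    unfold partnerLevel
    split_ifs
    · exact hb
    · exact hF.assets_nonneg hp0 w
  have hlev : ∀ u, F.level {v, w} (partnerLevel v b (F.assets p w)) r u
      ≤ (F.afterTrade v w T).assets r u := fun u => by
    rw [hM.assets_afterTrade, hT]
    by_cases h1 : u = v
    · rw [h1, level_partner_left, F.assets_eq]
      simp [hvw, Network.transfer]
    by_cases h2 : u = w
    · rw [h2, level_partner_right F hvw, F.assets_eq r]
      simp only [hvw.symm, if_false, if_true]
      linarith
    rw [level_partner_other F h1 h2]
    simp [h1, h2]
  have hrq : r ≤ q := hq.ge hF' hr0 fun e => (hr.follows e).trans_le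
    (hF.pay_mono e _ _ (hF.level_nonneg hl hr0 _) (hlev _))
  constructor
  · have := (hlev v).trans (Network.assets_mono _ hrq v)
    rwa [level_partner_left] at this
  · have := (hlev w).trans (Network.assets_mono _ hrq w)
    rwa [level_partner_right F hvw] at this

end Trades


/-! ### Small increases of the assets of the creditor -/

section SmallLevels

variable {n m : ℕ} {S : PaymentScheme}

theorem Network.Valid.pay_sum_sub {F : Network ℝ n m} (hF : F.Valid S) (u : Fin n) {a b : ℝ}
    (ha : 0 ≤ a) (hab : a ≤ b) :
    ∑ e with F.debtor e = u, (F.pay S e b - F.pay S e a)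
      = min b (F.debt u) - min a (F.debt u) := by
  rw [Finset.sum_sub_distrib, hF.pay_sum u b (ha.trans hab), hF.pay_sum u a ha]
  rfl

theorem Network.Valid.pay_sub_le {F : Network ℝ n m} (hF : F.Valid S) (e : Fin m) {a b : ℝ}
    (ha : 0 ≤ a) (hab : a ≤ b) : F.pay S e b - F.pay S e a ≤ b - a := by
  refine le_trans ?_ ((hF.pay_sum_sub (F.debtor e) ha hab).trans_le (min_sub_min_le _ hab))
  exact Finset.single_le_sum (f := fun e' => F.pay S e' b - F.pay S e' a)
    (fun e' _ => sub_nonneg.2 (hF.pay_mono e' b a ha hab)) (by simp)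

theorem Network.Valid.continuousOn_pay {F : Network ℝ n m} (hF : F.Valid S) (e : Fin m) :
    ContinuousOn (F.pay S e) (Set.Ici 0) := by
  refine LipschitzOnWith.continuousOn (K := 1) (LipschitzOnWith.of_dist_le_mul ?_)
  intro a ha b hb
  simp only [Set.mem_Ici] at ha hb
  rw [Real.dist_eq, Real.dist_eq, NNReal.coe_one, one_mul]
  rcases le_total a b with h | h
  · rw [abs_sub_comm, abs_sub_comm a, abs_of_nonneg (sub_nonneg.2 h),
      abs_of_nonneg (sub_nonneg.2 (hF.pay_mono e b a ha h))]
    exact hF.pay_sub_le e ha h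
  · rw [abs_of_nonneg (sub_nonneg.2 h),
      abs_of_nonneg (sub_nonneg.2 (hF.pay_mono e a b hb h))]
    exact hF.pay_sub_le e hb h

theorem partnerLevel_nonneg {F : Network ℝ n m} (hF : F.Valid S) {p : Fin m → ℝ}
    (hp0 : 0 ≤ p) (v w : Fin n) {b : ℝ} (hb : 0 ≤ b) (u : Fin n) :
    0 ≤ partnerLevel v b (F.assets p w) u := by
  unfold partnerLevel
  split_ifs
  · exact hb
  · exact hF.assets_nonneg hp0 w

theorem FixedClearing.partner_ge {F : Network ℝ n m} (hF : F.Valid S) {p r : Fin m → ℝ}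
    (hp : F.IsClearingState S p) {v w : Fin n} {b : ℝ} (hb : F.assets p v ≤ b)
    (hr : F.FixedClearing S {v, w} (partnerLevel v b (F.assets p w)) r) : p ≤ r :=
  hr.ge_clearing hF hp fun u hu => by
    unfold partnerLevel
    split_ifs with h
    · rw [h]; exact hb
    · rw [(mem_insert.1 hu).resolve_left h |> mem_singleton.1]

/-- As the level of `v` tends to its assets from above, so do the assets of all banks. -/
theorem exists_level_le_add {F : Network ℝ n m} (hF : F.Valid S) {p : Fin m → ℝ}
    (hp : F.IsClearingState S p) {v w : Fin n} (hvw : v ≠ w) {c η : ℝ} (hc : F.assets p v < c)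
    (hη : 0 < η) : ∃ b r, F.assets p v < b ∧ b ≤ c ∧
      F.FixedClearing S {v, w} (partnerLevel v b (F.assets p w)) r ∧
      ∀ u, F.level {v, w} (partnerLevel v b (F.assets p w)) r u ≤ F.assets p u + η := by
  have hp0 := hp.nonneg hF
  have hv0 := hF.assets_nonneg hp0 v
  set g := c - F.assets p v with hg
  have hg0 : 0 < g := sub_pos.2 hc
  let b : ℕ → ℝ := fun k => F.assets p v + g / (k + 1)
  have hbv : ∀ k, F.assets p v < b k := fun k => by
    have : 0 < g / ((k : ℝ) + 1) := by positivity
    simp only [b]; linarith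
  have hbc : ∀ k, b k ≤ c := fun k => by
    have : g / ((k : ℝ) + 1) ≤ g := div_le_self hg0.le (by linarith [(Nat.cast_nonneg k : (0:ℝ) ≤
        k)])
    simp only [b]; linarith
  have hb0 : ∀ k, 0 ≤ b k := fun k => hv0.trans (hbv k).le
  have hbanti : Antitone b := fun i j hij => by
    simp only [b]
    gcongr
  choose r hr using fun k => hF.exists_fixedClearing (S := S) {v, w}
    (partnerLevel v (b k) (F.assets p w)) fun u _ => partnerLevel_nonneg hF hp0 v w (hb0 k) u
  have hpr : ∀ k, p ≤ r k := fun k => FixedClearing.partner_ge hF hp (hbv k).le (hr k)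
  have hranti : Antitone r := fun i j hij => by
    refine Network.FixedClearing.mono hF (fun u _ => partnerLevel_nonneg hF hp0 v w (hb0 j) u) ?_
      (hr j) (hr i)
    intro u _
    unfold partnerLevel
    split_ifs
    · exact hbanti hij
    · exact le_rfl
  let q : Fin m → ℝ := fun e => ⨅ k, r k e
  have hbdd : ∀ e, BddBelow (Set.range fun k => r k e) := fun e =>
    ⟨p e, by rintro _ ⟨k, rfl⟩; exact hpr k e⟩
  have hlim : ∀ e, Filter.Tendsto (fun k => r k e) Filter.atTop (nhds (q e)) := fun e =>
    tendsto_atTop_ciInf (fun i j hij => hranti hij e) (hbdd e)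
  have hpq : p ≤ q := fun e => le_ciInf fun k => hpr k e
  have hblim : Filter.Tendsto b Filter.atTop (nhds (F.assets p v)) := by
    have h1 : Filter.Tendsto (fun k : ℕ => g * (1 / ((k : ℝ) + 1))) Filter.atTop (nhds (g * 0)) :=
      tendsto_one_div_add_atTop_nhds_zero_nat.const_mul g
    have h2 := h1.const_add (F.assets p v)
    simp only [mul_zero, add_zero] at h2
    refine h2.congr fun k => ?_
    simp only [b]; ring
  set lev := partnerLevel v (F.assets p v) (F.assets p w) with hlev
  have hlevlim : ∀ u, Filter.Tendsto
      (fun k => F.level {v, w} (partnerLevel v (b k) (F.assets p w)) (r k) u) Filter.atTop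
      (nhds (F.level {v, w} lev q u)) := fun u => by
    by_cases h1 : u = v
    · rw [h1, hlev]; simp only [level_partner_left]; exact hblim
    by_cases h2 : u = w
    · rw [h2, hlev]; simp only [level_partner_right F hvw]; exact tendsto_const_nhds
    rw [hlev]
    simp only [level_partner_other F h1 h2]
    exact (tendsto_finsetSum _ fun e _ => hlim e).const_add _
  have hq : F.Follows S (F.level {v, w} lev q) q := fun e => by
    refine tendsto_nhds_unique (hlim e) ?_
    have h1 : ∀ k, r k e = _ := fun k => (hr k).follows e
    simp only [h1]
    have hnn : ∀ k u, 0 ≤ F.level {v, w} (partnerLevel v (b k) (F.assets p w)) (r k) u :=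
      fun k u => hF.level_nonneg (fun u _ => partnerLevel_nonneg hF hp0 v w (hb0 k) u)
        (hp0.trans (hpr k)) u
    have h0 : 0 ≤ F.level {v, w} lev q (F.debtor e) :=
      hF.level_nonneg (fun u _ => partnerLevel_nonneg hF hp0 v w hv0 u) (hp0.trans hpq) _
    exact ((hF.continuousOn_pay e) _ h0).tendsto.comp
      (tendsto_nhdsWithin_iff.2 ⟨hlevlim _, Filter.Eventually.of_forall fun k => hnn k _⟩)
  have hbal := balance_partner hF hp hvw le_rfl hq
  have hnon : 0 ≤ ∑ u ∈ (univ.erase v).erase w, (F.inflow q u - F.inflow p u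
          - (min (F.assets q u) (F.debt u) - min (F.assets p u) (F.debt u))) :=
    Finset.sum_nonneg fun u _ => by
      have := min_sub_min_le (F.debt u) (F.assets_mono hpq u)
      rw [F.assets_eq, F.assets_eq] at this ⊢
      linarith
  have hiv := F.inflow_mono hpq v
  have hiw := F.inflow_mono hpq w
  have hlevq : F.level {v, w} lev q = F.assets q := funext fun u => by
    by_cases h1 : u = v
    · rw [h1, hlev, level_partner_left, F.assets_eq, F.assets_eq]; linarith
    by_cases h2 : u = w
    · rw [h2, hlev, level_partner_right F hvw, F.assets_eq, F.assets_eq]; linarith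
    exact level_partner_other F h1 h2 _ _ _
  have hqp : q = p := le_antisymm (hp.2 (show F.Follows S (F.assets q) q from hlevq ▸ hq)) hpq
  rw [hlevq, hqp] at hlevlim
  have hev : ∀ᶠ k in Filter.atTop, ∀ u,
      F.level {v, w} (partnerLevel v (b k) (F.assets p w)) (r k) u < F.assets p u + η :=
    Filter.eventually_all.2 fun u => (hlevlim u).eventually_lt_const (by linarith)
  obtain ⟨k, hk⟩ := hev.exists
  exact ⟨b k, r k, hbv k, hbc k, hr k, fun u => (hk u).le⟩

/-- The claims whose payment grows as soon as the assets of their debtor exceed `A`. -/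
noncomputable def Network.active (S : PaymentScheme) (F : Network ℝ n m) (A : Fin n → ℝ) :
    Finset (Fin m) :=
  open Classical in {e | ∀ a, A (F.debtor e) < a → F.pay S e (A (F.debtor e)) < F.pay S e a}

theorem Network.mem_active {F : Network ℝ n m} {A : Fin n → ℝ} {e : Fin m} :
    e ∈ F.active S A ↔
      ∀ a, A (F.debtor e) < a → F.pay S e (A (F.debtor e)) < F.pay S e a := by
  simp [Network.active]

/-- Some active claim leads from the bank `y` to the bank `z`, which is none of the trading
partners. -/
def Network.Step (S : PaymentScheme) (F : Network ℝ n m) (A : Fin n → ℝ) (v w y z : Fin n) : Prop :=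
  z ≠ v ∧ z ≠ w ∧ ∃ e ∈ F.active S A, F.debtor e = y ∧ F.creditor e = z

/-- The bank `z` is reached from `y` along active claims that avoid the trading partners. -/
def Network.Reach (S : PaymentScheme) (F : Network ℝ n m) (A : Fin n → ℝ) (v w y z : Fin n) :
    Prop :=
  Relation.ReflTransGen (F.Step S A v w) y z

theorem Network.Reach.ne {F : Network ℝ n m} {A : Fin n → ℝ} {v w y z : Fin n}
    (h : F.Reach S A v w y z) (hy : y ≠ v) (hw : y ≠ w) : z ≠ v ∧ z ≠ w := by
  induction h with
  | refl => exact ⟨hy, hw⟩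
  | tail _ h _ => exact ⟨h.1, h.2.1⟩

theorem Network.Reach.ne_right {F : Network ℝ n m} {A : Fin n → ℝ} {v w y z : Fin n}
    (h : F.Reach S A v w y z) (hw : y ≠ w) : z ≠ w := by
  induction h with
  | refl => exact hw
  | tail _ h _ => exact h.2.1

theorem inflow_lt_inflow {F : Network ℝ n m} {p r : Fin m → ℝ} (hpr : p ≤ r) {e : Fin m}
    (he : p e < r e) : F.inflow p (F.creditor e) < F.inflow r (F.creditor e) :=
  Finset.sum_lt_sum (fun e _ => hpr e) ⟨e, by simp, he⟩

/-- Higher assets propagate along active claims. -/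
theorem Network.Reach.level_lt {F : Network ℝ n m} {p r : Fin m → ℝ}
    (hp : F.IsClearingState S p) {X : Finset (Fin n)} {lev : Fin n → ℝ} (hpr : p ≤ r)
    (hr : F.Follows S (F.level X lev r) r) {v w y z : Fin n}
    (hX : ∀ u ∈ X, u ≠ v → u ≠ w → F.assets p u < lev u)
    (h : F.Reach S (F.assets p) v w y z) (hy : F.assets p y < F.level X lev r y) :
    F.assets p z < F.level X lev r z := by
  induction h with
  | refl => exact hy
  | tail _ h ih =>
    obtain ⟨hzv, hzw, e, he, hde, hce⟩ := h
    have h1 : p e < r e := by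
      rw [hp.1 e, hr e]
      refine Network.mem_active.1 he _ ?_
      rw [hde]; exact ih
    have h2 := inflow_lt_inflow (F := F) hpr h1
    rw [hce] at h2
    unfold Network.level
    split_ifs with hz
    · exact hX _ hz hzv hzw
    · rw [F.assets_eq, F.assets_eq]; linarith

/-- Levels `h` up to which the banks in `U` pay all of their additional assets along active
claims. -/
structure Network.Threshold (S : PaymentScheme) (F : Network ℝ n m) (p : Fin m → ℝ)
    (U : Fin n → Prop) (h : Fin n → ℝ) : Prop where
  lt : ∀ u, U u → F.assets p u < h u
  le_debt : ∀ u, U u → h u ≤ F.debt u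
  flat : ∀ e, U (F.debtor e) → e ∉ F.active S (F.assets p) → F.pay S e (h (F.debtor e)) = p e

theorem Network.Threshold.flat_of_le {F : Network ℝ n m} (hF : F.Valid S) {p : Fin m → ℝ}
    (hp : F.IsClearingState S p) {U : Fin n → Prop} {h : Fin n → ℝ} (hU : F.Threshold S p U h)
    {e : Fin m} (he : U (F.debtor e)) (hact : e ∉ F.active S (F.assets p)) {a : ℝ}
    (ha : F.assets p (F.debtor e) ≤ a) (hah : a ≤ h (F.debtor e)) : F.pay S e a = p e := by
  have h0 := hF.assets_nonneg (hp.nonneg hF) (F.debtor e)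
  refine le_antisymm ?_ ?_
  · rw [← hU.flat e he hact]; exact hF.pay_mono e _ _ (h0.trans ha) hah
  · rw [hp.1 e]; exact hF.pay_mono e _ _ h0 ha

theorem mem_trading_iff {v w u : Fin n} :
    u ∈ ({v, w} : Finset (Fin n)) ↔ u = v ∨ u = w := by simp

/-- From every bank that is reached from `v` some trading partner is reached: otherwise additional
payments among the banks that are reached could circulate, and `p` would not be maximal. -/
theorem Network.Reach.exists_exit {F : Network ℝ n m} (hF : F.Valid S) {p : Fin m → ℝ}
    (hp : F.IsClearingState S p) {v w : Fin n} (hvw : v ≠ w) {c : ℝ} (hc : F.assets p v < c)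
    {h : Fin n → ℝ} (hU : F.Threshold S p (F.Reach S (F.assets p) v w v) h) {u : Fin n}
    (hu : F.Reach S (F.assets p) v w v u) (huv : u ≠ v) :
    ∃ e ∈ F.active S (F.assets p), F.Reach S (F.assets p) v w u (F.debtor e) ∧
      (F.creditor e = v ∨ F.creditor e = w) := by
  classical
  by_contra! hcon
  have hp0 := hp.nonneg hF
  have huw := hu.ne_right hvw
  -- a level of `v` at which no bank has passed its threshold
  obtain ⟨η, hη, hηle⟩ : ∃ η > 0, ∀ y, F.Reach S (F.assets p) v w v y →
      F.assets p y + η ≤ h y := by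
    have h1 : ∀ y, ∃ η > 0, F.Reach S (F.assets p) v w v y → F.assets p y + η ≤ h y := fun y => by
      by_cases hy : F.Reach S (F.assets p) v w v y
      · exact ⟨h y - F.assets p y, sub_pos.2 (hU.lt y hy), fun _ => by linarith⟩
      · exact ⟨1, one_pos, fun h => absurd h hy⟩
    choose η hη hle using h1
    refine ⟨univ.inf' ⟨v, mem_univ v⟩ η, (Finset.lt_inf'_iff _).2 fun y _ => hη y, fun y hy => ?_⟩
    have := Finset.inf'_le η (mem_univ y)
    have := hle y hy
    linarith
  obtain ⟨b, r, hb, -, hr, hrle⟩ := exists_level_le_add hF hp (w := w) hvw hc hη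
  have hpr : p ≤ r := FixedClearing.partner_ge hF hp hb.le hr
  set lev := partnerLevel v b (F.assets p w) with hlev
  let X : Finset (Fin n) := {y | F.Reach S (F.assets p) v w u y}
  have hX : ∀ y, y ∈ X ↔ F.Reach S (F.assets p) v w u y := fun y => by simp [X]
  have hXne : ∀ y ∈ X, y ≠ v ∧ y ≠ w := fun y hy => ((hX y).1 hy).ne huv huw
  have hlevX : ∀ y ∈ X, F.level {v, w} lev r y = F.assets r y := fun y hy =>
    level_partner_other F (hXne y hy).1 (hXne y hy).2 _ _ _
  have hXU : ∀ y ∈ X, F.Reach S (F.assets p) v w v y := fun y hy => hu.trans ((hX y).1 hy)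
  have hle : ∀ y ∈ X, F.assets r y ≤ h y := fun y hy => by
    rw [← hlevX y hy]; exact (hrle y).trans (hηle y (hXU y hy))
  have hclosed : ∀ e, F.debtor e ∈ X → F.creditor e ∉ X → r e = p e := fun e he hce => by
    rw [hr.follows e, hlevX _ he]
    refine hU.flat_of_le hF hp (hXU _ he) (fun hact => ?_) (F.assets_mono hpr _) (hle _ he)
    by_cases h1 : F.creditor e = v ∨ F.creditor e = w
    · have := hcon e hact ((hX _).1 he); tauto
    · push Not at h1
      exact hce ((hX _).2 (((hX _).1 he).tail ⟨h1.1, h1.2, e, hact, rfl, rfl⟩))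
  have hout : ∀ y ∈ X, ∑ e with F.debtor e = y, (r e - p e) = F.inflow r y - F.inflow p y :=
    fun y hy => by
      have h1 := hle y hy
      have h2 := hU.le_debt y (hXU y hy)
      have h3 := F.assets_mono hpr y
      rw [Finset.sum_sub_distrib, hr.follows.outflow hF, hp.follows.outflow hF
        (hF.assets_nonneg hp0 y), hlevX y hy, min_eq_left (h1.trans h2),
        min_eq_left (h3.trans (h1.trans h2)), F.assets_eq, F.assets_eq]
      · ring
      · rw [hlevX y hy]; exact hF.assets_nonneg (hp0.trans hpr) y
  have hsum : ∑ e with F.debtor e ∈ X, (r e - p e) = ∑ e with F.creditor e ∈ X, (r e - p e) := by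
    have h1 : ∑ e with F.debtor e ∈ X, (r e - p e)
        = ∑ y ∈ X, ∑ e with F.debtor e = y, (r e - p e) := by
      rw [← Finset.sum_fiberwise_of_maps_to (s := {e | F.debtor e ∈ X}) (t := X) (g := F.debtor)
        (by simp)]
      refine Finset.sum_congr rfl fun y hy => Finset.sum_congr ?_ fun _ _ => rfl
      ext e; simp only [mem_filter, mem_univ, true_and]
      exact ⟨fun h => h.2, fun h => ⟨h ▸ hy, h⟩⟩
    have h2 : ∑ e with F.creditor e ∈ X, (r e - p e)
        = ∑ y ∈ X, ∑ e with F.creditor e = y, (r e - p e) := by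
      rw [← Finset.sum_fiberwise_of_maps_to (s := {e | F.creditor e ∈ X}) (t := X)
        (g := F.creditor) (by simp)]
      refine Finset.sum_congr rfl fun y hy => Finset.sum_congr ?_ fun _ _ => rfl
      ext e; simp only [mem_filter, mem_univ, true_and]
      exact ⟨fun h => h.2, fun h => ⟨h ▸ hy, h⟩⟩
    rw [h1, h2]
    refine Finset.sum_congr rfl fun y hy => ?_
    rw [hout y hy, Network.inflow, Network.inflow, ← Finset.sum_sub_distrib]
  have hnn : ∀ e, 0 ≤ r e - p e := fun e => sub_nonneg.2 (hpr e)
  have hentry : ∀ e, F.creditor e ∈ X → F.debtor e ∉ X → r e = p e := fun e hce hde => by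
    have h1 : ∑ e with F.debtor e ∈ X, (r e - p e)
        = ∑ e, if F.debtor e ∈ X ∧ F.creditor e ∈ X then r e - p e else 0 := by
      rw [Finset.sum_filter]
      refine Finset.sum_congr rfl fun e _ => ?_
      by_cases h1 : F.debtor e ∈ X <;> by_cases h2 : F.creditor e ∈ X <;> simp [h1, h2]
      rw [hclosed e h1 h2, sub_self]
    rw [h1, Finset.sum_filter] at hsum
    have h2 := (Finset.sum_eq_sum_iff_of_le fun e _ => by
      have := hnn e
      by_cases h1 : F.debtor e ∈ X <;> by_cases h2 : F.creditor e ∈ X <;> simp [h1, h2]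
      simpa using hpr e).1 hsum e (mem_univ e)
    simp only [hde, hce, false_and, if_false, if_true] at h2
    linarith
  let q : Fin m → ℝ := fun e => if F.debtor e ∈ X then r e else p e
  have hpq : p ≤ q := fun e => by simp only [q]; split_ifs; exacts [hpr e, le_rfl]
  have hqX : ∀ y ∈ X, F.assets q y = F.assets r y := fun y hy => by
    rw [F.assets_eq, F.assets_eq]
    congr 1
    refine Finset.sum_congr rfl fun e he => ?_
    simp only [q]
    split_ifs with h1
    · rfl
    · exact (hentry e (by rw [(mem_filter.1 he).2]; exact hy) h1).symm
  have hqp : q ≤ p := hp.ge hF (hp0.trans hpq) fun e => by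
    by_cases h1 : F.debtor e ∈ X
    · simp only [q, if_pos h1]
      rw [hqX _ h1, ← hlevX _ h1]
      exact (hr.follows e).le
    · simp only [q, if_neg h1]
      exact (hp.1 e).trans_le (hF.pay_mono e _ _ (hF.assets_nonneg hp0 _) (F.assets_mono hpq _))
  have huX : u ∈ X := (hX u).2 Relation.ReflTransGen.refl
  have hlt : F.assets p u < F.assets r u := by
    rw [← hlevX u huX]
    refine hu.level_lt hp hpr hr.follows ?_ ?_
    · intro y hy h1 h2
      rcases mem_trading_iff.1 hy with h | h
      exacts [absurd h h1, absurd h h2]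
    · rw [hlev, level_partner_left]; exact hb
  have h1 := hout u huX
  rw [Finset.sum_eq_zero] at h1
  · rw [F.assets_eq, F.assets_eq] at hlt; linarith
  · intro e he
    have h2 := hqp e
    simp only [q, if_pos ((mem_filter.1 he).2 ▸ huX : F.debtor e ∈ X)] at h2
    linarith [hpr e]

/-- The levels at which the trading partners and the bank `u` are held to see how much of the assets
of `u` reaches the trading partners. -/
def probeLevel {K : Type} (A h : Fin n → K) (u y : Fin n) : K := if y = u then h u else A y

/-- If `u` is held at its threshold, more payments reach the trading partners. -/
theorem Network.Reach.probe_pos {F : Network ℝ n m} (hF : F.Valid S) {p : Fin m → ℝ}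
    (hp : F.IsClearingState S p) {v w : Fin n} (hvw : v ≠ w) {c : ℝ} (hc : F.assets p v < c)
    {h : Fin n → ℝ} (hU : F.Threshold S p (F.Reach S (F.assets p) v w v) h) {u : Fin n}
    (hu : F.Reach S (F.assets p) v w v u) (huv : u ≠ v) {q : Fin m → ℝ}
    (hq : F.FixedClearing S {v, w, u} (probeLevel (F.assets p) h u) q) :
    0 < F.inflow q v - F.inflow p v + (F.inflow q w - F.inflow p w) := by
  obtain ⟨e, he, hue, hce⟩ := hu.exists_exit hF hp hvw hc hU huv
  have hpq : p ≤ q := hq.ge_clearing hF hp fun y _ => by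
    unfold probeLevel
    split_ifs with h1
    · rw [h1]; exact (hU.lt u hu).le
    · exact le_rfl
  have hlt := hue.level_lt hp hpq hq.follows (fun y hy h1 h2 => by
      have : y = u := by simpa [h1, h2] using hy
      rw [this, probeLevel, if_pos rfl]; exact hU.lt u hu) (by
      rw [F.level_of_mem (by simp), probeLevel, if_pos rfl]; exact hU.lt u hu)
  have h1 : p e < q e := by
    rw [hp.1 e, hq.follows e]
    exact Network.mem_active.1 he _ hlt
  have h2 := inflow_lt_inflow (F := F) hpq h1
  have h3 := F.inflow_mono hpq v
  have h4 := F.inflow_mono hpq w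
  rcases hce with h | h <;> rw [h] at h2 <;> linarith

/-- A small increase of the assets of `v` comes back to the buyer in full. -/
theorem level_of_small {F : Network ℝ n m} (hF : F.Valid S) {p : Fin m → ℝ}
    (hp : F.IsClearingState S p) {v w : Fin n} (hvw : v ≠ w)
    {h : Fin n → ℝ} (hU : F.Threshold S p (F.Reach S (F.assets p) v w v) h) {b : ℝ}
    (hb : F.assets p v < b) (hbh : b ≤ h v)
    (hprobe : ∀ u, F.Reach S (F.assets p) v w v u → u ≠ v → ∃ q,
      F.FixedClearing S {v, w, u} (probeLevel (F.assets p) h u) q ∧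
      b - F.assets p v < F.inflow q v - F.inflow p v + (F.inflow q w - F.inflow p w))
    {r : Fin m → ℝ} (hr : F.FixedClearing S {v, w} (partnerLevel v b (F.assets p w)) r) :
    F.transfer v b r = F.inflow r w - F.inflow p w := by
  classical
  have hp0 := hp.nonneg hF
  have hpr : p ≤ r := FixedClearing.partner_ge hF hp hb.le hr
  have hr0 := hr.follows.nonneg hF
  have hb0 : 0 ≤ b := (hF.assets_nonneg hp0 v).trans hb.le
  have hpl : ∀ u ∈ ({v, w} : Finset (Fin n)), 0 ≤ partnerLevel v b (F.assets p w) u :=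
    fun u _ => partnerLevel_nonneg hF hp0 v w hb0 u
  have hRv : F.Reach S (F.assets p) v w v v := Relation.ReflTransGen.refl
  have hbal := balance_partner hF hp hvw hb.le hr.follows
  have hinc : F.inflow r v - F.inflow p v + (F.inflow r w - F.inflow p w)
      ≤ b - F.assets p v := by
    have h1 : 0 ≤ ∑ u ∈ (univ.erase v).erase w, (F.inflow r u - F.inflow p u
          - (min (F.assets r u) (F.debt u) - min (F.assets p u) (F.debt u))) :=
      Finset.sum_nonneg fun u _ => by
        have := min_sub_min_le (F.debt u) (F.assets_mono hpr u)
        rw [F.assets_eq, F.assets_eq] at this ⊢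
        linarith
    have h2 := min_sub_min_le (F.debt v) hb.le
    linarith
  -- No bank that is reached passes its threshold.
  have hle : ∀ u, F.Reach S (F.assets p) v w v u → u ≠ v → F.assets r u ≤ h u := by
    intro u hu huv
    by_contra! hcon
    have huw := hu.ne_right hvw
    obtain ⟨q, hq, hlt⟩ := hprobe u hu huv
    have hql : ∀ y, 0 ≤ probeLevel (F.assets p) h u y := fun y => by
      unfold probeLevel
      split_ifs
      · exact (hF.assets_nonneg hp0 u).trans (hU.lt u hu).le
      · exact hF.assets_nonneg hp0 y
    have hq0 := hq.follows.nonneg hF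
    have hqr : q ≤ r := by
      refine le_sup_left.trans (hr.ge (q ⊔ r) (hq0.trans le_sup_left) fun e => sup_le ?_ ?_)
      · rw [hq.follows e]
        refine hF.pay_mono e _ _ (hF.level_nonneg (fun y _ => hql y) hq0 _) ?_
        set y := F.debtor e
        by_cases h1 : y = v
        · rw [h1, level_partner_left, F.level_of_mem (by simp), probeLevel, if_neg huv.symm]
          exact hb.le
        by_cases h2 : y = w
        · rw [h2, level_partner_right F hvw, F.level_of_mem (by simp), probeLevel,
            if_neg huw.symm]
        rw [level_partner_other F h1 h2]
        by_cases h3 : y = u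
        · rw [h3, F.level_of_mem (by simp), probeLevel, if_pos rfl]
          exact hcon.le.trans (F.assets_mono le_sup_right u)
        · rw [F.level_of_notMem (by simp [h1, h2, h3])]
          exact F.assets_mono le_sup_left y
      · rw [hr.follows e]
        exact hF.pay_mono e _ _ (hF.level_nonneg hpl hr0 _)
          (F.level_mono _ (fun _ _ => le_rfl) le_sup_right _)
    have h1 := F.inflow_mono hqr v
    have h2 := F.inflow_mono hqr w
    linarith
  have hflat : ∀ e, F.Reach S (F.assets p) v w v (F.debtor e) →
      e ∉ F.active S (F.assets p) → r e = p e := fun e he hact => by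
    rw [hr.follows e]
    by_cases h1 : F.debtor e = v
    · rw [h1, level_partner_left]
      refine hU.flat_of_le hF hp he hact ?_ ?_ <;> rw [h1]
      exacts [hb.le, hbh]
    · have h2 := he.ne_right hvw
      rw [level_partner_other F h1 h2]
      exact hU.flat_of_le hF hp he hact (F.assets_mono hpr _) (hle _ he h1)
  have hwout : ∀ e, F.debtor e = w → r e = p e := fun e he => by
    rw [hr.follows e, hp.1 e, he, level_partner_right F hvw]
  -- The banks that are not reached do not receive more.
  let Z : Fin n → Prop := fun u => u ≠ w ∧ ¬F.Reach S (F.assets p) v w v u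
  let q : Fin m → ℝ := fun e => if Z (F.debtor e) then r e else p e
  have hpq : p ≤ q := fun e => by simp only [q]; split_ifs; exacts [hpr e, le_rfl]
  have hZne : ∀ u, Z u → u ≠ v ∧ u ≠ w := fun u hu =>
    ⟨fun h1 => hu.2 (h1 ▸ hRv), hu.1⟩
  have hqZ : ∀ u, Z u → F.assets q u = F.assets r u := fun u hu => by
    rw [F.assets_eq, F.assets_eq]
    congr 1
    refine Finset.sum_congr rfl fun e he => ?_
    have hce := (mem_filter.1 he).2
    simp only [q]
    split_ifs with h1
    · rfl
    · by_cases h2 : F.debtor e = w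
      · exact (hwout e h2).symm
      have h3 : F.Reach S (F.assets p) v w v (F.debtor e) := by
        by_contra h4; exact h1 ⟨h2, h4⟩
      refine (hflat e h3 fun hact => hu.2 ?_).symm
      exact h3.tail ⟨(hZne u hu).1, (hZne u hu).2, e, hact, rfl, hce⟩
  have hqp : q ≤ p := hp.ge hF (hp0.trans hpq) fun e => by
    by_cases h1 : Z (F.debtor e)
    · simp only [q, if_pos h1]
      rw [hqZ _ h1, ← level_partner_other F (hZne _ h1).1 (hZne _ h1).2 b (F.assets p w)]
      exact (hr.follows e).le
    · simp only [q, if_neg h1]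
      exact (hp.1 e).trans_le (hF.pay_mono e _ _ (hF.assets_nonneg hp0 _) (F.assets_mono hpq _))
  have hqeq : q = p := le_antisymm hqp hpq
  refine transfer_eq_inflow hF hp hvw hb.le hr.follows ?_ ?_
  · rw [min_eq_left (hbh.trans (hU.le_debt v hRv)),
      min_eq_left (hb.le.trans (hbh.trans (hU.le_debt v hRv)))]
  · intro u h1 h2
    by_cases hu : F.Reach S (F.assets p) v w v u
    · have h3 := (hle u hu h1).trans (hU.le_debt u hu)
      rw [min_eq_left h3, min_eq_left ((F.assets_mono hpr u).trans h3)]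
    · rw [← hqZ u ⟨h2, hu⟩, hqeq]; ring

end SmallLevels


/-! ### Thresholds from an auxiliary clearing state -/

section Doubled

variable {n m : ℕ} {S : PaymentScheme}

/- The `simp` calls below exclude two lemmas that replace `Fin.natAdd` by another form, in which
`Fin.addCases` does not reduce. -/

/-- Two copies of every bank and a bank without debts. The claims in `E` lead from each copy of
their debtor to the other copy of it, all other claims lead to the bank without debts. -/
def Network.doubled {K : Type} [Zero K] (F : Network K n m) (E : Finset (Fin m)) (a : Fin n → K) :
    Network K (n + n + 1) (m + m) where
  debtor := Fin.addCases (fun e => (Fin.castAdd n (F.debtor e)).castSucc)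
    (fun e => (Fin.natAdd n (F.debtor e)).castSucc)
  creditor := Fin.addCases
    (fun e => if e ∈ E then (Fin.natAdd n (F.debtor e)).castSucc else Fin.last _)
    (fun e => if e ∈ E then (Fin.castAdd n (F.debtor e)).castSucc else Fin.last _)
  liability := Fin.addCases F.liability F.liability
  external := Fin.lastCases 0 (Fin.addCases a a)
  rule := Fin.lastCases (.num 0) (Fin.addCases F.rule F.rule)

theorem castAdd_ne_natAdd {a b : ℕ} (x : Fin a) (y : Fin b) : Fin.castAdd b x ≠ Fin.natAdd a y :=
  fun h => by
    have := congrArg Fin.val h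
    simp at this
    omega

theorem Network.doubled_pay_left (F : Network ℝ n m) (E : Finset (Fin m)) (a : Fin n → ℝ)
    (e : Fin m) : (F.doubled E a).pay S (Fin.castAdd m e) = F.pay S e := by
  have h : (F.doubled E a).slot (Fin.castAdd m e) = F.slot e := by
    simp only [Network.slot, Finset.card_filter, Fin.sum_univ_add]
    simp [-Fin.natAdd_eq_addNat, -Fin.castSucc_natAdd, Network.doubled,
        (castAdd_ne_natAdd _ _).symm, Fin.lt_def, -Fin.val_fin_lt]
  simp only [Network.pay, h]
  simp [-Fin.natAdd_eq_addNat, -Fin.castSucc_natAdd, Network.doubled]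

theorem Network.doubled_pay_right (F : Network ℝ n m) (E : Finset (Fin m)) (a : Fin n → ℝ)
    (e : Fin m) : (F.doubled E a).pay S (Fin.natAdd m e) = F.pay S e := by
  have h : (F.doubled E a).slot (Fin.natAdd m e) = F.slot e := by
    simp only [Network.slot, Finset.card_filter, Fin.sum_univ_add]
    simp [-Fin.natAdd_eq_addNat, -Fin.castSucc_natAdd, Network.doubled, castAdd_ne_natAdd,
        Fin.lt_def, -Fin.val_fin_lt]
  simp only [Network.pay, h]
  simp [-Fin.natAdd_eq_addNat, -Fin.castSucc_natAdd, Network.doubled]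

theorem Network.doubled_assets_left (F : Network ℝ n m) (E : Finset (Fin m)) (a : Fin n → ℝ)
    (q : Fin (m + m) → ℝ) (u : Fin n) :
    (F.doubled E a).assets q (Fin.castAdd n u).castSucc
      = a u + ∑ e ∈ E with F.debtor e = u, q (Fin.natAdd m e) := by
  unfold Network.assets
  rw [Finset.sum_filter, Fin.sum_univ_add, Finset.sum_eq_zero (s := univ)
    (f := fun e => if (F.doubled E a).creditor (Fin.castAdd m e) = _ then q (Fin.castAdd m e)
      else 0), zero_add]
  · congr 1
    · simp [-Fin.natAdd_eq_addNat, -Fin.castSucc_natAdd, Network.doubled]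
    · rw [Finset.sum_filter, ← Finset.sum_subset (Finset.subset_univ E)]
      · refine Finset.sum_congr rfl fun e he => ?_
        simp [-Fin.natAdd_eq_addNat, -Fin.castSucc_natAdd, Network.doubled, he]
      · intro e _ he
        simp [-Fin.natAdd_eq_addNat, -Fin.castSucc_natAdd, Network.doubled, he,
            (Fin.castSucc_lt_last _).ne']
  · intro e _
    rw [if_neg]
    simp only [Network.doubled, Fin.addCases_left]
    split_ifs
    · exact fun h => castAdd_ne_natAdd _ _ (Fin.castSucc_injective _ h).symm
    · exact (Fin.castSucc_lt_last _).ne'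

theorem Network.doubled_assets_right (F : Network ℝ n m) (E : Finset (Fin m)) (a : Fin n → ℝ)
    (q : Fin (m + m) → ℝ) (u : Fin n) :
    (F.doubled E a).assets q (Fin.natAdd n u).castSucc
      = a u + ∑ e ∈ E with F.debtor e = u, q (Fin.castAdd m e) := by
  unfold Network.assets
  rw [Finset.sum_filter, Fin.sum_univ_add, Finset.sum_eq_zero (s := univ)
    (f := fun e => if (F.doubled E a).creditor (Fin.natAdd m e) = _ then q (Fin.natAdd m e)
      else 0), add_zero]
  · congr 1
    · simp [-Fin.natAdd_eq_addNat, -Fin.castSucc_natAdd, Network.doubled]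
    · rw [Finset.sum_filter, ← Finset.sum_subset (Finset.subset_univ E)]
      · refine Finset.sum_congr rfl fun e he => ?_
        simp [-Fin.natAdd_eq_addNat, -Fin.castSucc_natAdd, Network.doubled, he]
      · intro e _ he
        simp [-Fin.natAdd_eq_addNat, -Fin.castSucc_natAdd, Network.doubled, he,
            (Fin.castSucc_lt_last _).ne']
  · intro e _
    rw [if_neg]
    simp only [Network.doubled, Fin.addCases_right]
    split_ifs
    · exact fun h => castAdd_ne_natAdd _ _ (Fin.castSucc_injective _ h)
    · exact (Fin.castSucc_lt_last _).ne'

theorem Network.Valid.doubled {F : Network ℝ n m} (hF : F.Valid S) (E : Finset (Fin m))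
    {a : Fin n → ℝ} (ha : ∀ u, 0 ≤ a u) : (F.doubled E a).Valid S where
  no_loop := fun e => by
    induction e using Fin.addCases with
    | left e =>
      simp only [Network.doubled, Fin.addCases_left]
      split_ifs
      · exact fun h => castAdd_ne_natAdd _ _ (Fin.castSucc_injective _ h)
      · exact (Fin.castSucc_lt_last _).ne
    | right e =>
      simp only [Network.doubled, Fin.addCases_right]
      split_ifs
      · exact fun h => castAdd_ne_natAdd _ _ (Fin.castSucc_injective _ h).symm
      · exact (Fin.castSucc_lt_last _).ne
  liability_pos := fun e => by
    induction e using Fin.addCases <;> simpa [-Fin.natAdd_eq_addNat, -Fin.castSucc_natAdd,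
        Network.doubled] using hF.liability_pos _
  external_nonneg := fun u => by
    induction u using Fin.lastCases with
    | last => simp [-Fin.natAdd_eq_addNat, -Fin.castSucc_natAdd, Network.doubled]
    | cast u => induction u using Fin.addCases <;> simpa [-Fin.natAdd_eq_addNat,
        -Fin.castSucc_natAdd, Network.doubled] using ha _
  pay_mem := fun e b => by
    induction e using Fin.addCases with
    | left e => rw [F.doubled_pay_left]; simpa [-Fin.natAdd_eq_addNat, -Fin.castSucc_natAdd,
        Network.doubled] using hF.pay_mem e b
    | right e => rw [F.doubled_pay_right]; simpa [-Fin.natAdd_eq_addNat, -Fin.castSucc_natAdd,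
        Network.doubled] using hF.pay_mem e b
  pay_mono := fun e x y => by
    induction e using Fin.addCases with
    | left e => rw [F.doubled_pay_left]; exact hF.pay_mono e x y
    | right e => rw [F.doubled_pay_right]; exact hF.pay_mono e x y
  pay_sum := fun u b hb => by
    simp only [Finset.sum_filter, Fin.sum_univ_add, F.doubled_pay_left, F.doubled_pay_right]
    induction u using Fin.lastCases with
    | last => simp [-Fin.natAdd_eq_addNat, -Fin.castSucc_natAdd, Network.doubled,
        (Fin.castSucc_lt_last _).ne, hb]
    | cast u =>
      have h := hF.pay_sum
      simp only [Finset.sum_filter] at h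
      induction u using Fin.addCases with
      | left u =>
        simpa [-Fin.natAdd_eq_addNat, -Fin.castSucc_natAdd, Network.doubled,
            (castAdd_ne_natAdd _ _).symm] using h u b hb
      | right u =>
        simpa [-Fin.natAdd_eq_addNat, -Fin.castSucc_natAdd, Network.doubled,
            castAdd_ne_natAdd] using h u b hb

/-- Thresholds exist if some exact trade is creditor-positive: the banks reached by additional
payments pass on all of their additional assets after the trade, and each inactive claim is constant
on some interval. -/
theorem Network.IsExactPositive.exists_threshold {F : Network ℝ n m} (hF : F.Valid S)
    {v w : Fin n} {p : Fin m → ℝ} (hp : F.IsClearingState S p) {T : MultiTrade ℝ m}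
    (hT : F.IsExactPositive S v w T) :
    ∃ h, F.Threshold S p (F.Reach S (F.assets p) v w v) h := by
  classical
  have hvw := hT.1.distinct
  have hp0 := hp.nonneg hF
  have hb : F.assets p v < (F.afterTrade v w T).totalAssets S v := by
    have := hT.2.1
    unfold Network.totalAssets at this
    rwa [hp.clearing_eq hF] at this
  have hb0 := (hF.assets_nonneg hp0 v).trans hb.le
  obtain ⟨r, hr⟩ := hF.exists_fixedClearing (S := S) {v, w}
    (partnerLevel v ((F.afterTrade v w T).totalAssets S v) (F.assets p w))
    fun u _ => partnerLevel_nonneg hF hp0 v w hb0 u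
  obtain ⟨hpr, -, -, hdebt, hsave, -⟩ := hT.lower_level hF hp hb le_rfl hr
  set b := (F.afterTrade v w T).totalAssets S v
  set lev := partnerLevel v b (F.assets p w) with hlev
  have hlt : ∀ u, F.Reach S (F.assets p) v w v u → F.assets p u < F.level {v, w} lev r u :=
    fun u hu => hu.level_lt hp hpr hr.follows (fun y hy h1 h2 => by
      rcases mem_trading_iff.1 hy with h | h
      exacts [absurd h h1, absurd h h2]) (by rw [hlev, level_partner_left]; exact hb)
  have hle : ∀ u, F.Reach S (F.assets p) v w v u → F.level {v, w} lev r u ≤ F.debt u := by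
    intro u hu
    by_cases h1 : u = v
    · rw [h1, hlev, level_partner_left]; exact hdebt
    have h2 := hu.ne_right hvw
    have h3 := hlt u hu
    rw [hlev, level_partner_other F h1 h2] at h3 ⊢
    have h4 := hsave u h1 h2
    by_contra! hcon
    rw [min_eq_right hcon.le] at h4
    rcases min_choice (F.assets p u) (F.debt u) with h | h <;> rw [h] at h4 <;> linarith
  have hex : ∀ e, ∃ a, e ∉ F.active S (F.assets p) →
      F.assets p (F.debtor e) < a ∧ F.pay S e a ≤ p e := fun e => by
    by_cases he : e ∈ F.active S (F.assets p)
    · exact ⟨0, fun h => absurd he h⟩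
    · rw [Network.mem_active] at he
      push Not at he
      obtain ⟨a, h1, h2⟩ := he
      exact ⟨a, fun _ => ⟨h1, by rw [hp.1 e]; exact h2⟩⟩
  choose a ha using hex
  let s : Fin n → Finset ℝ := fun u => insert (F.level {v, w} lev r u)
    (({e | F.debtor e = u ∧ e ∉ F.active S (F.assets p)} : Finset (Fin m)).image a)
  have hs : ∀ u, (s u).Nonempty := fun u => Finset.insert_nonempty _ _
  have hslt : ∀ u, F.Reach S (F.assets p) v w v u → F.assets p u < (s u).min' (hs u) :=
    fun u hu => (Finset.lt_min'_iff _ _).2 fun y hy => by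
      rcases Finset.mem_insert.1 hy with rfl | hy
      · exact hlt u hu
      · obtain ⟨e, he, rfl⟩ := Finset.mem_image.1 hy
        have h1 := (Finset.mem_filter.1 he).2
        rw [← h1.1]
        exact (ha e h1.2).1
  refine ⟨fun u => (s u).min' (hs u), hslt, fun u hu => ?_, fun e he hact => ?_⟩
  · exact (Finset.min'_le _ _ (Finset.mem_insert_self _ _)).trans (hle u hu)
  · have h0 := hF.assets_nonneg hp0 (F.debtor e)
    have h1 := hslt _ he
    have h2 : (s (F.debtor e)).min' (hs _) ≤ a e :=
      Finset.min'_le _ _ (Finset.mem_insert_of_mem (Finset.mem_image.2 ⟨e, by simp [hact], rfl⟩))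
    refine le_antisymm ((hF.pay_mono e _ _ (h0.trans h1.le) h2).trans (ha e hact).2) ?_
    rw [hp.1 e]
    exact hF.pay_mono e _ _ h0 h1.le

/-- The assets that a bank pays along claims outside of `E`, or keeps. -/
def Network.residual {K : Type} [AddCommGroup K] (F : Network K n m) (E : Finset (Fin m))
    (A : Fin n → K) (p : Fin m → K) (u : Fin n) : K :=
  A u - ∑ e ∈ E with F.debtor e = u, p e

theorem residual_nonneg {F : Network ℝ n m} (hF : F.Valid S) {p : Fin m → ℝ}
    (hp : F.IsClearingState S p) (E : Finset (Fin m)) (u : Fin n) :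
    0 ≤ F.residual E (F.assets p) p u := by
  have h1 := hp.follows.outflow hF (hF.assets_nonneg (hp.nonneg hF) u)
  have h2 : ∑ e ∈ E with F.debtor e = u, p e ≤ ∑ e with F.debtor e = u, p e :=
    Finset.sum_le_sum_of_subset_of_nonneg (Finset.filter_subset_filter _ (Finset.subset_univ _))
      fun e _ _ => hp.nonneg hF e
  have h3 := min_le_left (F.assets p u) (F.debt u)
  unfold Network.residual
  linarith

/-- Thresholds can be read off the clearing state of the doubled network: there the active payments
of a bank return to it, so its assets are the largest ones that it passes on along active claims
in full. In particular there are thresholds of polynomial bit length. -/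
theorem Network.Threshold.doubled {F : Network ℝ n m} (hF : F.Valid S) {p : Fin m → ℝ}
    (hp : F.IsClearingState S p) {U : Fin n → Prop} {h : Fin n → ℝ} (hU : F.Threshold S p U h)
    {Q : Fin (m + m) → ℝ}
    (hQ : (F.doubled (F.active S (F.assets p))
      (F.residual (F.active S (F.assets p)) (F.assets p) p)).IsClearingState S Q) :
    F.Threshold S p U fun u => F.residual (F.active S (F.assets p)) (F.assets p) p u
      + ∑ e ∈ F.active S (F.assets p) with F.debtor e = u, Q (Fin.natAdd m e) := by
  classical
  set A := F.assets p with hA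
  set E := F.active S A with hE
  set R := F.residual E A p with hR
  have hp0 := hp.nonneg hF
  have hA0 : ∀ u, 0 ≤ A u := hF.assets_nonneg hp0
  have hR0 : ∀ u, 0 ≤ R u := residual_nonneg hF hp E
  have hV := hF.doubled E hR0
  have hQ0 := hQ.nonneg hV
  have hRA : ∀ u, R u + ∑ e ∈ E with F.debtor e = u, p e = A u := fun u => by
    rw [hR, Network.residual]; ring
  -- the state in which every bank of `U` is at the given threshold
  let s : Fin m → ℝ := fun e => if U (F.debtor e) then F.pay S e (h (F.debtor e)) else p e
  have hs0 : ∀ e, 0 ≤ s e := fun e => by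
    simp only [s]; split_ifs
    exacts [(hF.pay_mem e _).1, hp0 e]
  have hEsum : ∀ (u : Fin n) (b : ℝ), A u ≤ b →
      (∑ e ∈ E with F.debtor e = u, (F.pay S e b - p e))
        + ∑ e ∈ Eᶜ with F.debtor e = u, (F.pay S e b - p e)
        = min b (F.debt u) - min (A u) (F.debt u) := fun u b hb => by
    rw [← hF.pay_sum_sub u (hA0 u) hb, Finset.sum_filter, Finset.sum_filter, Finset.sum_filter,
      Finset.sum_add_sum_compl]
    refine Finset.sum_congr rfl fun e _ => ?_
    split_ifs with h1
    · rw [hp.1 e, h1]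
    · rfl
  have hssum : ∀ u, U u → R u + ∑ e ∈ E with F.debtor e = u, s e = h u := fun u hu => by
    have h1 := hEsum u (h u) (hU.lt u hu).le
    rw [Finset.sum_eq_zero (s := Finset.filter _ Eᶜ), add_zero, min_eq_left (hU.le_debt u hu),
      min_eq_left ((hU.lt u hu).le.trans (hU.le_debt u hu)), Finset.sum_sub_distrib] at h1
    · have h2 : ∑ e ∈ E with F.debtor e = u, s e
          = ∑ e ∈ E with F.debtor e = u, F.pay S e (h u) :=
        Finset.sum_congr rfl fun e he => by
          simp only [s, (Finset.mem_filter.1 he).2, hu, if_true]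
      have := hRA u
      linarith
    · intro e he
      obtain ⟨h2, h3⟩ := Finset.mem_filter.1 he
      have := hU.flat e (h3 ▸ hu) (Finset.mem_compl.1 h2)
      rw [h3] at this
      rw [this, sub_self]
  have hssum' : ∀ u, ¬U u → R u + ∑ e ∈ E with F.debtor e = u, s e = A u := fun u hu => by
    rw [← hRA u]
    congr 1
    refine Finset.sum_congr rfl fun e he => ?_
    simp only [s, (Finset.mem_filter.1 he).2, hu, if_false]
  have hsle : ∀ e, s e ≤ F.pay S e (R (F.debtor e) + ∑ e' ∈ E with F.debtor e' = F.debtor e,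
      s e') :=
    fun e => by
      by_cases hu : U (F.debtor e)
      · rw [hssum _ hu]; simp only [s, hu, if_true]; exact le_rfl
      · rw [hssum' _ hu]; simp only [s, hu, if_false]; exact (hp.1 e).le
  have hsQ : (Fin.addCases s s : Fin (m + m) → ℝ) ≤ Q := hQ.ge hV
    (fun e => by induction e using Fin.addCases <;> simpa [-Fin.natAdd_eq_addNat,
        -Fin.castSucc_natAdd] using hs0 _) fun e => by
      induction e using Fin.addCases with
      | left e =>
        rw [F.doubled_pay_left]
        have : (F.doubled E R).debtor (Fin.castAdd m e) = (Fin.castAdd n (F.debtor e)).castSucc :=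
            by
          simp [-Fin.natAdd_eq_addNat, -Fin.castSucc_natAdd, Network.doubled]
        rw [this, F.doubled_assets_left]
        simpa [-Fin.natAdd_eq_addNat, -Fin.castSucc_natAdd] using hsle e
      | right e =>
        rw [F.doubled_pay_right]
        have : (F.doubled E R).debtor (Fin.natAdd m e) = (Fin.natAdd n (F.debtor e)).castSucc := by
          simp [-Fin.natAdd_eq_addNat, -Fin.castSucc_natAdd, Network.doubled]
        rw [this, F.doubled_assets_right]
        simpa [-Fin.natAdd_eq_addNat, -Fin.castSucc_natAdd] using hsle e
  have hsL : ∀ e, s e ≤ Q (Fin.castAdd m e) := fun e => by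
    simpa [-Fin.natAdd_eq_addNat, -Fin.castSucc_natAdd] using hsQ (Fin.castAdd m e)
  have hsR : ∀ e, s e ≤ Q (Fin.natAdd m e) := fun e => by
    simpa [-Fin.natAdd_eq_addNat, -Fin.castSucc_natAdd] using hsQ (Fin.natAdd m e)
  have hQL : ∀ e, Q (Fin.castAdd m e) = F.pay S e (R (F.debtor e)
      + ∑ e' ∈ E with F.debtor e' = F.debtor e, Q (Fin.natAdd m e')) := fun e => by
    have h1 := hQ.1 (Fin.castAdd m e)
    have : (F.doubled E R).debtor (Fin.castAdd m e) = (Fin.castAdd n (F.debtor e)).castSucc := by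
      simp [-Fin.natAdd_eq_addNat, -Fin.castSucc_natAdd, Network.doubled]
    rwa [F.doubled_pay_left, this, F.doubled_assets_left] at h1
  have hQR : ∀ e, Q (Fin.natAdd m e) = F.pay S e (R (F.debtor e)
      + ∑ e' ∈ E with F.debtor e' = F.debtor e, Q (Fin.castAdd m e')) := fun e => by
    have h1 := hQ.1 (Fin.natAdd m e)
    have : (F.doubled E R).debtor (Fin.natAdd m e) = (Fin.natAdd n (F.debtor e)).castSucc := by
      simp [-Fin.natAdd_eq_addNat, -Fin.castSucc_natAdd, Network.doubled]
    rwa [F.doubled_pay_right, this, F.doubled_assets_right] at h1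
  let a : Fin n → ℝ := fun u => R u + ∑ e ∈ E with F.debtor e = u, Q (Fin.natAdd m e)
  let b : Fin n → ℝ := fun u => R u + ∑ e ∈ E with F.debtor e = u, Q (Fin.castAdd m e)
  have hha : ∀ u, U u → h u ≤ a u := fun u hu => by
    rw [← hssum u hu]
    exact add_le_add le_rfl (Finset.sum_le_sum fun e _ => hsR e)
  have hhb : ∀ u, U u → h u ≤ b u := fun u hu => by
    rw [← hssum u hu]
    exact add_le_add le_rfl (Finset.sum_le_sum fun e _ => hsL e)
  have haE : ∀ u, a u - A u = ∑ e ∈ E with F.debtor e = u, (F.pay S e (b u) - p e) := fun u => by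
    rw [← hRA u, Finset.sum_sub_distrib]
    have : ∑ e ∈ E with F.debtor e = u, Q (Fin.natAdd m e)
        = ∑ e ∈ E with F.debtor e = u, F.pay S e (b u) :=
      Finset.sum_congr rfl fun e he => by rw [hQR e, (Finset.mem_filter.1 he).2]
    rw [← this]; simp only [a]; ring
  have hbE : ∀ u, b u - A u = ∑ e ∈ E with F.debtor e = u, (F.pay S e (a u) - p e) := fun u => by
    rw [← hRA u, Finset.sum_sub_distrib]
    have : ∑ e ∈ E with F.debtor e = u, Q (Fin.castAdd m e)
        = ∑ e ∈ E with F.debtor e = u, F.pay S e (a u) :=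
      Finset.sum_congr rfl fun e he => by rw [hQL e, (Finset.mem_filter.1 he).2]
    rw [← this]; simp only [b]; ring
  have hnn : ∀ u c, A u ≤ c → ∀ e, F.debtor e = u → 0 ≤ F.pay S e c - p e := fun u c hc e he => by
    rw [hp.1 e]
    refine sub_nonneg.2 (hF.pay_mono e _ _ (hA0 _) ?_)
    rw [he]; exact hc
  have hlt : ∀ u, U u → A u < a u := fun u hu => (hU.lt u hu).trans_le (hha u hu)
  have hltb : ∀ u, U u → A u < b u := fun u hu => (hU.lt u hu).trans_le (hhb u hu)
  have key : ∀ u, U u → (∑ e ∈ Eᶜ with F.debtor e = u, (F.pay S e (a u) - p e)) = 0 ∧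
      min (a u) (F.debt u) - min (A u) (F.debt u) = a u - A u := fun u hu => by
    have h1 := hEsum u (a u) (hlt u hu).le
    have h2 := hEsum u (b u) (hltb u hu).le
    have h3 : 0 ≤ ∑ e ∈ Eᶜ with F.debtor e = u, (F.pay S e (a u) - p e) :=
      Finset.sum_nonneg fun e he => hnn u _ (hlt u hu).le e (Finset.mem_filter.1 he).2
    have h4 : 0 ≤ ∑ e ∈ Eᶜ with F.debtor e = u, (F.pay S e (b u) - p e) :=
      Finset.sum_nonneg fun e he => hnn u _ (hltb u hu).le e (Finset.mem_filter.1 he).2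
    have h5 := min_sub_min_le (F.debt u) (hlt u hu).le
    have h6 := min_sub_min_le (F.debt u) (hltb u hu).le
    rw [← hbE u] at h1
    rw [← haE u] at h2
    constructor <;> linarith
  refine ⟨hlt, fun u hu => ?_, fun e he hact => ?_⟩
  · have h1 := (key u hu).2
    have h2 := hlt u hu
    change a u ≤ F.debt u
    by_contra! hcon
    rw [min_eq_right hcon.le] at h1
    rcases min_choice (A u) (F.debt u) with h | h <;> rw [h] at h1 <;> linarith
  · have h1 := (Finset.sum_eq_zero_iff_of_nonneg fun e' he' =>
      hnn _ _ (hlt _ he).le e' (Finset.mem_filter.1 he').2).1 (key _ he).1 e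
      (Finset.mem_filter.2 ⟨Finset.mem_compl.2 hact, rfl⟩)
    exact sub_eq_zero.1 h1

/-- The trade of the claims in `C` for the return `ρ`, with the same haircut rate for all of them. -/
def Network.uniformTrade {K : Type} [Field K] (F : Network K n m) (C : Finset (Fin m)) (ρ : K) :
    MultiTrade K m where
  claims := C
  rate := fun _ => ρ / ∑ e ∈ C, (F.liability e : K)

theorem Network.tradeReturn_uniformTrade (F : Network ℝ n m) {C : Finset (Fin m)} {ρ : ℝ}
    (hC : 0 < ∑ e ∈ C, (F.liability e : ℝ)) : F.tradeReturn (F.uniformTrade C ρ) = ρ := by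
  simp only [Network.tradeReturn, Network.uniformTrade]
  rw [← Finset.mul_sum, div_mul_cancel₀ _ hC.ne']

theorem Network.isMultiTrade_uniformTrade (F : Network ℝ n m) {v w : Fin n} (hvw : v ≠ w)
    {C : Finset (Fin m)} {ρ R : ℝ} (hin : ∀ e ∈ C, F.creditor e = v)
    (hde : ∀ e ∈ C, F.debtor e ≠ w) (hC : 0 < ∑ e ∈ C, (F.liability e : ℝ)) (hρ : 0 ≤ ρ)
    (hR : ρ ≤ R * ∑ e ∈ C, (F.liability e : ℝ)) (hw : ρ ≤ F.external w) :
    F.IsMultiTrade v w R (F.uniformTrade C ρ) where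
  distinct := hvw
  incoming := hin
  debtor_ne := hde
  rate_mem := fun _ _ => ⟨div_nonneg hρ hC.le, (div_le_iff₀ hC).2 hR⟩
  affordable := by rwa [F.tradeReturn_uniformTrade hC]

/-- The net transfer of a creditor-positive trade is positive, so neither the assets of `w` nor the
liabilities of the traded claims are exhausted by the payments that change hands. -/
theorem Network.IsExactPositive.claims_slack {F : Network ℝ n m} (hF : F.Valid S)
    {v w : Fin n} {p : Fin m → ℝ} (hp : F.IsClearingState S p) {T : MultiTrade ℝ m}
    (hT : F.IsExactPositive S v w T) :
    0 < F.external w - ∑ e ∈ T.claims, p e ∧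
    0 < (∑ e ∈ T.claims, (F.liability e : ℝ)) - ∑ e ∈ T.claims, p e := by
  have hF' := hT.1.valid hF
  obtain ⟨q, hq⟩ := hF'.exists_isClearingState
  obtain ⟨hpq, -, -, -, hx, -⟩ := hT.structure hF hp hq
  have h1 : ∑ e ∈ T.claims, p e ≤ ∑ e ∈ T.claims, q e := Finset.sum_le_sum fun e _ => hpq e
  have h2 := hT.1.affordable
  have h3 : F.tradeReturn T ≤ ∑ e ∈ T.claims, (F.liability e : ℝ) :=
    Finset.sum_le_sum fun e he =>
      mul_le_of_le_one_left (Nat.cast_nonneg _) (hT.1.rate_mem e he).2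
  constructor <;> linarith

/-- If thresholds are known, then every sufficiently small increase of the assets of `v` is achieved
by an exact creditor-positive trade. -/
theorem Network.IsExactPositive.exists_small_gain {F : Network ℝ n m} (hF : F.Valid S)
    {v w : Fin n} {p : Fin m → ℝ} (hp : F.IsClearingState S p) {T : MultiTrade ℝ m}
    (hT : F.IsExactPositive S v w T) {h : Fin n → ℝ}
    (hU : F.Threshold S p (F.Reach S (F.assets p) v w v) h) {τ : ℝ} (hτ : 0 < τ)
    (hτv : τ ≤ h v - F.assets p v) (hτw : τ ≤ F.external w - ∑ e ∈ T.claims, p e)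
    (hτC : τ ≤ (∑ e ∈ T.claims, (F.liability e : ℝ)) - ∑ e ∈ T.claims, p e)
    (hprobe : ∀ u, F.Reach S (F.assets p) v w v u → u ≠ v → ∃ q,
      F.FixedClearing S {v, w, u} (probeLevel (F.assets p) h u) q ∧
      τ < F.inflow q v - F.inflow p v + (F.inflow q w - F.inflow p w)) :
    ∃ T', F.IsExactPositive S v w T' ∧
      F.totalAssets S v + τ ≤ (F.afterTrade v w T').totalAssets S v := by
  have hM := hT.1
  have hvw := hM.distinct
  have hp0 := hp.nonneg hF
  set b := F.assets p v + τ with hb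
  have hvb : F.assets p v < b := by linarith
  have hb0 : 0 ≤ b := (hF.assets_nonneg hp0 v).trans hvb.le
  obtain ⟨r, hr⟩ := hF.exists_fixedClearing (S := S) {v, w}
    (partnerLevel v b (F.assets p w)) fun u _ => partnerLevel_nonneg hF hp0 v w hb0 u
  have hpr : p ≤ r := FixedClearing.partner_ge hF hp hvb.le hr
  have htr := level_of_small hF hp hvw hU hvb (by linarith) (fun u hu huv => by
    obtain ⟨q, hq, hlt⟩ := hprobe u hu huv
    exact ⟨q, hq, by linarith⟩) hr
  have hpos := transfer_pos hp hvw hvb hr.follows hpr htr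
  have hr0 : 0 ≤ ∑ e ∈ T.claims, r e := Finset.sum_nonneg fun e _ => hp0.trans hpr e
  have hpC : 0 ≤ ∑ e ∈ T.claims, p e := Finset.sum_nonneg fun e _ => hp0 e
  have hρ : F.transfer v b r + ∑ e ∈ T.claims, r e ≤ τ + ∑ e ∈ T.claims, p e := by
    have hsub : ∑ e ∈ T.claims, (r e - p e) ≤ F.inflow r v - F.inflow p v := by
      rw [Network.inflow, Network.inflow, ← Finset.sum_sub_distrib]
      exact Finset.sum_le_sum_of_subset_of_nonneg
        (fun e he => by simpa using hM.incoming e he) fun e _ _ => sub_nonneg.2 (hpr e)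
    rw [Finset.sum_sub_distrib] at hsub
    unfold Network.transfer
    rw [hb, F.assets_eq]
    linarith
  have hC : 0 < ∑ e ∈ T.claims, (F.liability e : ℝ) := by linarith
  have hM' := F.isMultiTrade_uniformTrade hvw (C := T.claims) (R := 1) hM.incoming hM.debtor_ne hC
    (by linarith : 0 ≤ F.transfer v b r + ∑ e ∈ T.claims, r e) (by linarith) (by linarith)
  have hA := achieves_level hF hp hb0 hr (by rw [F.assets_eq]; linarith) hM'
    (F.tradeReturn_uniformTrade hC)
  have hv : F.totalAssets S v = F.assets p v := by
    unfold Network.totalAssets; rw [hp.clearing_eq hF]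
  refine ⟨_, ⟨hM', ?_, hA.2⟩, ?_⟩
  · rw [hv]; exact hvb.trans_le hA.1
  · rw [hv]; exact hA.1

end Doubled


/-! ### Polynomial bounds and sizes -/

section Polynomial

variable {ι κ : Type}

/-- `f` is bounded by a polynomial in `μ`, uniformly over a family of instances. -/
def PolyBdd (μ f : ι → ℕ) : Prop := ∃ k, ∀ i, f i ≤ (μ i + 2) ^ k

theorem PolyBdd.mono {μ f g : ι → ℕ} (hf : PolyBdd μ f) (h : ∀ i, g i ≤ f i) : PolyBdd μ g :=
  let ⟨k, hk⟩ := hf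
  ⟨k, fun i => (h i).trans (hk i)⟩

theorem PolyBdd.const (μ : ι → ℕ) (c : ℕ) : PolyBdd μ fun _ => c :=
  ⟨c, fun _ => (Nat.lt_two_pow_self).le.trans (Nat.pow_le_pow_left (by omega) _)⟩

theorem PolyBdd.refl (μ : ι → ℕ) : PolyBdd μ μ := ⟨1, fun i => by rw [pow_one]; omega⟩

theorem PolyBdd.add {μ f g : ι → ℕ} (hf : PolyBdd μ f) (hg : PolyBdd μ g) :
    PolyBdd μ fun i => f i + g i := by
  obtain ⟨a, ha⟩ := hf
  obtain ⟨b, hb⟩ := hg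
  refine ⟨a + b + 1, fun i => ?_⟩
  have h1 : (μ i + 2) ^ a ≤ (μ i + 2) ^ (a + b) := Nat.pow_le_pow_right (by omega) (by omega)
  have h2 : (μ i + 2) ^ b ≤ (μ i + 2) ^ (a + b) := Nat.pow_le_pow_right (by omega) (by omega)
  have h3 : (μ i + 2) ^ (a + b) * 2 ≤ (μ i + 2) ^ (a + b + 1) := by
    rw [pow_succ]; exact Nat.mul_le_mul_left _ (by omega)
  have := ha i
  have := hb i
  change f i + g i ≤ _
  omega

theorem PolyBdd.mul {μ f g : ι → ℕ} (hf : PolyBdd μ f) (hg : PolyBdd μ g) :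
    PolyBdd μ fun i => f i * g i := by
  obtain ⟨a, ha⟩ := hf
  obtain ⟨b, hb⟩ := hg
  exact ⟨a + b, fun i => by rw [pow_add]; exact Nat.mul_le_mul (ha i) (hb i)⟩

theorem PolyBdd.pow {μ f : ι → ℕ} (hf : PolyBdd μ f) (k : ℕ) : PolyBdd μ fun i => f i ^ k := by
  obtain ⟨a, ha⟩ := hf
  exact ⟨a * k, fun i => by rw [pow_mul]; exact Nat.pow_le_pow_left (ha i) k⟩

theorem PolyBdd.trans {μ ν f : ι → ℕ} (hf : PolyBdd ν f) (hν : PolyBdd μ ν) : PolyBdd μ f := by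
  obtain ⟨k, hk⟩ := hf
  exact ((hν.add (PolyBdd.const μ 2)).pow k).mono hk

theorem PolyBdd.comap {μ f : ι → ℕ} (hf : PolyBdd μ f) (φ : κ → ι) :
    PolyBdd (fun j => μ (φ j)) fun j => f (φ j) :=
  let ⟨k, hk⟩ := hf
  ⟨k, fun j => hk (φ j)⟩

end Polynomial

section Sizes

theorem Data.size_pos (x : Data) : 0 < x.size := by cases x <;> simp [Data.size]

theorem Data.size_ofList (l : List Data) :
    (Data.ofList l).size = (l.map fun a => a.size + 1).sum + 2 := by
  induction l with
  | nil => rfl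
  | cons a l ih => simp only [Data.ofList, Data.size, ih, List.map_cons, List.sum_cons]; omega

theorem Data.length_le_size (l : List Data) : l.length ≤ (Data.ofList l).size := by
  induction l with
  | nil => simp
  | cons a l ih => simp only [Data.ofList, Data.size, List.length_cons]; omega

theorem Data.size_le_of_mem {l : List Data} {a : Data} (h : a ∈ l) :
    a.size ≤ (Data.ofList l).size := by
  induction l with
  | nil => simp at h
  | cons b l ih =>
    simp only [Data.ofList, Data.size]
    rcases List.mem_cons.1 h with rfl | h
    · omega
    · have := ih h; omega

theorem Data.size_ofList_sublist {l l' : List Data} (h : l.Sublist l') :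
    (Data.ofList l).size ≤ (Data.ofList l').size := by
  induction h with
  | slnil => exact le_rfl
  | cons _ _ ih => simp only [Data.ofList, Data.size]; omega
  | cons_cons _ _ ih => simp only [Data.ofList, Data.size]; omega

theorem Data.size_ofList_le {l : List Data} {B : ℕ} (h : ∀ a ∈ l, a.size ≤ B) :
    (Data.ofList l).size ≤ l.length * (B + 1) + 2 := by
  rw [Data.size_ofList]
  have := List.sum_le_card_nsmul (l.map fun a => a.size + 1) (B + 1) (by simpa using h)
  simpa using this

theorem Data.size_ofList_reverse (l : List Data) :
    (Data.ofList l.reverse).size = (Data.ofList l).size := by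
  simp [Data.size_ofList, List.sum_reverse]

theorem size_num (q : ℚ) : (Data.num q).size = q.num.natAbs.size + q.den.size + 1 := rfl

theorem abs_le_two_pow_size (q : ℚ) : |q| ≤ 2 ^ (Data.num q).size := by
  have h1 : |q| ≤ (q.num.natAbs : ℚ) := by
    have hd : (1 : ℚ) ≤ q.den := by exact_mod_cast q.den_pos
    have h : |q| * q.den = (q.num.natAbs : ℚ) := by
      rw [← Nat.abs_cast q.den, ← abs_mul, Rat.mul_den_eq_num, Nat.cast_natAbs, Int.cast_abs]
    rw [← h]
    exact le_mul_of_one_le_right (abs_nonneg _) hd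
  refine h1.trans ?_
  have h2 : q.num.natAbs ≤ 2 ^ (Data.num q).size :=
    (Nat.lt_size_self _).le.trans (Nat.pow_le_pow_right (by norm_num) (by rw [size_num]; omega))
  exact_mod_cast h2

theorem den_le_two_pow_size (q : ℚ) : q.den ≤ 2 ^ (Data.num q).size :=
  (Nat.lt_size_self _).le.trans (Nat.pow_le_pow_right (by norm_num) (by rw [size_num]; omega))

theorem size_num_le {q : ℚ} {a b : ℕ} (ha : |q| ≤ 2 ^ a) (hb : q.den ≤ 2 ^ b) :
    (Data.num q).size ≤ a + 2 * b + 3 := by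
  have h1 : q.num.natAbs ≤ 2 ^ (a + b) := by
    have h : |q| * q.den = (q.num.natAbs : ℚ) := by
      rw [← Nat.abs_cast q.den, ← abs_mul, Rat.mul_den_eq_num, Nat.cast_natAbs, Int.cast_abs]
    have hb' : (q.den : ℚ) ≤ 2 ^ b := by exact_mod_cast hb
    have : (q.num.natAbs : ℚ) ≤ 2 ^ (a + b) := by
      rw [← h, pow_add]
      exact mul_le_mul ha hb' (by positivity) (by positivity)
    exact_mod_cast this
  have h2 : q.num.natAbs.size ≤ a + b + 1 :=
    Nat.size_le.2 (h1.trans_lt (Nat.pow_lt_pow_right (by norm_num) (by omega)))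
  have h3 : q.den.size ≤ b + 1 :=
    Nat.size_le.2 (hb.trans_lt (Nat.pow_lt_pow_right (by norm_num) (by omega)))
  rw [size_num]; omega

theorem size_num_natCast_le (k : ℕ) : (Data.num (k : ℚ)).size ≤ k.size + 2 := by
  rw [size_num]; simp

theorem Nat.size_le_self (k : ℕ) : k.size ≤ k := Nat.size_le.2 Nat.lt_two_pow_self

theorem size_add_le (a b : ℚ) :
    (Data.num (a + b)).size ≤ 3 * ((Data.num a).size + (Data.num b).size) + 4 := by
  set s := (Data.num a).size
  set t := (Data.num b).size
  have h1 : |a + b| ≤ 2 ^ (s + t + 1) := by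
    refine (abs_add_le a b).trans ?_
    have ha : |a| ≤ 2 ^ (s + t) :=
      (abs_le_two_pow_size a).trans (pow_le_pow_right₀ (by norm_num) (by omega))
    have hb : |b| ≤ 2 ^ (s + t) :=
      (abs_le_two_pow_size b).trans (pow_le_pow_right₀ (by norm_num) (by omega))
    rw [pow_succ]; linarith
  have h2 : (a + b).den ≤ 2 ^ (s + t) := by
    refine (Nat.le_of_dvd (by positivity) (Rat.add_den_dvd a b)).trans ?_
    rw [pow_add]
    exact Nat.mul_le_mul (den_le_two_pow_size a) (den_le_two_pow_size b)
  have := size_num_le h1 h2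
  omega

theorem size_neg (a : ℚ) : (Data.num (-a)).size = (Data.num a).size := by
  simp [size_num]

theorem size_sub_le (a b : ℚ) :
    (Data.num (a - b)).size ≤ 3 * ((Data.num a).size + (Data.num b).size) + 4 := by
  rw [sub_eq_add_neg, ← size_neg b]; exact size_add_le a (-b)

theorem size_mul_le (a b : ℚ) :
    (Data.num (a * b)).size ≤ 3 * ((Data.num a).size + (Data.num b).size) + 4 := by
  set s := (Data.num a).size
  set t := (Data.num b).size
  have h1 : |a * b| ≤ 2 ^ (s + t) := by
    rw [abs_mul, pow_add]
    exact mul_le_mul (abs_le_two_pow_size a) (abs_le_two_pow_size b) (abs_nonneg _) (by positivity)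
  have h2 : (a * b).den ≤ 2 ^ (s + t) := by
    refine (Nat.le_of_dvd (by positivity) (Rat.mul_den_dvd a b)).trans ?_
    rw [pow_add]
    exact Nat.mul_le_mul (den_le_two_pow_size a) (den_le_two_pow_size b)
  have := size_num_le h1 h2
  omega

theorem size_inv_le (a : ℚ) : (Data.num a⁻¹).size ≤ (Data.num a).size + 2 := by
  rcases eq_or_ne a 0 with rfl | ha
  · simp
  have h1 : a⁻¹.num.natAbs = a.den := by
    rw [Rat.num_inv, Int.natAbs_mul, Int.natAbs_sign_of_ne_zero (Rat.num_ne_zero.2 ha)]; simp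
  have h2 : a⁻¹.den = a.num.natAbs := by
    rw [Rat.den_inv]; simp [ha]
  rw [size_num, size_num, h1, h2]; omega

theorem size_div_le (a b : ℚ) :
    (Data.num (a / b)).size ≤ 3 * ((Data.num a).size + (Data.num b).size) + 10 := by
  rw [div_eq_mul_inv]
  have h1 := size_mul_le a b⁻¹
  have h2 := size_inv_le b
  omega

theorem size_floor_le (a : ℚ) : (Data.num (⌊a⌋ : ℤ)).size ≤ (Data.num a).size + 4 := by
  have h1 : |((⌊a⌋ : ℤ) : ℚ)| ≤ 2 ^ ((Data.num a).size + 1) := by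
    have h := abs_le_two_pow_size a
    have h0 : (1 : ℚ) ≤ 2 ^ (Data.num a).size := one_le_pow₀ (by norm_num)
    have h2 := Int.floor_le a
    have h3 := Int.lt_floor_add_one a
    rw [pow_succ]
    rw [abs_le] at h ⊢
    constructor <;> linarith
  have := size_num_le (b := 0) h1 (by simp)
  omega

/-- A sum of rational numbers of bounded size. -/
theorem size_sum_le {α : Type} (s : Finset α) (a : α → ℚ) (B : ℕ)
    (hB : ∀ e ∈ s, (Data.num (a e)).size ≤ B) :
    (Data.num (∑ e ∈ s, a e)).size ≤ #s + B + 2 * (B * #s) + 3 := by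
  refine size_num_le ?_ ?_
  · refine (Finset.abs_sum_le_sum_abs _ _).trans ?_
    calc ∑ e ∈ s, |a e| ≤ ∑ _e ∈ s, (2 : ℚ) ^ B := Finset.sum_le_sum fun e he =>
          (abs_le_two_pow_size _).trans (pow_le_pow_right₀ (by norm_num) (hB e he))
      _ = #s * 2 ^ B := by simp
      _ ≤ 2 ^ #s * 2 ^ B := by
          gcongr; exact_mod_cast (Nat.lt_two_pow_self).le
      _ = 2 ^ (#s + B) := by rw [pow_add]
  · have h : ∀ t ⊆ s, (∑ e ∈ t, a e).den ≤ ∏ e ∈ t, (a e).den := by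
      classical
      intro t
      induction t using Finset.induction_on with
      | empty => simp
      | insert e t he ih =>
        intro ht
        rw [Finset.sum_insert he, Finset.prod_insert he]
        refine (Nat.le_of_dvd (by positivity) (Rat.add_den_dvd _ _)).trans ?_
        exact Nat.mul_le_mul_left _ (ih ((Finset.subset_insert _ _).trans ht))
    refine (h s subset_rfl).trans ?_
    calc ∏ e ∈ s, (a e).den ≤ ∏ _e ∈ s, 2 ^ B := Finset.prod_le_prod' fun e he =>
          (den_le_two_pow_size _).trans (Nat.pow_le_pow_right (by norm_num) (hB e he))
      _ = 2 ^ (B * #s) := by rw [Finset.prod_const, pow_mul]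

/-- A positive rational number is not smaller than a bound that depends on its size only. -/
theorem inv_two_pow_size_le {q : ℚ} (hq : 0 < q) : (2 ^ (Data.num q).size : ℚ)⁻¹ ≤ q := by
  have h1 : (q.den : ℚ)⁻¹ ≤ q := by
    have hd : (0 : ℚ) < q.den := by exact_mod_cast q.den_pos
    rw [inv_le_iff_one_le_mul₀ hd, Rat.mul_den_eq_num]
    exact_mod_cast (Rat.num_pos.2 hq)
  refine le_trans ?_ h1
  rw [inv_le_inv₀ (by positivity) (by exact_mod_cast q.den_pos)]
  exact_mod_cast den_le_two_pow_size q

theorem Run.size_le {P : Code} {x y : Data} {t : ℕ} (h : Run P x y t) :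
    y.size ≤ t ∧ x.size ≤ t := by
  induction h with
  | prim o x => omega
  | pair _ _ h1 h2 => simp only [Data.size]; omega
  | seq _ _ h1 h2 => omega
  | ite_true _ _ _ h1 h2 => omega
  | ite_false _ _ h1 h2 => omega
  | loop_stop _ h1 => omega
  | loop_step _ _ _ _ h1 h2 h3 => omega

end Sizes

/-! ### Polynomial-time programs -/

section Comp

variable {ι κ : Type} {μ : ι → ℕ} {Γ x y z : ι → Data}

/-- One program computes `y i` from `x i` for all instances `i`, in time polynomial in `μ i`. -/
def Comp (μ : ι → ℕ) (x y : ι → Data) : Prop :=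
  ∃ (P : Code) (k : ℕ), ∀ i, ∃ t, t ≤ (μ i + 2) ^ k ∧ Run P (x i) (y i) t

theorem Comp.of_bound (P : Code) {T : ι → ℕ} (hT : PolyBdd μ T)
    (h : ∀ i, ∃ t, t ≤ T i ∧ Run P (x i) (y i) t) : Comp μ x y :=
  let ⟨k, hk⟩ := hT
  ⟨P, k, fun i => let ⟨t, ht, hr⟩ := h i; ⟨t, ht.trans (hk i), hr⟩⟩

theorem Comp.exists_bound (h : Comp μ x y) : ∃ (P : Code) (T : ι → ℕ), PolyBdd μ T ∧
    ∀ i, ∃ t, t ≤ T i ∧ Run P (x i) (y i) t :=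
  let ⟨P, k, hk⟩ := h
  ⟨P, fun i => (μ i + 2) ^ k, ⟨k, fun _ => le_rfl⟩, hk⟩

theorem Comp.size_right (h : Comp μ x y) : PolyBdd μ fun i => (y i).size :=
  let ⟨_, k, hk⟩ := h
  ⟨k, fun i => let ⟨_, ht, hr⟩ := hk i; hr.size_le.1.trans ht⟩

theorem Comp.size_left (h : Comp μ x y) : PolyBdd μ fun i => (x i).size :=
  let ⟨_, k, hk⟩ := h
  ⟨k, fun i => let ⟨_, ht, hr⟩ := hk i; hr.size_le.2.trans ht⟩

theorem Comp.congr (h : Comp μ x y) (hy : ∀ i, y i = z i) : Comp μ x z :=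
  (funext hy : y = z) ▸ h

theorem Comp.mono {ν : ι → ℕ} (h : Comp ν x y) (hν : PolyBdd μ ν) : Comp μ x y := by
  obtain ⟨P, T, hT, hr⟩ := h.exists_bound
  exact Comp.of_bound P (hT.trans hν) hr

theorem Comp.comap (h : Comp μ x y) (φ : κ → ι) :
    Comp (fun j => μ (φ j)) (fun j => x (φ j)) fun j => y (φ j) :=
  let ⟨P, k, hk⟩ := h
  ⟨P, k, fun j => hk (φ j)⟩

theorem Comp.trans (h1 : Comp μ x y) (h2 : Comp μ y z) : Comp μ x z := by
  obtain ⟨P, T, hT, hP⟩ := h1.exists_bound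
  obtain ⟨Q, U, hU, hQ⟩ := h2.exists_bound
  refine Comp.of_bound (.seq P Q) ((hT.add hU).add (PolyBdd.const μ 1)) fun i => ?_
  obtain ⟨s, hs, h1⟩ := hP i
  obtain ⟨t, ht, h2⟩ := hQ i
  exact ⟨s + t + 1, by omega, .seq h1 h2⟩

/-- What is computed from part of the context is computed from the whole context. -/
theorem Comp.lift {ν : κ → ℕ} {Δ : κ → Data} (h : Comp μ x y) (φ : κ → ι)
    (hν : PolyBdd ν fun j => μ (φ j)) (hΔ : Comp ν Δ fun j => x (φ j)) :
    Comp ν Δ fun j => y (φ j) :=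
  hΔ.trans ((h.comap φ).mono hν)

theorem Comp.pair (h1 : Comp μ Γ x) (h2 : Comp μ Γ y) : Comp μ Γ fun i => .pair (x i) (y i) := by
  obtain ⟨P, T, hT, hP⟩ := h1.exists_bound
  obtain ⟨Q, U, hU, hQ⟩ := h2.exists_bound
  refine Comp.of_bound (.pair P Q) ((hT.add hU).add (PolyBdd.const μ 1)) fun i => ?_
  obtain ⟨s, hs, h1⟩ := hP i
  obtain ⟨t, ht, h2⟩ := hQ i
  exact ⟨s + t + 1, by omega, .pair h1 h2⟩

theorem Comp.prim (o : Op) (hx : PolyBdd μ fun i => (x i).size)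
    (hy : PolyBdd μ fun i => (o.eval (x i)).size) : Comp μ x fun i => o.eval (x i) :=
  Comp.of_bound (.prim o) (((PolyBdd.const μ 1).add hx).add hy) fun _ => ⟨_, le_rfl, .prim o _⟩

theorem Comp.op (h : Comp μ Γ x) (o : Op) (hy : PolyBdd μ fun i => (o.eval (x i)).size) :
    Comp μ Γ fun i => o.eval (x i) :=
  h.trans (Comp.prim o h.size_right hy)

theorem Comp.refl (hx : PolyBdd μ fun i => (x i).size) : Comp μ x x := Comp.prim .id hx hx

theorem Comp.const (hx : PolyBdd μ fun i => (x i).size) (d : Data) : Comp μ x fun _ => d :=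
  (Comp.prim (.const d) hx ((PolyBdd.const μ d.size).mono fun i => by simp [Op.eval])).congr
    fun i => by simp [Op.eval]

theorem Comp.fst (h : Comp μ Γ fun i => .pair (x i) (y i)) : Comp μ Γ x :=
  h.op .fst (h.size_right.mono fun i => by simp only [Op.eval, Data.size]; omega)

theorem Comp.snd (h : Comp μ Γ fun i => .pair (x i) (y i)) : Comp μ Γ y :=
  h.op .snd (h.size_right.mono fun i => by simp only [Op.eval, Data.size]; omega)

section Numbers

variable {a b : ι → ℚ}

theorem Comp.arith (o : Op) (f : ℚ → ℚ → ℚ) (c : ℕ)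
    (ho : ∀ a b, o.eval (.pair (.num a) (.num b)) = .num (f a b))
    (hc : ∀ a b, (Data.num (f a b)).size ≤ 3 * ((Data.num a).size + (Data.num b).size) + c)
    (ha : Comp μ Γ fun i => .num (a i)) (hb : Comp μ Γ fun i => .num (b i)) :
    Comp μ Γ fun i => .num (f (a i) (b i)) := by
  have hs := ((PolyBdd.const μ 3).mul (ha.size_right.add hb.size_right)).add (PolyBdd.const μ c)
  exact ((ha.pair hb).op o (hs.mono fun i => by rw [ho]; exact hc _ _)).congr fun i => ho _ _

theorem Comp.add (ha : Comp μ Γ fun i => .num (a i)) (hb : Comp μ Γ fun i => .num (b i)) :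
    Comp μ Γ fun i => .num (a i + b i) :=
  Comp.arith .add (· + ·) 4 (fun _ _ => rfl) size_add_le ha hb

theorem Comp.sub (ha : Comp μ Γ fun i => .num (a i)) (hb : Comp μ Γ fun i => .num (b i)) :
    Comp μ Γ fun i => .num (a i - b i) :=
  Comp.arith .sub (· - ·) 4 (fun _ _ => rfl) size_sub_le ha hb

theorem Comp.mul (ha : Comp μ Γ fun i => .num (a i)) (hb : Comp μ Γ fun i => .num (b i)) :
    Comp μ Γ fun i => .num (a i * b i) :=
  Comp.arith .mul (· * ·) 4 (fun _ _ => rfl) size_mul_le ha hb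

theorem Comp.div (ha : Comp μ Γ fun i => .num (a i)) (hb : Comp μ Γ fun i => .num (b i)) :
    Comp μ Γ fun i => .num (a i / b i) :=
  Comp.arith .div (· / ·) 10 (fun _ _ => rfl) size_div_le ha hb

theorem Comp.floor (ha : Comp μ Γ fun i => .num (a i)) :
    Comp μ Γ fun i => .num ((⌊a i⌋ : ℤ) : ℚ) :=
  ha.op .floor ((ha.size_right.add (PolyBdd.const μ 4)).mono fun _ => size_floor_le _)

/-- The leaf that represents a truth value. -/
noncomputable def bit (p : Prop) : Data := open Classical in if p then .num 1 else .num 0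

theorem bit_true {p : Prop} (h : p) : bit p = .num 1 := by simp [bit, h]

theorem bit_false {p : Prop} (h : ¬p) : bit p = .num 0 := by simp [bit, h]

theorem size_bit_le (p : Prop) : (bit p).size ≤ 3 := by
  by_cases h : p
  · rw [bit_true h]; rfl
  · rw [bit_false h]; decide

theorem Comp.lt (ha : Comp μ Γ fun i => .num (a i)) (hb : Comp μ Γ fun i => .num (b i)) :
    Comp μ Γ fun i => bit (a i < b i) := by
  have h : ∀ i, Op.lt.eval (.pair (.num (a i)) (.num (b i))) = bit (a i < b i) := fun i => by
    by_cases h : a i < b i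
    · rw [bit_true h]; simp [Op.eval, h]
    · rw [bit_false h]; simp only [Op.eval, h, if_false]
  exact ((ha.pair hb).op .lt ((PolyBdd.const μ 3).mono fun i => by
    rw [h]; exact size_bit_le _)).congr h

end Numbers

section Branching

variable {c d : ι → Prop}

theorem Comp.ite [DecidablePred c] (hc : Comp μ Γ fun i => bit (c i))
    (h1 : Comp (fun i : {i // c i} => μ i) (fun i => Γ i) fun i => x i)
    (h2 : Comp (fun i : {i // ¬c i} => μ i) (fun i => Γ i) fun i => y i) :
    Comp μ Γ fun i => if c i then x i else y i := by
  obtain ⟨C, a, ha⟩ := hc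
  obtain ⟨P, k, hk⟩ := h1
  obtain ⟨Q, l, hl⟩ := h2
  have hpow : ∀ k, PolyBdd μ fun i => (μ i + 2) ^ k := fun k => ⟨k, fun _ => le_rfl⟩
  refine Comp.of_bound (.ite C P Q)
    ((((hpow a).add (hpow k)).add (hpow l)).add (PolyBdd.const μ 1)) fun i => ?_
  obtain ⟨s, hs, hC⟩ := ha i
  beta_reduce at hC
  by_cases h : c i
  · obtain ⟨t, ht, hP⟩ := hk ⟨i, h⟩
    refine ⟨s + t + 1, by simp only at ht; omega, ?_⟩
    rw [if_pos h]
    exact .ite_true hC (by rw [bit_true h]; simp) hP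
  · obtain ⟨t, ht, hQ⟩ := hl ⟨i, h⟩
    refine ⟨s + t + 1, by simp only at ht; omega, ?_⟩
    rw [if_neg h]
    rw [bit_false h] at hC
    exact .ite_false hC hQ

theorem Comp.ite' [DecidablePred c] (hc : Comp μ Γ fun i => bit (c i)) (h1 : Comp μ Γ x)
    (h2 : Comp μ Γ y) : Comp μ Γ fun i => if c i then x i else y i :=
  hc.ite (h1.comap _) (h2.comap _)

theorem Comp.not (hc : Comp μ Γ fun i => bit (c i)) : Comp μ Γ fun i => bit (¬c i) := by
  classical
  refine (hc.ite' (Comp.const hc.size_left (.num 0)) (Comp.const hc.size_left (.num 1))).congr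
    fun i => ?_
  by_cases h : c i
  · rw [if_pos h, bit_false (not_not.2 h)]
  · rw [if_neg h, bit_true h]

theorem Comp.and (hc : Comp μ Γ fun i => bit (c i)) (hd : Comp μ Γ fun i => bit (d i)) :
    Comp μ Γ fun i => bit (c i ∧ d i) := by
  classical
  refine (hc.ite' hd (Comp.const hc.size_left (.num 0))).congr fun i => ?_
  by_cases h : c i
  · rw [if_pos h]; simp [h]
  · rw [if_neg h, bit_false fun h' => h h'.1]

theorem Comp.or (hc : Comp μ Γ fun i => bit (c i)) (hd : Comp μ Γ fun i => bit (d i)) :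
    Comp μ Γ fun i => bit (c i ∨ d i) :=
  (hc.not.and hd.not).not.congr fun i => congrArg bit (propext (by tauto))

theorem Comp.le {a b : ι → ℚ} (ha : Comp μ Γ fun i => .num (a i))
    (hb : Comp μ Γ fun i => .num (b i)) : Comp μ Γ fun i => bit (a i ≤ b i) :=
  (hb.lt ha).not.congr fun _ => congrArg bit (propext not_lt)

theorem Comp.eq {a b : ι → ℚ} (ha : Comp μ Γ fun i => .num (a i))
    (hb : Comp μ Γ fun i => .num (b i)) : Comp μ Γ fun i => bit (a i = b i) :=
  ((ha.le hb).and (hb.le ha)).congr fun _ => congrArg bit (propext le_antisymm_iff.symm)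

end Branching

end Comp


/-! ### Loops -/

section Loops

variable {ι κ : Type} {μ : ι → ℕ} {Γ x y z : ι → Data}

/-- The rounds of a loop that makes `n i` of them on the instance `i`. -/
abbrev Below (n : ι → ℕ) : Type := {q : ι × ℕ // q.2 < n q.1}

/-- The states of a loop that makes `n i` rounds on the instance `i`. -/
abbrev Upto (n : ι → ℕ) : Type := {q : ι × ℕ // q.2 ≤ n q.1}

theorem PolyBdd.upto {n : ι → ℕ} {f : ι → ℕ → ℕ}
    (h : PolyBdd (fun q : Below n => μ q.1.1) fun q => f q.1.1 q.1.2)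
    (h' : PolyBdd μ fun i => f i (n i)) :
    PolyBdd (fun q : Upto n => μ q.1.1) fun q => f q.1.1 q.1.2 := by
  obtain ⟨a, ha⟩ := h
  obtain ⟨b, hb⟩ := h'
  refine PolyBdd.mono (f := fun q : Upto n => (μ q.1.1 + 2) ^ a + (μ q.1.1 + 2) ^ b)
    (PolyBdd.add ⟨a, fun _ => le_rfl⟩ ⟨b, fun _ => le_rfl⟩) fun q => ?_
  obtain ⟨⟨i, j⟩, hj⟩ := q
  simp only at hj ⊢
  rcases hj.lt_or_eq with h | rfl
  · have := ha ⟨(i, j), h⟩; simp only at this; omega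
  · have := hb i; simp only at this; omega

/-- A loop that makes polynomially many rounds, each in polynomial time. -/
theorem Comp.loop {n : ι → ℕ} {s : ι → ℕ → Data} (hn : PolyBdd μ n)
    (htest : Comp (fun q : Upto n => μ q.1.1) (fun q => s q.1.1 q.1.2)
      fun q => bit (q.1.2 < n q.1.1))
    (hstep : Comp (fun q : Below n => μ q.1.1) (fun q => s q.1.1 q.1.2)
      fun q => s q.1.1 (q.1.2 + 1)) :
    Comp μ (fun i => s i 0) fun i => s i (n i) := by
  obtain ⟨b, hb⟩ := htest.size_left
  obtain ⟨C, a, ha⟩ := htest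
  obtain ⟨P, k, hk⟩ := hstep
  have hpow : ∀ k, PolyBdd μ fun i => (μ i + 2) ^ k := fun k => ⟨k, fun _ => le_rfl⟩
  refine Comp.of_bound (.loop C P)
    ((hn.mul (((hpow a).add (hpow k)).add (PolyBdd.const μ 1))).add
      (((hpow a).add (hpow b)).add (PolyBdd.const μ 1))) fun i => ?_
  have key : ∀ d j, j + d = n i → ∃ t, t ≤ d * ((μ i + 2) ^ a + (μ i + 2) ^ k + 1)
      + ((μ i + 2) ^ a + (μ i + 2) ^ b + 1) ∧ Run (.loop C P) (s i j) (s i (n i)) t := by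
    intro d
    induction d with
    | zero =>
      intro j hj
      rw [add_zero] at hj
      obtain ⟨t, ht, hC⟩ := ha ⟨(i, j), hj.le⟩
      have hsz := hb ⟨(i, j), hj.le⟩
      simp only at ht hC hsz
      rw [bit_false (by omega)] at hC
      refine ⟨t + (s i j).size + 1, by omega, ?_⟩
      rw [← hj]
      exact Run.loop_stop hC
    | succ d ih =>
      intro j hj
      obtain ⟨t, ht, hC⟩ := ha ⟨(i, j), by simp only; omega⟩
      obtain ⟨u, hu, hP⟩ := hk ⟨(i, j), by simp only; omega⟩
      obtain ⟨r, hr, hL⟩ := ih (j + 1) (by omega)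
      simp only at ht hC hu hP
      rw [bit_true (by omega)] at hC
      refine ⟨t + u + r + 1, ?_, .loop_step hC (by simp) hP hL⟩
      rw [Nat.succ_mul]
      omega
  exact key (n i) 0 (by omega)

/-- Iteration with a precomputed number of rounds. -/
theorem Comp.iter {n : ι → ℕ} {acc : ι → ℕ → Data} (hnb : PolyBdd μ n)
    (hn : Comp μ Γ fun i => .num (n i)) (h0 : Comp μ Γ fun i => acc i 0)
    (hstep : Comp (fun q : Below n => μ q.1.1) (fun q => .pair (Γ q.1.1) (acc q.1.1 q.1.2))
      fun q => acc q.1.1 (q.1.2 + 1)) :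
    Comp μ Γ fun i => acc i (n i) := by
  have hΓ := hn.size_left
  have hacc : PolyBdd (fun q : Upto n => μ q.1.1) fun q => (acc q.1.1 q.1.2).size := by
    refine PolyBdd.upto (f := fun i j => (acc i j).size)
      (hstep.size_left.mono fun q => by simp only [Data.size]; omega) ?_
    obtain ⟨a, ha⟩ := hstep.size_right
    obtain ⟨b, hb⟩ := h0.size_right
    refine PolyBdd.mono (f := fun i => (μ i + 2) ^ a + (μ i + 2) ^ b)
      (PolyBdd.add ⟨a, fun _ => le_rfl⟩ ⟨b, fun _ => le_rfl⟩) fun i => ?_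
    rcases Nat.eq_zero_or_pos (n i) with h | h
    · rw [h]; exact (hb i).trans (Nat.le_add_left _ _)
    · have := ha ⟨(i, n i - 1), by simp only; omega⟩
      simp only [Nat.sub_add_cancel h] at this
      exact this.trans (Nat.le_add_right _ _)
  let s : ι → ℕ → Data := fun i j => .pair (Γ i) (.pair (.num ((n i - j : ℕ) : ℚ)) (acc i j))
  have hs : PolyBdd (fun q : Upto n => μ q.1.1) fun q => (s q.1.1 q.1.2).size :=
    (((hΓ.comap fun q : Upto n => q.1.1).add ((hnb.comap fun q : Upto n => q.1.1).add
      hacc)).add (PolyBdd.const _ 4)).mono fun q => by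
        have h1 := size_num_natCast_le (n q.1.1 - q.1.2)
        have h2 := Nat.size_le_self (n q.1.1 - q.1.2)
        simp only [s, Data.size] at h1 ⊢
        omega
  have hs' : PolyBdd (fun q : Below n => μ q.1.1) fun q => (s q.1.1 q.1.2).size :=
    hs.comap fun q : Below n => (⟨q.1, q.2.le⟩ : Upto n)
  have htest : Comp (fun q : Upto n => μ q.1.1) (fun q => s q.1.1 q.1.2)
      fun q => bit (q.1.2 < n q.1.1) :=
    ((Comp.const hs (.num 0)).lt (Comp.refl hs).snd.fst).congr fun q => congrArg bit (propext (by
      rw [Nat.cast_pos]; omega))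
  have hstep' : Comp (fun q : Below n => μ q.1.1) (fun q => s q.1.1 q.1.2)
      fun q => s q.1.1 (q.1.2 + 1) :=
    (Comp.refl hs').fst.pair ((((Comp.refl hs').snd.fst.sub (Comp.const hs' (.num 1))).congr
      fun q => by
        have := q.2
        congr 1
        rw [← Nat.sub_sub, Nat.cast_pred (by omega)]).pair
      (((Comp.refl hs').fst.pair (Comp.refl hs').snd.snd).trans hstep))
  exact ((Comp.refl hΓ).pair (hn.pair h0)).trans (Comp.loop hnb htest hstep').snd.snd

/-- A bounded loop over the entries of a list. -/
theorem Comp.fold {L : ι → List Data} {acc : ι → ℕ → Data}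
    (hL : Comp μ Γ fun i => Data.ofList (L i)) (h0 : Comp μ Γ fun i => acc i 0)
    (hstep : Comp (fun q : Below fun i => (L i).length => μ q.1.1)
      (fun q => .pair (Γ q.1.1) (.pair ((L q.1.1)[q.1.2]'q.2) (acc q.1.1 q.1.2)))
      fun q => acc q.1.1 (q.1.2 + 1)) :
    Comp μ Γ fun i => acc i (L i).length := by
  have hΓ := hL.size_left
  set n : ι → ℕ := fun i => (L i).length with hn
  have hnb : PolyBdd μ n := hL.size_right.mono fun i => Data.length_le_size _
  have hacc : PolyBdd (fun q : Upto n => μ q.1.1) fun q => (acc q.1.1 q.1.2).size := by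
    refine PolyBdd.upto (f := fun i j => (acc i j).size)
      (hstep.size_left.mono fun q => by simp only [Data.size]; omega) ?_
    obtain ⟨a, ha⟩ := hstep.size_right
    obtain ⟨b, hb⟩ := h0.size_right
    refine PolyBdd.mono (f := fun i => (μ i + 2) ^ a + (μ i + 2) ^ b)
      (PolyBdd.add ⟨a, fun _ => le_rfl⟩ ⟨b, fun _ => le_rfl⟩) fun i => ?_
    rcases Nat.eq_zero_or_pos (n i) with h | h
    · rw [h]; exact (hb i).trans (Nat.le_add_left _ _)
    · have := ha ⟨(i, n i - 1), by simp only [n]; simp only [n] at h; omega⟩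
      simp only [Nat.sub_add_cancel h] at this
      exact this.trans (Nat.le_add_right _ _)
  let s : ι → ℕ → Data := fun i j => .pair (Γ i) (.pair (.ofList ((L i).drop j)) (acc i j))
  have hs : PolyBdd (fun q : Upto n => μ q.1.1) fun q => (s q.1.1 q.1.2).size :=
    (((hΓ.comap fun q : Upto n => q.1.1).add ((hL.size_right.comap fun q : Upto n => q.1.1).add
      hacc)).add (PolyBdd.const _ 4)).mono fun q => by
        have h1 := Data.size_ofList_sublist (List.drop_sublist q.1.2 (L q.1.1))
        simp only [s, Data.size]
        omega
  have hs' : PolyBdd (fun q : Below n => μ q.1.1) fun q => (s q.1.1 q.1.2).size :=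
    hs.comap fun q : Below n => (⟨q.1, q.2.le⟩ : Upto n)
  have hisPair : ∀ l : List Data, Op.isPair.eval (Data.ofList l) = bit (0 < l.length) := fun l => by
    cases l with
    | nil => rw [bit_false (by simp)]; rfl
    | cons a l => rw [bit_true (by simp)]; rfl
  have htest : Comp (fun q : Upto n => μ q.1.1) (fun q => s q.1.1 q.1.2)
      fun q => bit (q.1.2 < n q.1.1) :=
    ((Comp.refl hs).snd.fst.op .isPair ((PolyBdd.const _ 3).mono fun q => by
      rw [hisPair]; exact size_bit_le _)).congr fun q => by
        rw [hisPair]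
        refine congrArg bit (propext ?_)
        rw [List.length_drop]
        simp only [hn]
        omega
  have hcons : Comp (fun q : Below n => μ q.1.1) (fun q => s q.1.1 q.1.2)
      fun q => .pair ((L q.1.1)[q.1.2]'q.2) (.ofList ((L q.1.1).drop (q.1.2 + 1))) :=
    (Comp.refl hs').snd.fst.congr fun q => by
      rw [List.drop_eq_getElem_cons q.2, Data.ofList]
  have hstep' : Comp (fun q : Below n => μ q.1.1) (fun q => s q.1.1 q.1.2)
      fun q => s q.1.1 (q.1.2 + 1) :=
    (Comp.refl hs').fst.pair (hcons.snd.pair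
      (((Comp.refl hs').fst.pair (hcons.fst.pair (Comp.refl hs').snd.snd)).trans hstep))
  exact ((Comp.refl hΓ).pair (hL.pair h0)).trans (Comp.loop hnb htest hstep').snd.snd

end Loops

/-! ### Programs on vectors -/

section Vectors

variable {ι κ : Type} {μ : ι → ℕ} {Γ x y z : ι → Data} {m : ι → ℕ}

/-- The representation of a vector. -/
def vec {m : ℕ} (g : Fin m → Data) : Data := Data.ofList (List.ofFn g)

/-- The instances together with an index. -/
abbrev Entry (m : ι → ℕ) : Type := Σ i, Fin (m i)

theorem Comp.reverse {L : ι → List Data} (hL : Comp μ Γ fun i => Data.ofList (L i)) :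
    Comp μ Γ fun i => Data.ofList (L i).reverse := by
  have hsz : PolyBdd (fun q : Below fun i => (L i).length => μ q.1.1) fun q =>
      (Data.pair (Γ q.1.1) (.pair ((L q.1.1)[q.1.2]'q.2)
        (.ofList ((L q.1.1).take q.1.2).reverse))).size :=
    (((hL.size_left.add ((hL.size_right).add hL.size_right)).add (PolyBdd.const _ 4)).comap
      fun q : Below fun i => (L i).length => q.1.1).mono fun q => by
        have h1 := Data.size_le_of_mem (List.getElem_mem q.2)
        have h2 := Data.size_ofList_sublist (List.take_sublist q.1.2 (L q.1.1))
        simp only [Data.size, Data.size_ofList_reverse]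
        omega
  refine (Comp.fold (acc := fun i j => Data.ofList ((L i).take j).reverse) hL
    ((Comp.const hL.size_left (.num 0)).congr fun i => by simp [Data.ofList])
    (((Comp.refl hsz).snd.fst.pair (Comp.refl hsz).snd.snd).congr fun q => ?_)).congr fun i => ?_
  · rw [List.take_succ_eq_append_getElem q.2, List.reverse_append]
    simp [Data.ofList]
  · simp

/-- A loop over the entries of a vector, from the first to the last. -/
theorem Comp.foldVec {g : ∀ i, Fin (m i) → Data} {acc : ι → ℕ → Data}
    (hg : Comp μ Γ fun i => vec (g i)) (h0 : Comp μ Γ fun i => acc i 0)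
    (hstep : Comp (fun q : Entry m => μ q.1)
      (fun q => .pair (Γ q.1) (.pair (g q.1 q.2) (acc q.1 q.2)))
      fun q => acc q.1 (q.2 + 1)) :
    Comp μ Γ fun i => acc i (m i) := by
  refine (Comp.fold (L := fun i => List.ofFn (g i)) hg h0 ?_).congr fun i => by simp
  have h := hstep.comap fun q : Below fun i => (List.ofFn (g i)).length =>
    (⟨q.1.1, ⟨q.1.2, by simpa using q.2⟩⟩ : Entry m)
  simpa using h

/-- A loop over the entries of a vector, from the last to the first. -/
theorem Comp.foldVecRev {g : ∀ i, Fin (m i) → Data} {acc : ι → ℕ → Data}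
    (hg : Comp μ Γ fun i => vec (g i)) (h0 : Comp μ Γ fun i => acc i (m i))
    (hstep : Comp (fun q : Entry m => μ q.1)
      (fun q => .pair (Γ q.1) (.pair (g q.1 q.2) (acc q.1 (q.2 + 1))))
      fun q => acc q.1 q.2) :
    Comp μ Γ fun i => acc i 0 := by
  refine (Comp.fold (L := fun i => (List.ofFn (g i)).reverse) (acc := fun i j => acc i (m i - j))
    hg.reverse (h0.congr fun i => by simp) ?_).congr fun i => by simp
  have h := hstep.comap fun q : Below fun i => (List.ofFn (g i)).reverse.length =>
    (⟨q.1.1, ⟨m q.1.1 - 1 - q.1.2, by have := q.2; simp at this; omega⟩⟩ : Entry m)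
  have h1 : ∀ q : Below fun i => (List.ofFn (g i)).reverse.length,
      m q.1.1 - 1 - q.1.2 + 1 = m q.1.1 - q.1.2 := fun q => by
    have := q.2; simp at this; omega
  have h2 : ∀ q : Below fun i => (List.ofFn (g i)).reverse.length,
      m q.1.1 - 1 - q.1.2 = m q.1.1 - (q.1.2 + 1) := fun q => by omega
  simp only [h1] at h
  simpa [h2, List.getElem_reverse] using h

theorem Comp.length {g : ∀ i, Fin (m i) → Data} (hg : Comp μ Γ fun i => vec (g i)) :
    Comp μ Γ fun i => .num (m i : ℚ) := by
  have hm : PolyBdd μ m := hg.size_right.mono fun i => by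
    simpa [vec] using Data.length_le_size (List.ofFn (g i))
  have hsz : PolyBdd (fun q : Entry m => μ q.1) fun q =>
      (Data.pair (Γ q.1) (.pair (g q.1 q.2) (.num ((q.2 : ℕ) : ℚ)))).size :=
    (((hg.size_left.add (hg.size_right.add hm)).add (PolyBdd.const _ 4)).comap
      fun q : Entry m => q.1).mono fun q => by
        have h1 : (g q.1 q.2).size ≤ (vec (g q.1)).size := Data.size_le_of_mem (by simp)
        have h2 := size_num_natCast_le q.2
        have h3 := Nat.size_le_self q.2
        have h4 := q.2.2
        simp only [Data.size] at h2 ⊢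
        omega
  refine Comp.foldVec (acc := fun i j => .num (j : ℚ)) hg
    ((Comp.const hg.size_left (.num 0)).congr fun i => by simp) ?_
  exact ((Comp.refl hsz).snd.snd.add (Comp.const hsz (.num 1))).congr fun q => by push_cast; rfl

theorem Comp.length_bdd {g : ∀ i, Fin (m i) → Data} (hg : Comp μ Γ fun i => vec (g i)) :
    PolyBdd μ m := hg.size_right.mono fun i => by
  simpa [vec] using Data.length_le_size (List.ofFn (g i))

theorem Comp.size_entry {g : ∀ i, Fin (m i) → Data} (hg : Comp μ Γ fun i => vec (g i)) :
    PolyBdd (fun q : Entry m => μ q.1) fun q => (g q.1 q.2).size :=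
  (hg.size_right.comap fun q : Entry m => q.1).mono fun _ => Data.size_le_of_mem (by simp)

theorem size_vec_bdd {h : ∀ i, Fin (m i) → Data} (hm : PolyBdd μ m)
    (hh : PolyBdd (fun q : Entry m => μ q.1) fun q => (h q.1 q.2).size) :
    PolyBdd μ fun i => (vec (h i)).size := by
  obtain ⟨k, hk⟩ := hh
  refine ((hm.mul (PolyBdd.add (f := fun i => (μ i + 2) ^ k) ⟨k, fun _ => le_rfl⟩
    (PolyBdd.const μ 1))).add (PolyBdd.const μ 2)).mono fun i => ?_
  have := Data.size_ofList_le (l := List.ofFn (h i)) (B := (μ i + 2) ^ k) fun a ha => by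
    obtain ⟨e, rfl⟩ := (List.mem_ofFn' _ _).1 ha
    exact hk ⟨i, e⟩
  simpa [vec] using this

/-- The entries of a vector are processed one by one; their positions are available. -/
theorem Comp.mapIdx {g h : ∀ i, Fin (m i) → Data} (hg : Comp μ Γ fun i => vec (g i))
    (hstep : Comp (fun q : Entry m => μ q.1)
      (fun q => .pair (Γ q.1) (.pair (.num ((q.2 : ℕ) : ℚ)) (g q.1 q.2)))
      fun q => h q.1 q.2) :
    Comp μ Γ fun i => vec (h i) := by
  have hm := hg.length_bdd
  have hv := size_vec_bdd hm hstep.size_right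
  have hsz : PolyBdd (fun q : Entry m => μ q.1) fun q =>
      (Data.pair (Γ q.1) (.pair (g q.1 q.2) (.pair (.num ((q.2 + 1 : ℕ) : ℚ))
        (.ofList ((List.ofFn (h q.1)).drop (q.2 + 1)))))).size :=
    (((hg.size_left.add (hg.size_right.add (hm.add hv))).add (PolyBdd.const _ 9)).comap
      fun q : Entry m => q.1).mono fun q => by
        have h1 : (g q.1 q.2).size ≤ (vec (g q.1)).size := Data.size_le_of_mem (by simp)
        have h2 := size_num_natCast_le (q.2 + 1)
        have h3 := Nat.size_le_self (q.2 + 1)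
        have h4 := q.2.2
        have h5 := Data.size_ofList_sublist (List.drop_sublist (q.2 + 1) (List.ofFn (h q.1)))
        simp only [Data.size, vec] at h1 h2 h5 ⊢
        omega
  have hC := Comp.refl hsz
  have hidx : Comp _ _ fun q : Entry m => .num ((q.2 : ℕ) : ℚ) :=
    (hC.snd.snd.fst.sub (Comp.const hsz (.num 1))).congr fun q => by push_cast; simp
  refine (Comp.foldVecRev (acc := fun i j => .pair (.num (j : ℚ))
    (.ofList ((List.ofFn (h i)).drop j))) hg
    (hg.length.pair ((Comp.const hg.size_left (.num 0)).congr fun i => by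
      rw [List.drop_eq_nil_of_le (by simp)]; rfl)) ?_).snd.congr fun i => by simp [vec]
  refine hidx.pair ((((hC.fst.pair (hidx.pair hC.snd.fst)).trans hstep).pair
    hC.snd.snd.snd).congr fun q => ?_)
  rw [List.drop_eq_getElem_cons (i := (q.2 : ℕ)) (by simp), Data.ofList]
  simp

theorem Comp.map {g h : ∀ i, Fin (m i) → Data} (hg : Comp μ Γ fun i => vec (g i))
    (hstep : Comp (fun q : Entry m => μ q.1) (fun q => .pair (Γ q.1) (g q.1 q.2))
      fun q => h q.1 q.2) :
    Comp μ Γ fun i => vec (h i) := by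
  refine hg.mapIdx ?_
  have hsz : PolyBdd (fun q : Entry m => μ q.1) fun q =>
      (Data.pair (Γ q.1) (.pair (.num ((q.2 : ℕ) : ℚ)) (g q.1 q.2))).size :=
    (((hg.size_left.add (hg.size_right.add hg.length_bdd)).add (PolyBdd.const _ 4)).comap
      fun q : Entry m => q.1).mono fun q => by
        have h1 : (g q.1 q.2).size ≤ (vec (g q.1)).size := Data.size_le_of_mem (by simp)
        have h2 := size_num_natCast_le q.2
        have h3 := Nat.size_le_self q.2
        have h4 := q.2.2
        simp only [Data.size] at h2 ⊢
        omega
  exact ((Comp.refl hsz).fst.pair (Comp.refl hsz).snd.snd).trans hstep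

/-- The entries of a vector are paired with the first entries of a list. -/
theorem Comp.zipList {g h : ∀ i, Fin (m i) → Data} {L : ι → List Data}
    (hg : Comp μ Γ fun i => vec (g i)) (hL : Comp μ Γ fun i => .ofList (L i))
    (hlen : ∀ i, m i ≤ (L i).length) (hh : ∀ i (e : Fin (m i)), (L i)[(e : ℕ)]? = some (h i e)) :
    Comp μ Γ fun i => vec fun e => .pair (g i e) (h i e) := by
  have hm := hg.length_bdd
  have hmem : ∀ i (e : Fin (m i)), h i e ∈ L i := fun i e => List.mem_of_getElem? (hh i e)
  have hhsz : PolyBdd (fun q : Entry m => μ q.1) fun q => (h q.1 q.2).size :=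
    (hL.size_right.comap fun q : Entry m => q.1).mono fun q => Data.size_le_of_mem (hmem _ _)
  have hv : PolyBdd μ fun i => (vec fun e => .pair (g i e) (h i e)).size :=
    size_vec_bdd hm (((hg.size_entry.add hhsz).add (PolyBdd.const _ 1)).mono fun q => by
      simp only [Data.size]; omega)
  let P : ∀ i, List Data := fun i => List.ofFn fun e => .pair (g i e) (h i e)
  have hsz : PolyBdd (fun q : Entry m => μ q.1) fun q =>
      (Data.pair (Γ q.1) (.pair (g q.1 q.2) (.pair (.ofList ((L q.1).drop q.2))
        (.ofList ((P q.1).take q.2).reverse)))).size :=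
    (((hg.size_left.add (hg.size_right.add (hL.size_right.add hv))).add (PolyBdd.const _ 9)).comap
      fun q : Entry m => q.1).mono fun q => by
        have h1 : (g q.1 q.2).size ≤ (vec (g q.1)).size := Data.size_le_of_mem (by simp)
        have h5 := Data.size_ofList_sublist (List.drop_sublist q.2 (L q.1))
        have h6 := Data.size_ofList_sublist (List.take_sublist q.2 (P q.1))
        simp only [Data.size, vec, Data.size_ofList_reverse, P] at h1 h5 h6 ⊢
        omega
  have hC := Comp.refl hsz
  have hdrop : Comp _ _ fun q : Entry m =>
      .pair (h q.1 q.2) (.ofList ((L q.1).drop (q.2 + 1))) :=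
    hC.snd.snd.fst.congr fun q => by
      have h1 : (q.2 : ℕ) < (L q.1).length := q.2.2.trans_le (hlen q.1)
      rw [List.drop_eq_getElem_cons h1, Data.ofList]
      have := hh q.1 q.2
      rw [List.getElem?_eq_getElem h1, Option.some_inj] at this
      rw [this]
  have hfold := Comp.foldVec (acc := fun i j => .pair (.ofList ((L i).drop j))
    (.ofList ((P i).take j).reverse)) hg
    ((hL.pair (Comp.const hg.size_left (.num 0))).congr fun i => by simp [Data.ofList]) (by
      refine hdrop.snd.pair (((hC.snd.fst.pair hdrop.fst).pair hC.snd.snd.snd).congr fun q => ?_)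
      have h1 : (q.2 : ℕ) < (P q.1).length := by simp [P]
      rw [List.take_succ_eq_append_getElem h1, List.reverse_append]
      simp [Data.ofList, P])
  refine hfold.snd.reverse.congr fun i => ?_
  simp only [List.reverse_reverse]
  rw [List.take_of_length_le (by simp [P])]
  rfl

theorem Comp.zip {g h : ∀ i, Fin (m i) → Data}
    (hg : Comp μ Γ fun i => vec (g i)) (hh : Comp μ Γ fun i => vec (h i)) :
    Comp μ Γ fun i => vec fun e => .pair (g i e) (h i e) :=
  hg.zipList hh (by simp) (by simp)

/-- A vector with an additional last entry. -/
theorem Comp.snoc {g : ∀ i, Fin (m i) → Data} (hg : Comp μ Γ fun i => vec (g i))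
    (hx : Comp μ Γ x) :
    Comp μ Γ fun i => vec (Fin.lastCases (motive := fun _ => Data) (x i) (g i)) := by
  refine (Comp.reverse (L := fun i => x i :: (List.ofFn (g i)).reverse)
    (hx.pair hg.reverse)).congr fun i => ?_
  rw [vec, List.ofFn_succ']
  simp

theorem Comp.sum {a : ∀ i, Fin (m i) → ℚ} (ha : Comp μ Γ fun i => vec fun e => .num (a i e)) :
    Comp μ Γ fun i => .num (∑ e, a i e) := by
  have hm := ha.length_bdd
  let s : ι → ℕ → ℚ := fun i j => ∑ e : Fin (m i) with e.val < j, a i e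
  have hs : PolyBdd (fun q : Entry m => μ q.1) fun q => (Data.num (s q.1 q.2)).size :=
    ((((hm.add ha.size_right).add ((PolyBdd.const _ 2).mul (ha.size_right.mul hm))).add
      (PolyBdd.const _ 3)).comap fun q : Entry m => q.1).mono fun q => by
        have hc : #{e : Fin (m q.1) | e.val < q.2} ≤ m q.1 := by
          simpa using Finset.card_le_univ ({e : Fin (m q.1) | e.val < q.2} : Finset _)
        have h1 := size_sum_le {e : Fin (m q.1) | e.val < q.2} (a q.1)
          (vec fun e => .num (a q.1 e)).size fun e _ =>
            (Data.size_le_of_mem (by simp) : (Data.num (a q.1 e)).size ≤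
            (vec fun e => .num (a q.1 e)).size)
        have h2 := Nat.mul_le_mul_left (vec fun e => .num (a q.1 e)).size hc
        simp only [s]
        omega
  have hsz : PolyBdd (fun q : Entry m => μ q.1) fun q =>
      (Data.pair (Γ q.1) (.pair (.num (a q.1 q.2)) (.num (s q.1 q.2)))).size :=
    (((ha.size_left.comap fun q : Entry m => q.1).add (ha.size_entry.add hs)).add
      (PolyBdd.const _ 2)).mono fun q => by simp only [Data.size]; omega
  have hC := Comp.refl hsz
  refine (Comp.foldVec (acc := fun i j => .num (s i j)) ha
    ((Comp.const ha.size_left (.num 0)).congr fun i => by simp [s])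
    ((hC.snd.fst.add hC.snd.snd).congr fun q => ?_)).congr fun i => ?_
  · have h : Finset.univ.filter (fun e : Fin (m q.1) => e.val < q.2 + 1)
        = insert q.2 (Finset.univ.filter fun e : Fin (m q.1) => e.val < q.2) := by
      ext e
      simp only [Finset.mem_filter, Finset.mem_univ, true_and, Finset.mem_insert, Fin.ext_iff]
      omega
    simp only [s, h]
    rw [Finset.sum_insert (by simp)]
  · simp [s]

/-- The sum over the indices that satisfy a decidable condition. -/
theorem Comp.sumFilter {g : ∀ i, Fin (m i) → Data} {c : ∀ i, Fin (m i) → Prop}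
    [∀ i, DecidablePred (c i)] {a : ∀ i, Fin (m i) → ℚ} (hg : Comp μ Γ fun i => vec (g i))
    (hc : Comp (fun q : Entry m => μ q.1) (fun q => .pair (Γ q.1) (g q.1 q.2))
      fun q => bit (c q.1 q.2))
    (ha : Comp (fun q : Entry m => μ q.1) (fun q => .pair (Γ q.1) (g q.1 q.2))
      fun q => .num (a q.1 q.2)) :
    Comp μ Γ fun i => .num (∑ e with c i e, a i e) := by
  refine (Comp.sum (a := fun i e => if c i e then a i e else 0) (hg.map
    ((hc.ite' ha (Comp.const hc.size_left (.num 0))).congr fun q => ?_))).congr fun i => ?_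
  · split_ifs <;> rfl
  · rw [Finset.sum_filter]

end Vectors


/-! ### Rational networks and the clearing oracle -/

section Rational

variable {n m : ℕ} {S : PaymentScheme}

/-- A vector of rational payments, viewed over the reals. -/
def realPayments {m : ℕ} (p : Fin m → ℚ) : Fin m → ℝ := fun e => (p e : ℝ)

/-- The assets of the bank `u` under rational payments. -/
def Network.wealth (F : Network ℚ n m) (p : Fin m → ℚ) (u : Fin n) : ℚ :=
  F.external u + F.inflow p u

theorem Network.toReal_inflow (F : Network ℚ n m) (p : Fin m → ℚ) (u : Fin n) :
    F.toReal.inflow (realPayments p) u = ((F.inflow p u : ℚ) : ℝ) := by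
  rw [Network.inflow, Network.inflow, Rat.cast_sum]
  rfl

theorem Network.toReal_assets (F : Network ℚ n m) (p : Fin m → ℚ) (u : Fin n) :
    F.toReal.assets (realPayments p) u = ((F.wealth p u : ℚ) : ℝ) := by
  rw [Network.assets_eq, F.toReal_inflow, Network.wealth]
  simp [Network.toReal]

theorem Network.toReal_transfer (F : Network ℚ n m) (v : Fin n) (b : ℚ) (p : Fin m → ℚ) :
    F.toReal.transfer v (b : ℝ) (realPayments p) = ((F.transfer v b p : ℚ) : ℝ) := by
  rw [Network.transfer, F.toReal_inflow, Network.transfer]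
  simp [Network.toReal]

theorem Network.toReal_fixed (F : Network ℚ n m) (X : Finset (Fin n)) (lev : Fin n → ℚ) :
    (F.fixed X lev).toReal = F.toReal.fixed X fun u => (lev u : ℝ) := by
  simp only [Network.toReal, Network.fixed, Network.mk.injEq, true_and, and_true]
  refine ⟨rfl, ?_⟩
  funext u
  induction u using Fin.lastCases with
  | last => simp
  | cast u => simp only [Fin.lastCases_castSucc]; split_ifs <;> rfl

theorem Network.toReal_doubled (F : Network ℚ n m) (E : Finset (Fin m)) (a : Fin n → ℚ) :
    (F.doubled E a).toReal = F.toReal.doubled E fun u => (a u : ℝ) := by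
  simp only [Network.toReal, Network.doubled, Network.mk.injEq, true_and, and_true]
  funext u
  induction u using Fin.lastCases with
  | last => simp
  | cast u => induction u using Fin.addCases <;> simp [-Fin.natAdd_eq_addNat, -Fin.castSucc_natAdd]

theorem Network.doubled_external_forall {F : Network ℚ n m} {E : Finset (Fin m)} {a : Fin n → ℚ}
    {P : ℚ → Prop} (h0 : P 0) (h : ∀ u, P (a u)) (u : Fin (n + n + 1)) :
    P ((F.doubled E a).external u) := by
  induction u using Fin.lastCases with
  | last => simpa [Network.doubled]
  | cast u =>
    simp only [Network.doubled, Fin.lastCases_castSucc]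
    induction u using Fin.addCases with
    | left u => rw [Fin.addCases_left]; exact h u
    | right u => rw [Fin.addCases_right]; exact h u

theorem Network.doubled_rule_forall {F : Network ℚ n m} {E : Finset (Fin m)} {a : Fin n → ℚ}
    {P : Data → Prop} (h0 : P (.num 0)) (h : ∀ u, P (F.rule u)) (u : Fin (n + n + 1)) :
    P ((F.doubled E a).rule u) := by
  induction u using Fin.lastCases with
  | last => simpa [Network.doubled]
  | cast u =>
    simp only [Network.doubled, Fin.lastCases_castSucc]
    induction u using Fin.addCases with
    | left u => rw [Fin.addCases_left]; exact h u
    | right u => rw [Fin.addCases_right]; exact h u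

theorem Network.doubled_liability_forall {F : Network ℚ n m} {E : Finset (Fin m)} {a : Fin n → ℚ}
    {P : ℕ → Prop} (h : ∀ e, P (F.liability e)) (e : Fin (m + m)) :
    P ((F.doubled E a).liability e) := by
  simp only [Network.doubled]
  induction e using Fin.addCases with
  | left e => rw [Fin.addCases_left]; exact h e
  | right e => rw [Fin.addCases_right]; exact h e

theorem toReal_residual (F : Network ℚ n m) (E : Finset (Fin m)) (p : Fin m → ℚ) :
    F.toReal.residual E (F.toReal.assets (realPayments p)) (realPayments p)
      = fun u => ((F.residual E (F.wealth p) p u : ℚ) : ℝ) := by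
  funext u
  rw [Network.residual, Network.residual, F.toReal_assets]
  rw [Rat.cast_sub, Rat.cast_sum]
  rfl

theorem toReal_partnerLevel (v : Fin n) (b c : ℚ) :
    (fun u => ((partnerLevel v b c u : ℚ) : ℝ)) = partnerLevel v (b : ℝ) (c : ℝ) := by
  funext u
  unfold partnerLevel
  split_ifs <;> rfl

end Rational

section Oracle

variable {S : PaymentScheme}

/-- A valid network with rational external assets. -/
structure ValidNetwork (S : PaymentScheme) : Type where
  n : ℕ
  m : ℕ
  net : Network ℚ n m
  valid : net.toReal.Valid S

theorem encode_eq {n m : ℕ} (F : Network ℚ n m) :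
    F.encode = .pair (vec fun u => .pair (.num (F.external u)) (F.rule u))
      (vec fun e => .pair (.num ((F.debtor e : ℕ) : ℚ))
        (.pair (.num ((F.creditor e : ℕ) : ℚ)) (.num (F.liability e : ℚ)))) := rfl

/-- The clearing states of all valid networks are rational, and computed in polynomial time. -/
structure Oracle (S : PaymentScheme) : Type where
  clr : ∀ {n m : ℕ}, Network ℚ n m → Fin m → ℚ
  isClearingState : ∀ {n m : ℕ} (F : Network ℚ n m), F.toReal.Valid S →
    F.toReal.IsClearingState S (realPayments (clr F))
  comp : Comp (fun G : ValidNetwork S => G.net.encode.size) (fun G => G.net.encode)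
    fun G => vec fun e => .num (clr G.net e)

theorem HasClearingOracle.exists_oracle (hS : HasClearingOracle S) : Nonempty (Oracle S) := by
  classical
  obtain ⟨Q, c, k, h⟩ := hS
  have h' : ∀ (n m : ℕ) (F : Network ℚ n m), ∃ p : Fin m → ℚ, F.toReal.Valid S →
      F.toReal.IsClearingState S (realPayments p) ∧
      ∃ t, Run Q F.encode (encodePayments p) t ∧ t ≤ c * F.encode.size ^ k := fun n m F => by
    by_cases hF : F.toReal.Valid S
    · obtain ⟨p, t, h1, h2, h3⟩ := h n m F hF
      exact ⟨p, fun _ => ⟨h1, t, h2, h3⟩⟩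
    · exact ⟨0, fun h => absurd h hF⟩
  choose clr hclr using h'
  refine ⟨⟨fun {n m} F => clr n m F, fun {n m} F hF => (hclr n m F hF).1, ?_⟩⟩
  refine Comp.of_bound Q ((PolyBdd.const _ c).mul ((PolyBdd.refl _).pow k)) fun G => ?_
  obtain ⟨-, t, h1, h2⟩ := hclr _ _ G.net G.valid
  exact ⟨t, h2, h1⟩

end Oracle

section NetworkSize

variable {ι : Type} {μ : ι → ℕ} {n m : ι → ℕ}

theorem PolyBdd.encode {G : ∀ i, Network ℚ (n i) (m i)} (hn : PolyBdd μ n) (hm : PolyBdd μ m)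
    (hext : PolyBdd (fun q : Entry n => μ q.1) fun q => (Data.num ((G q.1).external q.2)).size)
    (hrule : PolyBdd (fun q : Entry n => μ q.1) fun q => ((G q.1).rule q.2).size)
    (hl : PolyBdd (fun q : Entry m => μ q.1)
      fun q => (Data.num ((G q.1).liability q.2 : ℚ)).size) :
    PolyBdd μ fun i => (G i).encode.size := by
  have hbank : PolyBdd (fun q : Entry n => μ q.1) fun q =>
      (Data.pair (.num ((G q.1).external q.2)) ((G q.1).rule q.2)).size :=
    ((hext.add hrule).add (PolyBdd.const _ 1)).mono fun q => by simp only [Data.size]; omega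
  have hnE : PolyBdd (fun q : Entry m => μ q.1) fun q => n q.1 := hn.comap fun q : Entry m => q.1
  have hclaim : PolyBdd (fun q : Entry m => μ q.1) fun q =>
      (Data.pair (.num (((G q.1).debtor q.2 : ℕ) : ℚ)) (.pair
        (.num (((G q.1).creditor q.2 : ℕ) : ℚ)) (.num ((G q.1).liability q.2 : ℚ)))).size :=
    (((hnE.add hnE).add hl).add (PolyBdd.const _ 6)).mono fun q => by
      have h1 := size_num_natCast_le ((G q.1).debtor q.2)
      have h2 := size_num_natCast_le ((G q.1).creditor q.2)
      have h3 := Nat.size_le_self ((G q.1).debtor q.2)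
      have h4 := Nat.size_le_self ((G q.1).creditor q.2)
      have h5 := ((G q.1).debtor q.2).2
      have h6 := ((G q.1).creditor q.2).2
      simp only [Data.size] at h1 h2 ⊢
      omega
  exact (((size_vec_bdd hn hbank).add (size_vec_bdd hm hclaim)).add (PolyBdd.const _ 1)).mono
    fun i => by rw [encode_eq]; simp only [Data.size]; exact le_rfl

theorem size_bank_le {n m : ℕ} (F : Network ℚ n m) (u : Fin n) :
    (Data.num (F.external u)).size ≤ F.encode.size ∧ (F.rule u).size ≤ F.encode.size := by
  have h : (Data.pair (.num (F.external u)) (F.rule u)).size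
      ≤ (vec fun u => .pair (.num (F.external u)) (F.rule u)).size :=
    Data.size_le_of_mem ((List.mem_ofFn' _ _).2 ⟨u, rfl⟩)
  rw [encode_eq]
  simp only [Data.size] at h ⊢
  omega

theorem size_liability_le {n m : ℕ} (F : Network ℚ n m) (e : Fin m) :
    (Data.num (F.liability e : ℚ)).size ≤ F.encode.size := by
  have h : (Data.pair (.num ((F.debtor e : ℕ) : ℚ))
        (.pair (.num ((F.creditor e : ℕ) : ℚ)) (.num (F.liability e : ℚ)))).size
      ≤ (vec fun e => .pair (.num ((F.debtor e : ℕ) : ℚ))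
        (.pair (.num ((F.creditor e : ℕ) : ℚ)) (.num (F.liability e : ℚ)))).size :=
    Data.size_le_of_mem ((List.mem_ofFn' _ _).2 ⟨e, rfl⟩)
  rw [encode_eq]
  simp only [Data.size] at h ⊢
  omega

theorem card_le_size {n m : ℕ} (F : Network ℚ n m) :
    n ≤ F.encode.size ∧ m ≤ F.encode.size := by
  have h1 : n ≤ (vec fun u => .pair (.num (F.external u)) (F.rule u)).size := by
    simpa [vec] using Data.length_le_size
      (List.ofFn fun u => .pair (.num (F.external u)) (F.rule u))
  have h2 : m ≤ (vec fun e => .pair (.num ((F.debtor e : ℕ) : ℚ))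
        (.pair (.num ((F.creditor e : ℕ) : ℚ)) (.num (F.liability e : ℚ)))).size := by
    simpa [vec] using Data.length_le_size
      (List.ofFn fun e => .pair (.num ((F.debtor e : ℕ) : ℚ))
        (.pair (.num ((F.creditor e : ℕ) : ℚ)) (.num (F.liability e : ℚ))))
  rw [encode_eq]
  simp only [Data.size]
  omega

theorem PolyBdd.sum {κ : Type} {ν : κ → ℕ} {m : κ → ℕ} {a : ∀ j, Fin (m j) → ℚ}
    (s : ∀ j, Finset (Fin (m j)))
    (hm : PolyBdd ν m) (ha : PolyBdd (fun q : Entry m => ν q.1) fun q =>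
      (Data.num (a q.1 q.2)).size) :
    PolyBdd ν fun j => (Data.num (∑ e ∈ s j, a j e)).size := by
  obtain ⟨k, hk⟩ := ha
  have hB : PolyBdd ν fun j => (ν j + 2) ^ k := ⟨k, fun _ => le_rfl⟩
  refine (((hm.add hB).add ((PolyBdd.const _ 2).mul (hB.mul hm))).add (PolyBdd.const _ 3)).mono
    fun j => ?_
  have h1 := size_sum_le (s j) (a j) ((ν j + 2) ^ k) fun e _ => hk ⟨j, e⟩
  have hc : #(s j) ≤ m j := by simpa using Finset.card_le_univ (s j)
  have h2 := Nat.mul_le_mul_left ((ν j + 2) ^ k) hc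
  omega

theorem PolyBdd.num_add {a b : ι → ℚ} (ha : PolyBdd μ fun i => (Data.num (a i)).size)
    (hb : PolyBdd μ fun i => (Data.num (b i)).size) :
    PolyBdd μ fun i => (Data.num (a i + b i)).size :=
  (((PolyBdd.const μ 3).mul (ha.add hb)).add (PolyBdd.const μ 4)).mono fun _ => size_add_le _ _

theorem PolyBdd.num_sub {a b : ι → ℚ} (ha : PolyBdd μ fun i => (Data.num (a i)).size)
    (hb : PolyBdd μ fun i => (Data.num (b i)).size) :
    PolyBdd μ fun i => (Data.num (a i - b i)).size :=
  (((PolyBdd.const μ 3).mul (ha.add hb)).add (PolyBdd.const μ 4)).mono fun _ => size_sub_le _ _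

end NetworkSize

/-! ### A lower bound for the gain of some trade -/

section Gain

variable {S : PaymentScheme}

/-- A valid network with two trading partners for which some exact trade is creditor-positive. -/
structure TradeSetting (S : PaymentScheme) : Type extends ValidNetwork S where
  v : Fin n
  w : Fin n
  ne : v ≠ w
  trade : ∃ T : MultiTrade ℝ m, net.toReal.IsExactPositive S v w T

/-- Whenever some exact trade is creditor-positive, then some exact trade increases the assets of
`v` by an amount with polynomially many bits. All the quantities that limit the increase are
differences of rational numbers that the oracle outputs on networks of polynomial size. -/
theorem Oracle.exists_gain (O : Oracle S) :
    ∃ K : TradeSetting S → ℕ, PolyBdd (fun I => I.net.encode.size) K ∧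
      ∀ I : TradeSetting S, ∃ T, I.net.toReal.IsExactPositive S I.v I.w T ∧
        I.net.toReal.totalAssets S I.v + ((2 : ℝ) ^ K I)⁻¹
          ≤ (I.net.toReal.afterTrade I.v I.w T).totalAssets S I.v := by
  classical
  let ι := TradeSetting S
  let μ : ι → ℕ := fun I => I.net.encode.size
  let n : ι → ℕ := fun I => I.n
  let m : ι → ℕ := fun I => I.m
  have hn : PolyBdd μ n := (PolyBdd.refl μ).mono fun I => (card_le_size I.net).1
  have hm : PolyBdd μ m := (PolyBdd.refl μ).mono fun I => (card_le_size I.net).2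
  have hn2 : PolyBdd (fun q : Entry n => μ q.1) fun q => n q.1 := hn.comap fun q : Entry n => q.1
  have hm2 : PolyBdd (fun q : Entry n => μ q.1) fun q => m q.1 := hm.comap fun q : Entry n => q.1
  have hext : PolyBdd (fun q : Entry n => μ q.1) fun q =>
      (Data.num (q.1.net.external q.2)).size :=
    ((PolyBdd.refl μ).comap fun q : Entry n => q.1).mono fun q => (size_bank_le q.1.net q.2).1
  have hrule : PolyBdd (fun q : Entry n => μ q.1) fun q => (q.1.net.rule q.2).size :=
    ((PolyBdd.refl μ).comap fun q : Entry n => q.1).mono fun q => (size_bank_le q.1.net q.2).2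
  have hliab : PolyBdd (fun q : Entry m => μ q.1) fun q =>
      (Data.num (q.1.net.liability q.2 : ℚ)).size :=
    ((PolyBdd.refl μ).comap fun q : Entry m => q.1).mono fun q => size_liability_le q.1.net q.2
  -- the clearing state
  let p : ∀ I : ι, Fin (m I) → ℚ := fun I => O.clr I.net
  have hp : ∀ I : ι, I.net.toReal.IsClearingState S (realPayments (p I)) := fun I =>
    O.isClearingState I.net I.valid
  have hpsz : PolyBdd (fun q : Entry m => μ q.1) fun q => (Data.num (p q.1 q.2)).size :=
    ((O.comp.comap fun I : ι => I.toValidNetwork).size_right.comap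
      fun q : Entry m => q.1).mono fun q => Data.size_le_of_mem (by simp [p])
  have hpsz2 : PolyBdd (fun q : Entry (fun q : Entry n => m q.1) => μ q.1.1) fun q =>
      (Data.num (p q.1.1 q.2)).size :=
    hpsz.comap fun q : Entry (fun q : Entry n => m q.1) => (⟨q.1.1, q.2⟩ : Entry m)
  have hAsz : PolyBdd (fun q : Entry n => μ q.1) fun q =>
      (Data.num (q.1.net.wealth (p q.1) q.2)).size :=
    hext.num_add (PolyBdd.sum (fun q : Entry n => {e | q.1.net.creditor e = q.2}) hm2 hpsz2)
  -- the thresholds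
  let E : ∀ I : ι, Finset (Fin (m I)) := fun I =>
    I.net.toReal.active S (I.net.toReal.assets (realPayments (p I)))
  let R : ∀ I : ι, Fin (n I) → ℚ := fun I => I.net.residual (E I) (I.net.wealth (p I)) (p I)
  have hRsz : PolyBdd (fun q : Entry n => μ q.1) fun q => (Data.num (R q.1 q.2)).size :=
    hAsz.num_sub (PolyBdd.sum (fun q : Entry n => {e ∈ E q.1 | q.1.net.debtor e = q.2}) hm2 hpsz2)
  have hR : ∀ I : ι, (fun u => ((R I u : ℚ) : ℝ)) = I.net.toReal.residual (E I)
      (I.net.toReal.assets (realPayments (p I))) (realPayments (p I)) := fun I =>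
    (toReal_residual I.net (E I) (p I)).symm
  have hR0 : ∀ (I : ι) u, 0 ≤ ((R I u : ℚ) : ℝ) := fun I u => by
    rw [congrFun (hR I) u]; exact residual_nonneg I.valid (hp I) _ u
  let D : ι → ValidNetwork S := fun I => ⟨_, _, I.net.doubled (E I) (R I), by
    rw [Network.toReal_doubled]; exact I.valid.doubled _ (hR0 I)⟩
  have hDsz : PolyBdd μ fun I => (D I).net.encode.size := by
    obtain ⟨a, ha⟩ := hRsz
    obtain ⟨b, hb⟩ := hrule
    obtain ⟨c, hc⟩ := hliab
    have hpow : ∀ (N : ι → ℕ) k, PolyBdd (fun q : Entry N => μ q.1) fun q => (μ q.1 + 2) ^ k + 2 :=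
      fun N k => PolyBdd.add ⟨k, fun _ => le_rfl⟩ (PolyBdd.const _ 2)
    refine PolyBdd.encode (n := fun I => (D I).n) (m := fun I => (D I).m)
      (G := fun I => (D I).net) ((hn.add hn).add (PolyBdd.const _ 1)) (hm.add hm)
      ((hpow _ a).mono fun q => ?_) ((hpow _ b).mono fun q => ?_) ((hpow _ c).mono fun q => ?_)
    · exact Network.doubled_external_forall (P := fun x => (Data.num x).size ≤ (μ q.1 + 2) ^ a + 2)
        (by simp [Data.size]) (fun u => (ha ⟨q.1, u⟩).trans (Nat.le_add_right _ _)) q.2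
    · exact Network.doubled_rule_forall (P := fun x => x.size ≤ (μ q.1 + 2) ^ b + 2)
        (by simp [Data.size]) (fun u => (hb ⟨q.1, u⟩).trans (Nat.le_add_right _ _)) q.2
    · exact Network.doubled_liability_forall
        (P := fun x => (Data.num (x : ℚ)).size ≤ (μ q.1 + 2) ^ c + 2)
        (fun u => (hc ⟨q.1, u⟩).trans (Nat.le_add_right _ _)) q.2
  let Q : ∀ I : ι, Fin (m I + m I) → ℚ := fun I => O.clr (D I).net
  have hQ : ∀ I : ι, (I.net.toReal.doubled (E I) fun u => ((R I u : ℚ) : ℝ)).IsClearingState S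
      (realPayments (Q I)) := fun I => by
    rw [← Network.toReal_doubled]
    exact O.isClearingState (D I).net (D I).valid
  have hQsz : PolyBdd (fun q : Entry (fun q : Entry n => m q.1) => μ q.1.1) fun q =>
      (Data.num (Q q.1.1 (Fin.natAdd _ q.2))).size :=
    (((O.comp.comap D).mono hDsz).size_right.comap
      fun q : Entry (fun q : Entry n => m q.1) => q.1.1).mono fun q =>
        Data.size_le_of_mem (by simp [Q])
  let h : ∀ I : ι, Fin (n I) → ℚ := fun I u =>
    R I u + ∑ e ∈ E I with I.net.debtor e = u, Q I (Fin.natAdd _ e)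
  have hhsz : PolyBdd (fun q : Entry n => μ q.1) fun q => (Data.num (h q.1 q.2)).size :=
    hRsz.num_add (PolyBdd.sum (a := fun (q : Entry n) e => Q q.1 (Fin.natAdd _ e))
      (fun q : Entry n => {e ∈ E q.1 | q.1.net.debtor e = q.2}) hm2 hQsz)
  have hh0 : ∀ (I : ι) u, 0 ≤ ((h I u : ℚ) : ℝ) := fun I u => by
    have hQ0 := (hQ I).nonneg (I.valid.doubled _ (hR0 I))
    simp only [h, Rat.cast_add, Rat.cast_sum]
    exact add_nonneg (hR0 I u) (Finset.sum_nonneg fun e _ => hQ0 _)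
  have hU : ∀ I : ι, I.net.toReal.Threshold S (realPayments (p I))
      (I.net.toReal.Reach S (I.net.toReal.assets (realPayments (p I))) I.v I.w I.v)
      fun u => ((h I u : ℚ) : ℝ) := fun I => by
    obtain ⟨T, hT⟩ := I.trade
    obtain ⟨h', hh'⟩ := hT.exists_threshold I.valid (hp I)
    have hQ' := hQ I
    rw [hR I] at hQ'
    have := hh'.doubled I.valid (hp I) hQ'
    rw [← hR I] at this
    convert this using 2 with u
    simp only [h, Rat.cast_add, Rat.cast_sum]
    rfl
  -- the probes
  let lev : ∀ q : Entry n, Fin (n q.1) → ℚ := fun q =>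
    probeLevel (q.1.net.wealth (p q.1)) (h q.1) q.2
  have hlev : ∀ q : Entry n, (fun u => ((lev q u : ℚ) : ℝ)) = probeLevel
      (q.1.net.toReal.assets (realPayments (p q.1))) (fun u => ((h q.1 u : ℚ) : ℝ)) q.2 := fun q =>
        by
    funext u
    simp only [lev, probeLevel, Network.toReal_assets]
    split_ifs <;> rfl
  have hlev0 : ∀ (q : Entry n) u, 0 ≤ ((lev q u : ℚ) : ℝ) := fun q u => by
    rw [congrFun (hlev q) u, probeLevel]
    split_ifs
    · exact hh0 _ _
    · exact q.1.valid.assets_nonneg ((hp q.1).nonneg q.1.valid) u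
  let B : Entry n → ValidNetwork S := fun q => ⟨_, _, q.1.net.fixed {q.1.v, q.1.w, q.2} (lev q), by
    rw [Network.toReal_fixed]; exact q.1.valid.fixed _ _ fun u _ => hlev0 q u⟩
  have hBsz : PolyBdd (fun q : Entry n => μ q.1) fun q => (B q).net.encode.size := by
    obtain ⟨a, ha⟩ := hAsz
    obtain ⟨a', ha'⟩ := hhsz
    obtain ⟨a'', ha''⟩ := hext
    obtain ⟨b, hb⟩ := hrule
    obtain ⟨c, hc⟩ := hliab
    have hpow : ∀ (N : Entry n → ℕ) k, PolyBdd (fun q : Entry N => μ q.1.1)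
        fun q => (μ q.1.1 + 2) ^ k := fun N k => ⟨k, fun _ => le_rfl⟩
    refine PolyBdd.encode (n := fun q => (B q).n) (m := fun q => (B q).m)
      (G := fun q => (B q).net) (hn2.add (PolyBdd.const _ 1)) hm2
      (((((hpow _ a).add (hpow _ a')).add (hpow _ a'')).add (PolyBdd.const _ 2)).mono fun q => ?_)
      (((hpow _ b).add (PolyBdd.const _ 2)).mono fun q => ?_) ((hpow _ c).mono fun q => ?_)
    · obtain ⟨⟨I, y⟩, u⟩ := q
      change (Data.num ((I.net.fixed {I.v, I.w, y} (lev ⟨I, y⟩)).external u)).size ≤ _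
      refine Fin.lastCases ?_ (fun u => ?_) u
      · simp [Network.fixed, Data.size]
      · have h1 := ha ⟨I, u⟩
        have h2 := ha' ⟨I, y⟩
        have h3 := ha'' ⟨I, u⟩
        simp only [Network.fixed, Fin.lastCases_castSucc, lev, probeLevel]
        split_ifs with h4 h5
        · simp only at h2; omega
        · simp only at h1; omega
        · simp only at h3; omega
    · obtain ⟨⟨I, y⟩, u⟩ := q
      change ((I.net.fixed {I.v, I.w, y} (lev ⟨I, y⟩)).rule u).size ≤ _
      refine Fin.lastCases ?_ (fun u => ?_) u
      · simp [Network.fixed, Data.size]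
      · have h1 := hb ⟨I, u⟩
        simp only [Network.fixed, Fin.lastCases_castSucc] at h1 ⊢
        exact h1.trans (Nat.le_add_right _ _)
    · exact hc ⟨q.1.1, q.2⟩
  let M : ∀ q : Entry n, Fin (m q.1) → ℚ := fun q => O.clr (B q).net
  have hM : ∀ q : Entry n, q.1.net.toReal.FixedClearing S {q.1.v, q.1.w, q.2}
      (probeLevel (q.1.net.toReal.assets (realPayments (p q.1)))
        (fun u => ((h q.1 u : ℚ) : ℝ)) q.2) (realPayments (M q)) := fun q => by
    rw [← hlev q]
    refine Network.IsClearingState.fixedClearing q.1.valid (fun u _ => hlev0 q u) ?_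
    rw [← Network.toReal_fixed]
    exact O.isClearingState (B q).net (B q).valid
  have hMsz : PolyBdd (fun q : Entry (fun q : Entry n => m q.1) => μ q.1.1) fun q =>
      (Data.num (M q.1 q.2)).size :=
    (((O.comp.comap B).mono hBsz).size_right.comap
      fun q : Entry (fun q : Entry n => m q.1) => q.1).mono fun q =>
        Data.size_le_of_mem (by simp [M])
  let G : Entry n → ℚ := fun q => q.1.net.inflow (M q) q.1.v - q.1.net.inflow (p q.1) q.1.v
    + (q.1.net.inflow (M q) q.1.w - q.1.net.inflow (p q.1) q.1.w)
  have hGsz : PolyBdd (fun q : Entry n => μ q.1) fun q => (Data.num (G q)).size :=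
    ((PolyBdd.sum (fun q : Entry n => {e | q.1.net.creditor e = q.1.v}) hm2 hMsz).num_sub
      (PolyBdd.sum (fun q : Entry n => {e | q.1.net.creditor e = q.1.v}) hm2 hpsz2)).num_add
    ((PolyBdd.sum (fun q : Entry n => {e | q.1.net.creditor e = q.1.w}) hm2 hMsz).num_sub
      (PolyBdd.sum (fun q : Entry n => {e | q.1.net.creditor e = q.1.w}) hm2 hpsz2))
  -- the claims of some trade
  let T : ∀ I : ι, MultiTrade ℝ (m I) := fun I => I.trade.choose
  have hT : ∀ I : ι, I.net.toReal.IsExactPositive S I.v I.w (T I) := fun I => I.trade.choose_spec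
  let s1 : ι → ℚ := fun I => I.net.external I.w - ∑ e ∈ (T I).claims, p I e
  let s2 : ι → ℚ := fun I => (∑ e ∈ (T I).claims, (I.net.liability e : ℚ)) - ∑ e ∈ (T I).claims,
      p I e
  have hs1 : PolyBdd μ fun I => (Data.num (s1 I)).size :=
    (hext.comap fun I : ι => (⟨I, I.w⟩ : Entry n)).num_sub (PolyBdd.sum _ hm hpsz)
  have hs2 : PolyBdd μ fun I => (Data.num (s2 I)).size :=
    (PolyBdd.sum (fun I => (T I).claims) hm hliab).num_sub
      (PolyBdd.sum (fun I => (T I).claims) hm hpsz)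
  have hs3 : PolyBdd μ fun I => (Data.num (h I I.v - I.net.wealth (p I) I.v)).size :=
    (hhsz.num_sub hAsz).comap fun I : ι => (⟨I, I.v⟩ : Entry n)
  obtain ⟨a1, h1⟩ := hs1
  obtain ⟨a2, h2⟩ := hs2
  obtain ⟨a3, h3⟩ := hs3
  obtain ⟨a4, h4⟩ := hGsz
  have hpow : ∀ k, PolyBdd μ fun I => (μ I + 2) ^ k := fun k => ⟨k, fun _ => le_rfl⟩
  refine ⟨fun I => (μ I + 2) ^ a1 + (μ I + 2) ^ a2 + (μ I + 2) ^ a3 + (μ I + 2) ^ a4 + 1,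
    ((((hpow a1).add (hpow a2)).add (hpow a3)).add (hpow a4)).add (PolyBdd.const _ 1), fun I => ?_⟩
  obtain ⟨hslack1, hslack2⟩ := (hT I).claims_slack I.valid (hp I)
  set K := (μ I + 2) ^ a1 + (μ I + 2) ^ a2 + (μ I + 2) ^ a3 + (μ I + 2) ^ a4 + 1 with hK
  have hbound : ∀ q : ℚ, 0 < (q : ℝ) → (Data.num q).size + 1 ≤ K → ((2 : ℝ) ^ K)⁻¹ < (q : ℝ) := by
    intro q hq hsz
    have h1 := inv_two_pow_size_le (q := q) (by exact_mod_cast hq)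
    have h2 : ((2 : ℝ) ^ (Data.num q).size)⁻¹ ≤ (q : ℝ) := by
      have : (((2 ^ (Data.num q).size : ℚ)⁻¹ : ℚ) : ℝ) ≤ (q : ℝ) := by exact_mod_cast h1
      simpa using this
    refine lt_of_lt_of_le ?_ h2
    rw [inv_lt_inv₀ (by positivity) (by positivity)]
    exact pow_lt_pow_right₀ (by norm_num) (by omega)
  have hpos : ∀ k, 0 < (μ I + 2) ^ k := fun k => by positivity
  have hp1 := hpos a1
  have hp2 := hpos a2
  have hp3 := hpos a3
  have hp4 := hpos a4
  refine (hT I).exists_small_gain I.valid (hp I) (hU I) (by positivity) ?_ ?_ ?_ fun u hu huv => ?_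
  · have e : ((h I I.v : ℚ) : ℝ) - I.net.toReal.assets (realPayments (p I)) I.v
        = ((h I I.v - I.net.wealth (p I) I.v : ℚ) : ℝ) := by
      rw [Network.toReal_assets]; push_cast; rfl
    have hlt := (hU I).lt I.v Relation.ReflTransGen.refl
    rw [e]
    refine (hbound _ (by rw [← e]; linarith) ?_).le
    have := h3 I; simp only at this; omega
  · have e : I.net.toReal.external I.w - ∑ e ∈ (T I).claims, realPayments (p I) e
        = ((s1 I : ℚ) : ℝ) := by simp [s1, realPayments, Network.toReal]
    rw [e] at hslack1 ⊢
    refine (hbound _ hslack1 ?_).le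
    have := h1 I; simp only at this; omega
  · have e : (∑ e ∈ (T I).claims, (I.net.toReal.liability e : ℝ))
        - ∑ e ∈ (T I).claims, realPayments (p I) e
        = ((s2 I : ℚ) : ℝ) := by simp [s2, realPayments, Network.toReal]
    rw [e] at hslack2 ⊢
    refine (hbound _ hslack2 ?_).le
    have := h2 I; simp only at this; omega
  · refine ⟨_, hM ⟨I, u⟩, ?_⟩
    have hgt : I.net.toReal.assets (realPayments (p I)) I.v
        < I.net.toReal.assets (realPayments (p I)) I.v + 1 := by linarith
    have hprobe := hu.probe_pos I.valid (hp I) I.ne hgt (hU I) huv (hM ⟨I, u⟩)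
    have e : I.net.toReal.inflow (realPayments (M ⟨I, u⟩)) I.v
        - I.net.toReal.inflow (realPayments (p I)) I.v
        + (I.net.toReal.inflow (realPayments (M ⟨I, u⟩)) I.w
        - I.net.toReal.inflow (realPayments (p I)) I.w) = ((G ⟨I, u⟩ : ℚ) : ℝ) := by
      simp only [Network.toReal_inflow, G]; push_cast; rfl
    rw [e] at hprobe ⊢
    refine hbound _ hprobe ?_
    have := h4 ⟨I, u⟩; simp only at this; omega

end Gain


/-! ### The knapsack problem -/

section Knapsack

variable {m : ℕ}

open Classical in
/-- Dynamic programming for the covering knapsack problem with items `Fin m`, of which those in `E`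
may be chosen: `knapsack E cost κ top s j` is the least cost of a set of items below `s` with total
weight at least `j`, and a set that attains it. The value `top` stands for infinity. -/
noncomputable def knapsack (E : Finset (Fin m)) (cost : Fin m → ℚ) (κ : Fin m → ℕ) (top : ℚ) :
    ℕ → ℕ → ℚ × Finset (Fin m)
  | 0, j => (if j = 0 then 0 else top, ∅)
  | s + 1, j =>
    if h : ∃ h : s < m, (⟨s, h⟩ : Fin m) ∈ E ∧
        (knapsack E cost κ top s (j - κ ⟨s, h⟩)).1 + cost ⟨s,
            h⟩ < (knapsack E cost κ top s j).1 then
      ((knapsack E cost κ top s (j - κ ⟨s, h.1⟩)).1 + cost ⟨s, h.1⟩,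
        insert ⟨s, h.1⟩ (knapsack E cost κ top s (j - κ ⟨s, h.1⟩)).2)
    else knapsack E cost κ top s j

variable {E : Finset (Fin m)} {cost : Fin m → ℚ} {κ : Fin m → ℕ} {top : ℚ}

theorem knapsack_zero (j : ℕ) :
    knapsack E cost κ top 0 j = (if j = 0 then 0 else top, ∅) := by
  rw [knapsack]

theorem knapsack_take (e : Fin m) {j : ℕ} (h : e ∈ E ∧ (knapsack E cost κ top e (j - κ e)).1
    + cost e < (knapsack E cost κ top e j).1) :
    knapsack E cost κ top (e + 1) j = ((knapsack E cost κ top e (j - κ e)).1 + cost e,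
      insert e (knapsack E cost κ top e (j - κ e)).2) := by
  rw [knapsack, dif_pos ⟨e.2, h⟩]

theorem knapsack_skip (e : Fin m) {j : ℕ} (h : ¬(e ∈ E ∧ (knapsack E cost κ top e (j - κ e)).1
    + cost e < (knapsack E cost κ top e j).1)) :
    knapsack E cost κ top (e + 1) j = knapsack E cost κ top e j := by
  rw [knapsack, dif_neg fun h' => h h'.2]

theorem knapsack_mem : ∀ (s : ℕ), s ≤ m → ∀ (j : ℕ) (e : Fin m),
    e ∈ (knapsack E cost κ top s j).2 → e ∈ E ∧ (e : ℕ) < s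
  | 0, _, j, e => by simp [knapsack_zero]
  | s + 1, hs, j, e => by
    intro he
    by_cases h : (⟨s, hs⟩ : Fin m) ∈ E ∧ (knapsack E cost κ top s (j - κ ⟨s, hs⟩)).1
      + cost ⟨s, hs⟩ < (knapsack E cost κ top s j).1
    · rw [knapsack_take ⟨s, hs⟩ h, mem_insert] at he
      rcases he with rfl | he
      · exact ⟨h.1, Nat.lt_succ_self s⟩
      · exact (knapsack_mem s (Nat.le_of_succ_le hs) _ e he).imp_right Nat.lt_succ_of_lt
    · rw [knapsack_skip ⟨s, hs⟩ h] at he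
      exact (knapsack_mem s (Nat.le_of_succ_le hs) _ e he).imp_right Nat.lt_succ_of_lt

/-- The stored value is the cost of the stored set, increased by `top` unless the stored set covers
the target. -/
theorem knapsack_fst : ∀ (s : ℕ), s ≤ m → ∀ j : ℕ, ∃ d : ℚ, (d = top ∨ d = 0 ∧
    j ≤ ∑ e ∈ (knapsack E cost κ top s j).2, κ e) ∧
    (knapsack E cost κ top s j).1 = d + ∑ e ∈ (knapsack E cost κ top s j).2, cost e
  | 0, _, j => by
    rw [knapsack_zero]
    by_cases h : j = 0 <;> simp [h]
  | s + 1, hs, j => by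
    by_cases h : (⟨s, hs⟩ : Fin m) ∈ E ∧ (knapsack E cost κ top s (j - κ ⟨s, hs⟩)).1
      + cost ⟨s, hs⟩ < (knapsack E cost κ top s j).1
    · obtain ⟨d, hd, heq⟩ := knapsack_fst s (Nat.le_of_succ_le hs) (j - κ ⟨s, hs⟩)
      have hnot : (⟨s, hs⟩ : Fin m) ∉ (knapsack E cost κ top s (j - κ ⟨s, hs⟩)).2 := fun h' =>
        lt_irrefl _ (knapsack_mem s (Nat.le_of_succ_le hs) _ _ h').2
      rw [knapsack_take ⟨s, hs⟩ h]
      refine ⟨d, hd.imp_right fun hd => ⟨hd.1, ?_⟩, ?_⟩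
      · rw [sum_insert hnot]
        have := hd.2
        omega
      · rw [sum_insert hnot]
        simp only [heq]
        ring
    · rw [knapsack_skip ⟨s, hs⟩ h]
      exact knapsack_fst s (Nat.le_of_succ_le hs) j

/-- A value below `top` is attained by a set that covers the target. -/
theorem knapsack_sound (hcost : ∀ e, 0 ≤ cost e) {j : ℕ}
    (h : (knapsack E cost κ top m j).1 < top) :
    j ≤ ∑ e ∈ (knapsack E cost κ top m j).2, κ e ∧
    (knapsack E cost κ top m j).1 = ∑ e ∈ (knapsack E cost κ top m j).2, cost e := by
  obtain ⟨d, hd, heq⟩ := knapsack_fst (E := E) (cost := cost) (κ := κ) (top := top) m le_rfl j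
  rcases hd with rfl | ⟨rfl, hd⟩
  · have := sum_nonneg fun e (_ : e ∈ (knapsack E cost κ d m j).2) => hcost e
    linarith
  · exact ⟨hd, by rw [heq, zero_add]⟩

/-- The stored value is at most the cost of any set that covers the target. -/
theorem knapsack_le : ∀ (s : ℕ), s ≤ m → ∀ (j : ℕ) (C : Finset (Fin m)),
    (∀ e ∈ C, e ∈ E ∧ (e : ℕ) < s) → j ≤ ∑ e ∈ C, κ e →
    (knapsack E cost κ top s j).1 ≤ ∑ e ∈ C, cost e
  | 0, _, j, C => by
    intro hC hj
    have : C = ∅ := eq_empty_of_forall_notMem fun e he => absurd (hC e he).2 (Nat.not_lt_zero _)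
    subst this
    rw [knapsack_zero, if_pos (by simpa using hj)]
    simp
  | s + 1, hs, j, C => by
    intro hC hj
    have hs' := Nat.le_of_succ_le hs
    have hlt : ∀ e ∈ C, e ≠ ⟨s, hs⟩ → (e : ℕ) < s := fun e he hne =>
      lt_of_le_of_ne (Nat.lt_succ_iff.1 (hC e he).2) fun h => hne (Fin.ext h)
    have hle : (knapsack E cost κ top (s + 1) j).1 ≤ (knapsack E cost κ top s j).1 := by
      by_cases h : (⟨s, hs⟩ : Fin m) ∈ E ∧ (knapsack E cost κ top s (j - κ ⟨s, hs⟩)).1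
        + cost ⟨s, hs⟩ < (knapsack E cost κ top s j).1
      · rw [knapsack_take ⟨s, hs⟩ h]; exact h.2.le
      · rw [knapsack_skip ⟨s, hs⟩ h]
    by_cases hmem : (⟨s, hs⟩ : Fin m) ∈ C
    · have h1 := knapsack_le s hs' (j - κ ⟨s, hs⟩) (C.erase ⟨s, hs⟩)
        (fun e he => ⟨(hC e (mem_of_mem_erase he)).1,
          hlt e (mem_of_mem_erase he) (ne_of_mem_erase he)⟩)
        (by have := add_sum_erase C κ hmem; omega)
      have h2 := add_sum_erase C cost hmem
      by_cases h : (⟨s, hs⟩ : Fin m) ∈ E ∧ (knapsack E cost κ top s (j - κ ⟨s, hs⟩)).1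
        + cost ⟨s, hs⟩ < (knapsack E cost κ top s j).1
      · rw [knapsack_take ⟨s, hs⟩ h]; simp only; linarith
      · have h3 : ¬(knapsack E cost κ top s (j - κ ⟨s, hs⟩)).1
          + cost ⟨s, hs⟩ < (knapsack E cost κ top s j).1 := fun h' => h ⟨(hC _ hmem).1, h'⟩
        linarith
    · exact hle.trans (knapsack_le s hs' j C (fun e he => ⟨(hC e he).1,
        hlt e he fun h => hmem (h ▸ he)⟩) hj)

end Knapsack

/-! ### A program for the knapsack problem -/

section KnapsackProgram

variable {ι : Type} {μ : ι → ℕ} {Γ x : ι → Data} {m : ι → ℕ}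

/-- A precomputed number of copies of an entry is put in front of a list. -/
theorem Comp.replicate {n : ι → ℕ} {L : ι → List Data} (hnb : PolyBdd μ n)
    (hn : Comp μ Γ fun i => .num (n i)) (hx : Comp μ Γ x) (hL : Comp μ Γ fun i => .ofList (L i)) :
    Comp μ Γ fun i => .ofList (List.replicate (n i) (x i) ++ L i) := by
  have hsz : PolyBdd (fun q : Below n => μ q.1.1) fun q =>
      (Data.pair (Γ q.1.1) (.ofList (List.replicate q.1.2 (x q.1.1) ++ L q.1.1))).size :=
    (((hn.size_left.add ((hnb.mul (hx.size_right.add (PolyBdd.const _ 1))).add hL.size_right)).add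
      (PolyBdd.const _ 4)).comap fun q : Below n => q.1.1).mono fun q => by
        have h := Nat.mul_le_mul_right ((x q.1.1).size + 1) q.2.le
        simp only [Data.size, Data.size_ofList, List.map_append, List.map_replicate,
          List.sum_append, List.sum_replicate, smul_eq_mul]
        omega
  exact Comp.iter (acc := fun i j => .ofList (List.replicate j (x i) ++ L i)) hnb hn
    (hL.congr fun i => by simp)
    (((hx.lift (fun q : Below n => q.1.1) (PolyBdd.refl _) (Comp.refl hsz).fst).pair
      (Comp.refl hsz).snd).congr fun q => by
        rw [List.replicate_succ]; rfl)

/-- The last entry of a vector. -/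
theorem Comp.last {J : ι → ℕ} {g : ∀ i, Fin (J i + 1) → Data} (hg : Comp μ Γ fun i => vec (g i)) :
    Comp μ Γ fun i => g i (Fin.last _) :=
  (hg.reverse.congr (z := fun i => .pair (g i (Fin.last _))
    (.ofList (List.ofFn fun j : Fin (J i) => g i j.castSucc).reverse)) fun i => by
      rw [List.ofFn_succ', List.concat_eq_append, List.reverse_append]; rfl).fst

/-- Truth values of the membership of the items below `s`, from the last to the first. -/
noncomputable def flags {m : ℕ} (C : Finset (Fin m)) (s : ℕ) : Data :=
  .ofList ((List.ofFn fun e => bit (e ∈ C)).take s).reverse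

theorem flags_succ {m : ℕ} (C : Finset (Fin m)) (e : Fin m) :
    flags C (e + 1) = .pair (bit (e ∈ C)) (flags C e) := by
  rw [flags, List.take_succ_eq_append_getElem (by simp), List.reverse_append]
  simp [Data.ofList, flags]

/-- The list for the items below `e` does not depend on `e`. -/
theorem flags_insert {m : ℕ} (C : Finset (Fin m)) (e : Fin m) :
    flags (insert e C) e = flags C e := by
  rw [flags, flags]
  congr 2
  refine List.ext_getElem (by simp) fun i h1 h2 => ?_
  simp only [List.getElem_take, List.getElem_ofFn]
  refine congrArg bit (propext ?_)
  rw [mem_insert, or_iff_right]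
  intro h
  simp only [List.length_take, List.length_ofFn, lt_min_iff] at h1
  exact absurd (congrArg Fin.val h) h1.1.ne

theorem size_flags_le {m : ℕ} (C : Finset (Fin m)) (s : ℕ) : (flags C s).size ≤ 4 * m + 2 := by
  rw [flags, Data.size_ofList_reverse]
  refine (Data.size_ofList_sublist (List.take_sublist _ _)).trans ?_
  have := Data.size_ofList_le (l := List.ofFn fun e : Fin m => bit (e ∈ C)) (B := 3) fun a ha => by
    obtain ⟨e, rfl⟩ := (List.mem_ofFn' _ _).1 ha
    exact size_bit_le _
  simp only [List.length_ofFn] at this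
  omega

/-- The program that fills the table of the knapsack problem, for weights that are truncated at the
target `J`. -/
theorem Comp.knapsack {E : ∀ i, Finset (Fin (m i))} {cost : ∀ i, Fin (m i) → ℚ}
    {κ : ∀ i, Fin (m i) → ℕ} {top : ι → ℚ} {J : ι → ℕ} (hJb : PolyBdd μ J)
    (hitems : Comp μ Γ fun i => vec fun e => .pair (bit (e ∈ E i))
      (.pair (.num (cost i e)) (.num ((min (κ i e) (J i) : ℕ) : ℚ))))
    (htop : Comp μ Γ fun i => .num (top i)) (hJ : Comp μ Γ fun i => .num (J i)) :
    Comp μ Γ fun i => .pair (.num (knapsack (E i) (cost i) (κ i) (top i) (m i) (J i)).1)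
      (vec fun e => bit (e ∈ (ClaimsTrade.knapsack (E i) (cost i) (κ i) (top i) (m i) (J i)).2)) :=
          by
  classical
  let K : ∀ i, ℕ → ℕ → ℚ × Finset (Fin (m i)) := fun i =>
    ClaimsTrade.knapsack (E i) (cost i) (κ i) (top i)
  let cell : ∀ i, ℕ → ℕ → Data := fun i s j => .pair (.num (K i s j).1) (flags (K i s j).2 s)
  let tab : ∀ i, ℕ → List Data := fun i s => List.ofFn fun j : Fin (J i + 1) => cell i s j
  have hm := hitems.length_bdd
  have hcost : PolyBdd (fun q : Entry m => μ q.1) fun q => (Data.num (cost q.1 q.2)).size :=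
    hitems.size_entry.mono fun q => by simp only [Data.size]; omega
  -- every cell has polynomial size
  have hcell : ∃ B : ι → ℕ, PolyBdd μ B ∧ ∀ i s j, s ≤ m i → (cell i s j).size ≤ B i := by
    obtain ⟨k, hk⟩ := hcost
    have hB : PolyBdd μ fun i => (μ i + 2) ^ k := ⟨k, fun _ => le_rfl⟩
    refine ⟨fun i => 3 * ((Data.num (top i)).size + 3 + (m i + (μ i + 2) ^ k
      + 2 * ((μ i + 2) ^ k * m i) + 3)) + 4 + (4 * m i + 2) + 1,
      ((((PolyBdd.const _ 3).mul ((htop.size_right.add (PolyBdd.const _ 3)).add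
        (((hm.add hB).add ((PolyBdd.const _ 2).mul (hB.mul hm))).add (PolyBdd.const _ 3)))).add
        (PolyBdd.const _ 4)).add (((PolyBdd.const _ 4).mul hm).add (PolyBdd.const _ 2))).add
        (PolyBdd.const _ 1), fun i s j hs => ?_⟩
    obtain ⟨d, hd, heq⟩ := knapsack_fst (E := E i) (cost := cost i) (κ := κ i) (top := top i) s hs j
    have h1 := size_sum_le (K i s j).2 (cost i) ((μ i + 2) ^ k) fun e _ => hk ⟨i, e⟩
    have h2 : #(K i s j).2 ≤ m i := by simpa using Finset.card_le_univ (K i s j).2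
    have h3 := Nat.mul_le_mul_left ((μ i + 2) ^ k) h2
    have h4 := size_add_le d (∑ e ∈ (K i s j).2, cost i e)
    have h5 : (Data.num d).size ≤ (Data.num (top i)).size + 3 := by
      rcases hd with rfl | ⟨rfl, -⟩
      · omega
      · simp [Data.size]
    have h6 := size_flags_le (K i s j).2 s
    have h7 : (K i s j).1 = d + ∑ e ∈ (K i s j).2, cost i e := heq
    rw [← h7] at h4
    have h8 : (cell i s j).size = (Data.num (K i s j).1).size + (flags (K i s j).2 s).size + 1 :=
        rfl
    beta_reduce
    omega
  obtain ⟨B, hBb, hB⟩ := hcell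
  have htabsz : ∀ i s, s ≤ m i → (Data.ofList (tab i s)).size ≤ (J i + 1) * (B i + 1) + 2 := by
    intro i s hs
    have := Data.size_ofList_le (l := tab i s) (B := B i) fun a ha => by
      obtain ⟨j, rfl⟩ := (List.mem_ofFn' _ _).1 ha
      exact hB i s j hs
    simpa [tab] using this
  let item : ∀ i, Fin (m i) → Data := fun i e => .pair (bit (e ∈ E i))
      (.pair (.num (cost i e)) (.num ((min (κ i e) (J i) : ℕ) : ℚ)))
  have hsz : PolyBdd (fun q : Entry m => μ q.1) fun q =>
      (Data.pair (Γ q.1) (.pair (item q.1 q.2) (.ofList (tab q.1 q.2)))).size :=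
    (((hJ.size_left.comap fun q : Entry m => q.1).add hitems.size_entry).add
      (((((hJb.add (PolyBdd.const _ 1)).mul (hBb.add (PolyBdd.const _ 1))).add
        (PolyBdd.const _ 4))).comap fun q : Entry m => q.1)).mono fun q => by
        have h := htabsz q.1 q.2 q.2.2.le
        simp only [Data.size, item]
        omega
  have hC := Comp.refl hsz
  have htab : Comp _ _ fun q : Entry m => vec fun j : Fin (J q.1 + 1) => cell q.1 q.2 j :=
    hC.snd.snd
  have hfirst : Comp _ _ fun q : Entry m => cell q.1 q.2 0 :=
    (htab.congr (z := fun q => .pair (cell q.1 q.2 0) (.ofList (List.ofFn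
      fun j : Fin (J q.1) => cell q.1 q.2 j.succ))) fun q => by
        rw [vec, List.ofFn_succ]; rfl).fst
  have hmin : PolyBdd (fun q : Entry m => μ q.1) fun q => min (κ q.1 q.2) (J q.1) :=
    (hJb.comap fun q : Entry m => q.1).mono fun q => min_le_right _ _
  have hshift := Comp.replicate hmin hC.snd.fst.snd.snd hfirst htab
  have hzip := htab.zipList hshift (h := fun q j => cell q.1 q.2 (j - κ q.1 q.2))
    (fun q => by simp) fun q j => by
      have hj : (j : ℕ) < J q.1 + 1 := j.2
      by_cases h : (j : ℕ) < min (κ q.1 q.2) (J q.1)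
      · rw [List.getElem?_append_left (by simpa using h), List.getElem?_replicate, if_pos h]
        rw [show (j : ℕ) - κ q.1 q.2 = 0 by omega]
      · have h1 : (j : ℕ) - min (κ q.1 q.2) (J q.1) = j - κ q.1 q.2 := by omega
        rw [List.getElem?_append_right (by rw [List.length_replicate]; omega),
          List.length_replicate, h1, List.getElem?_eq_getElem (by rw [List.length_ofFn]; omega),
          List.getElem_ofFn]
  have hnext := hzip.map (h := fun q j => cell q.1 (q.2 + 1) j) (by
    have hsz2 := ((hzip.size_left.comap fun q : Entry (fun q : Entry m => J q.1 + 1) => q.1).add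
      hzip.size_entry).add (PolyBdd.const _ 1)
    have hD := Comp.refl (x := fun q : Entry (fun q : Entry m => J q.1 + 1) =>
      Data.pair (.pair (Γ q.1.1) (.pair (item q.1.1 q.1.2) (.ofList (tab q.1.1 q.1.2))))
        (.pair (cell q.1.1 q.1.2 q.2) (cell q.1.1 q.1.2 (q.2 - κ q.1.1 q.1.2)))) hsz2
    have hE := hD.fst.snd.fst.fst
    have hold := hD.snd.fst
    have hsh := hD.snd.snd
    have hsum := hsh.fst.add hD.fst.snd.fst.snd.fst
    refine ((hE.and (hsum.lt hold.fst)).ite'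
      (hsum.pair ((Comp.const hsz2 (.num 1)).pair hsh.snd))
      (hold.fst.pair ((Comp.const hsz2 (.num 0)).pair hold.snd))).congr fun q => ?_
    obtain ⟨⟨i, e⟩, j⟩ := q
    have hnot : ∀ j, e ∉ (K i e j).2 := fun j h' =>
      lt_irrefl _ (knapsack_mem e e.2.le _ _ h').2
    simp only [cell]
    rw [flags_succ]
    split_ifs with h
    · have h' : K i (e + 1) j = _ := knapsack_take e h
      rw [h', bit_true (mem_insert_self _ _), flags_insert]
    · have h' : K i (e + 1) j = _ := knapsack_skip e h
      rw [h', bit_false (hnot _)])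
  have hinit : Comp μ Γ fun i => .ofList (tab i 0) := by
    have h0 := Comp.const hJ.size_left (.num 0)
    refine ((h0.pair h0).pair (Comp.replicate (L := fun _ => []) hJb hJ (htop.pair h0) h0)).congr
      fun i => ?_
    simp only [tab, List.ofFn_succ, Data.ofList, cell, K, knapsack_zero, List.append_nil]
    congr 1
    refine congrArg Data.ofList (List.ext_getElem (by simp) fun j h1 h2 => ?_)
    simp [flags, Data.ofList]
  have hfold : Comp μ Γ fun i => vec fun j : Fin (J i + 1) => cell i (m i) j :=
    Comp.foldVec (acc := fun i s => .ofList (tab i s)) hitems hinit hnext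
  have hlast := hfold.last
  refine (hlast.fst.pair hlast.snd.reverse).congr fun i => ?_
  simp only [Fin.val_last, K, List.reverse_reverse]
  rw [List.take_of_length_le (by simp)]
  rfl

end KnapsackProgram


section Contexts

variable {ι κ : Type} {μ : ι → ℕ} {Γ x : ι → Data} {m : ι → ℕ}

/-- What is computed from the context is available in every larger context. -/
theorem Comp.along (h : Comp μ Γ x) {Δ : κ → Data} (φ : κ → ι)
    (hΔ : Comp (fun j => μ (φ j)) Δ fun j => Γ (φ j)) :
    Comp (fun j => μ (φ j)) Δ fun j => x (φ j) :=
  h.lift φ (PolyBdd.refl _) hΔ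

/-- The context in which a single entry of a vector is processed. -/
theorem Comp.entry {g : ∀ i, Fin (m i) → Data} (hg : Comp μ Γ fun i => vec (g i)) :
    Comp (fun q : Entry m => μ q.1) (fun q => .pair (Γ q.1) (g q.1 q.2))
      fun q => .pair (Γ q.1) (g q.1 q.2) :=
  Comp.refl ((((hg.size_left.comap fun q : Entry m => q.1).add hg.size_entry).add
    (PolyBdd.const _ 1)).mono fun q => by simp only [Data.size]; omega)

theorem Comp.entryIdx {g : ∀ i, Fin (m i) → Data} (hg : Comp μ Γ fun i => vec (g i)) :
    Comp (fun q : Entry m => μ q.1) (fun q => .pair (Γ q.1) (.pair (.num ((q.2 : ℕ) : ℚ)) (g q.1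
        q.2)))
      fun q => .pair (Γ q.1) (.pair (.num ((q.2 : ℕ) : ℚ)) (g q.1 q.2)) :=
  Comp.refl (((((hg.size_left.add hg.length_bdd).comap fun q : Entry m => q.1).add
    hg.size_entry).add (PolyBdd.const _ 4)).mono fun q => by
      have h2 := size_num_natCast_le q.2
      have h3 := Nat.size_le_self q.2
      have h4 := q.2.2
      simp only [Data.size] at h2 ⊢
      omega)

theorem Comp.natFloor {a : ι → ℚ} (ha : Comp μ Γ fun i => .num (a i)) :
    Comp μ Γ fun i => .num ((⌊a i⌋₊ : ℕ) : ℚ) := by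
  have h0 := Comp.const ha.size_left (.num 0)
  refine ((h0.le ha).ite' ha.floor h0).congr fun i => ?_
  split_ifs with h
  · rw [natCast_floor_eq_intCast_floor h]
  · rw [Nat.floor_of_nonpos (not_le.1 h).le]; simp

theorem Comp.natMin {a b : ι → ℕ} (ha : Comp μ Γ fun i => .num (a i))
    (hb : Comp μ Γ fun i => .num (b i)) : Comp μ Γ fun i => .num ((min (a i) (b i) : ℕ) : ℚ) := by
  refine ((ha.le hb).ite' ha hb).congr fun i => ?_
  simp only [Nat.cast_le]
  split_ifs with h
  · rw [min_eq_left h]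
  · rw [min_eq_right (not_le.1 h).le]

theorem Comp.finEq {n : ι → ℕ} {a b : ∀ i, Fin (n i)} (ha : Comp μ Γ fun i => .num ((a i : ℕ) : ℚ))
    (hb : Comp μ Γ fun i => .num ((b i : ℕ) : ℚ)) : Comp μ Γ fun i => bit (a i = b i) :=
  (ha.eq hb).congr fun i => congrArg bit (propext (by rw [Nat.cast_inj, Fin.ext_iff]))

theorem Comp.sumMem {g : ∀ i, Fin (m i) → Data} {C : ∀ i, Finset (Fin (m i))}
    {a : ∀ i, Fin (m i) → ℚ} (hg : Comp μ Γ fun i => vec (g i))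
    (hc : Comp (fun q : Entry m => μ q.1) (fun q => .pair (Γ q.1) (g q.1 q.2))
      fun q => bit (q.2 ∈ C q.1))
    (ha : Comp (fun q : Entry m => μ q.1) (fun q => .pair (Γ q.1) (g q.1 q.2))
      fun q => .num (a q.1 q.2)) :
    Comp μ Γ fun i => .num (∑ e ∈ C i, a i e) :=
  (Comp.sumFilter (c := fun i e => e ∈ C i) hg hc ha).congr fun i => by
    rw [Finset.filter_mem_eq_inter, Finset.univ_inter]

end Contexts

/-! ### Testing a level -/

section Query

variable {S : PaymentScheme}

/-- The question whether some trade between `v` and `w` brings the assets of `v` to the level `b`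
with haircut rates up to `1 + 1 / N`. -/
structure Query (S : PaymentScheme) : Type extends ValidNetwork S where
  v : Fin n
  w : Fin n
  ne : v ≠ w
  N : ℕ
  N_pos : 0 < N
  m_pos : 0 < m
  b : ℚ
  b_nonneg : 0 ≤ b

/-- The representation of a question. -/
def Query.data (q : Query S) : Data :=
  .pair q.net.encode (.pair (.pair (.num ((q.v : ℕ) : ℚ)) (.num ((q.w : ℕ) : ℚ)))
    (.pair (.num (q.N : ℚ)) (.num q.b)))

namespace Oracle

variable (O : Oracle S) (q : Query S)

/-- The levels at which the two partners are held. -/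
def lev : Fin q.n → ℚ := partnerLevel q.v q.b (q.net.wealth (O.clr q.net) q.w)

theorem lev_nonneg (u : Fin q.n) : 0 ≤ ((O.lev q u : ℚ) : ℝ) := by
  have h := congrFun (toReal_partnerLevel q.v q.b (q.net.wealth (O.clr q.net) q.w)) u
  have hp := O.isClearingState q.net q.valid
  rw [lev, h, ← Network.toReal_assets]
  exact partnerLevel_nonneg q.valid (hp.nonneg q.valid) _ _ (by exact_mod_cast q.b_nonneg) u

/-- The network in which the two partners are held at their levels. -/
def held : ValidNetwork S :=
  ⟨_, _, q.net.fixed {q.v, q.w} (O.lev q), by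
    rw [Network.toReal_fixed]; exact q.valid.fixed _ _ fun u _ => O.lev_nonneg q u⟩

/-- The payments while the two partners are held at their levels. -/
def paid : Fin q.m → ℚ := O.clr (O.held q).net

/-- The amount by which the return of the trade has to exceed the payments that `v` gives up.
It need not be positive, in which case the level is rejected. -/
def gap : ℚ := q.net.transfer q.v q.b (O.paid q)

/-- The amount that `w` can spend on the payments that `v` gives up. -/
def budget : ℚ := q.net.external q.w - O.gap q

/-- The claims that may be traded. -/
def eligible : Finset (Fin q.m) := {e | q.net.creditor e = q.v ∧ q.net.debtor e ≠ q.w}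

/-- The unpaid part of a claim in multiples of `gap / (m * (N + 1))`, rounded down. The value for
a gap that is not positive is irrelevant. -/
def weight (e : Fin q.m) : ℕ :=
  ⌊((q.net.liability e : ℚ) - O.paid q e) * (q.m * (q.N + 1)) / O.gap q⌋₊

/-- The cheapest set of claims of total weight at least `m * N`, and its cost. A set whose unpaid
parts cover the gap has weight more than `m * (N + 1) - m = m * N`, and conversely the unpaid parts
of a set of weight at least `m * N` cover the gap up to a factor `1 + 1 / N`. The budget and one
more unit stand for infinity. -/
noncomputable def choice : ℚ × Finset (Fin q.m) :=
  knapsack (eligible q) (O.paid q) (O.weight q) (O.budget q + 1) q.m (q.m * q.N)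

/-- The test by which the question is answered. -/
def Accepts : Prop :=
  0 < O.gap q ∧ q.net.wealth (O.clr q.net) q.w ≤ O.budget q + q.net.inflow (O.paid q) q.w ∧
    (O.choice q).1 ≤ O.budget q

/-- The trade of the chosen claims. -/
noncomputable def offer : MultiTrade ℚ q.m :=
  q.net.uniformTrade (O.choice q).2 (O.gap q + ∑ e ∈ (O.choice q).2, O.paid q e)

open Classical in
/-- The answer: a trade, or the leaf `0`. -/
noncomputable def answer : Data := if O.Accepts q then (O.offer q).encode else .num 0

theorem isClearingState_clr : q.net.toReal.IsClearingState S (realPayments (O.clr q.net)) :=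
  O.isClearingState q.net q.valid

theorem fixedClearing_paid : q.net.toReal.FixedClearing S {q.v, q.w}
    (partnerLevel q.v (q.b : ℝ) (q.net.toReal.assets (realPayments (O.clr q.net)) q.w))
    (realPayments (O.paid q)) := by
  rw [Network.toReal_assets, ← toReal_partnerLevel]
  refine Network.IsClearingState.fixedClearing q.valid (fun u _ => O.lev_nonneg q u) ?_
  rw [← Network.toReal_fixed]
  exact O.isClearingState (O.held q).net (O.held q).valid

theorem paid_nonneg (e : Fin q.m) : 0 ≤ O.paid q e := by
  have h : (0 : ℝ) ≤ ((O.paid q e : ℚ) : ℝ) := (O.fixedClearing_paid q).follows.nonneg q.valid e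
  exact_mod_cast h

theorem paid_le (e : Fin q.m) : O.paid q e ≤ q.net.liability e := by
  have h1 := (O.fixedClearing_paid q).follows e
  have h2 := (q.valid.pay_mem e (q.net.toReal.level {q.v, q.w} (partnerLevel q.v (q.b : ℝ)
    (q.net.toReal.assets (realPayments (O.clr q.net)) q.w)) (realPayments (O.paid q))
    (q.net.toReal.debtor e))).2
  rw [← h1] at h2
  have h : ((O.paid q e : ℚ) : ℝ) ≤ (q.net.liability e : ℝ) := h2
  exact_mod_cast h

/-- An accepted trade has an admissible return. -/
theorem Accepts.offer_bounds {O : Oracle S} {q : Query S} (h : O.Accepts q) :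
    (0 < ∑ e ∈ (O.choice q).2, (q.net.liability e : ℚ)) ∧
    O.gap q + ∑ e ∈ (O.choice q).2, O.paid q e ≤ q.net.external q.w ∧
    (O.gap q + ∑ e ∈ (O.choice q).2, O.paid q e) * q.N
      ≤ (q.N + 1) * ∑ e ∈ (O.choice q).2, (q.net.liability e : ℚ) := by
  obtain ⟨hx, -, hle⟩ := h
  obtain ⟨h1, h2⟩ := knapsack_sound (O.paid_nonneg q)
    (show (knapsack (eligible q) (O.paid q) (O.weight q) (O.budget q + 1) q.m (q.m * q.N)).1
      < O.budget q + 1 from hle.trans_lt (lt_add_one _))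
  change q.m * q.N ≤ ∑ e ∈ (O.choice q).2, O.weight q e at h1
  change (O.choice q).1 = ∑ e ∈ (O.choice q).2, O.paid q e at h2
  set C := (O.choice q).2
  have hm : (0 : ℚ) < q.m := by exact_mod_cast q.m_pos
  have hN : (0 : ℚ) < q.N := by exact_mod_cast q.N_pos
  have hw : ∀ e, (O.weight q e : ℚ) * O.gap q
      ≤ ((q.net.liability e : ℚ) - O.paid q e) * (q.m * (q.N + 1)) := fun e => by
    rw [← le_div_iff₀ hx]
    exact Nat.floor_le (div_nonneg (mul_nonneg (sub_nonneg.2 (O.paid_le q e)) (by positivity))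
        hx.le)
  have h3 : ((q.m * q.N : ℕ) : ℚ) * O.gap q
      ≤ (∑ e ∈ C, (q.net.liability e : ℚ) - ∑ e ∈ C, O.paid q e) * (q.m * (q.N + 1)) := by
    calc ((q.m * q.N : ℕ) : ℚ) * O.gap q ≤ ((∑ e ∈ C, O.weight q e : ℕ) : ℚ) * O.gap q :=
          mul_le_mul_of_nonneg_right (by exact_mod_cast h1) hx.le
      _ = ∑ e ∈ C, (O.weight q e : ℚ) * O.gap q := by rw [Nat.cast_sum, Finset.sum_mul]
      _ ≤ ∑ e ∈ C, ((q.net.liability e : ℚ) - O.paid q e) * (q.m * (q.N + 1)) :=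
          Finset.sum_le_sum fun e _ => hw e
      _ = _ := by rw [← Finset.sum_mul, Finset.sum_sub_distrib]
  have h4 : (q.N : ℚ) * O.gap q
      ≤ (∑ e ∈ C, (q.net.liability e : ℚ) - ∑ e ∈ C, O.paid q e) * (q.N + 1) := by
    refine le_of_mul_le_mul_left ?_ hm
    push_cast at h3
    linarith
  have h5 : 0 ≤ ∑ e ∈ C, O.paid q e := Finset.sum_nonneg fun e _ => O.paid_nonneg q e
  have h6 : 0 < (q.N : ℚ) * O.gap q := mul_pos hN hx
  refine ⟨?_, ?_, ?_⟩
  · by_contra! hcon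
    nlinarith
  · rw [← h2]; unfold budget at hle; linarith
  · linarith

theorem offer_toReal : (O.offer q).toReal = q.net.toReal.uniformTrade (O.choice q).2
    (((O.gap q + ∑ e ∈ (O.choice q).2, O.paid q e : ℚ)) : ℝ) := by
  simp only [offer, Network.uniformTrade, MultiTrade.toReal, Network.toReal, Rat.cast_div,
    Rat.cast_sum, Rat.cast_natCast]

theorem choice_mem {e : Fin q.m} (he : e ∈ (O.choice q).2) :
    q.net.creditor e = q.v ∧ q.net.debtor e ≠ q.w := by
  simpa [eligible] using (knapsack_mem q.m le_rfl _ e he).1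

/-- An accepted trade is admissible, lifts `v` to the level in question and does not harm `w`. -/
theorem Accepts.sound {O : Oracle S} {q : Query S} (h : O.Accepts q) {ε : ℝ}
    (hε : 1 / (q.N : ℝ) ≤ ε) :
    q.net.toReal.IsApproxTrade q.v q.w ε (O.offer q).toReal ∧
    (q.b : ℝ) ≤ (q.net.toReal.afterTrade q.v q.w (O.offer q).toReal).totalAssets S q.v ∧
    q.net.toReal.totalAssets S q.w
      ≤ (q.net.toReal.afterTrade q.v q.w (O.offer q).toReal).totalAssets S q.w := by
  obtain ⟨h1, h2, h3⟩ := h.offer_bounds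
  have hN : (0 : ℝ) < q.N := by exact_mod_cast q.N_pos
  set ρ := O.gap q + ∑ e ∈ (O.choice q).2, O.paid q e with hρ
  have hρ0 : 0 < ρ := add_pos_of_pos_of_nonneg h.1 (Finset.sum_nonneg fun e _ => O.paid_nonneg q e)
  have hρ0' : (0 : ℝ) < (ρ : ℝ) := by exact_mod_cast hρ0
  have hC : 0 < ∑ e ∈ (O.choice q).2, (q.net.toReal.liability e : ℝ) := by
    change 0 < ∑ e ∈ (O.choice q).2, (q.net.liability e : ℝ)
    exact_mod_cast h1
  have hret := q.net.toReal.tradeReturn_uniformTrade (ρ := (ρ : ℝ)) hC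
  have h3' : (ρ : ℝ) ≤ (1 + ε) * ∑ e ∈ (O.choice q).2, (q.net.toReal.liability e : ℝ) := by
    have h4 : (ρ : ℝ) * q.N ≤ (q.N + 1) * ∑ e ∈ (O.choice q).2, (q.net.toReal.liability e : ℝ) := by
      change (ρ : ℝ) * q.N ≤ (q.N + 1) * ∑ e ∈ (O.choice q).2, (q.net.liability e : ℝ)
      exact_mod_cast h3
    have h5 : (ρ : ℝ) ≤ (1 + 1 / (q.N : ℝ))
        * ∑ e ∈ (O.choice q).2, (q.net.toReal.liability e : ℝ) := by
      refine le_of_mul_le_mul_right (h4.trans_eq ?_) hN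
      field_simp
    exact h5.trans (mul_le_mul_of_nonneg_right (by linarith) hC.le)
  have hM := q.net.toReal.isMultiTrade_uniformTrade q.ne (C := (O.choice q).2)
    (fun e he => (O.choice_mem q he).1) (fun e he => (O.choice_mem q he).2) hC hρ0'.le h3'
    (show (ρ : ℝ) ≤ ((q.net.external q.w : ℚ) : ℝ) by exact_mod_cast h2)
  rw [O.offer_toReal q]
  refine ⟨⟨hM, by rw [hret]; exact hρ0', by rw [hret]; exact h3'⟩, ?_⟩
  refine achieves_level q.valid (O.isClearingState_clr q) (by exact_mod_cast q.b_nonneg)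
    (O.fixedClearing_paid q) ?_ hM ?_
  · rw [Network.toReal_assets, Network.toReal_transfer, Network.toReal_inflow]
    have := h.2.1
    unfold budget gap at this
    change ((_ : ℚ) : ℝ) ≤ ((q.net.external q.w : ℚ) : ℝ) - _ + _
    exact_mod_cast this
  · rw [hret, Network.toReal_transfer, hρ, gap]
    push_cast
    rfl

/-- Levels that exact creditor-positive trades reach are accepted. -/
theorem accepts_of_exact {T : MultiTrade ℝ q.m} (hT : q.net.toReal.IsExactPositive S q.v q.w T)
    (hb : q.net.toReal.totalAssets S q.v < q.b)
    (hb' : (q.b : ℝ) ≤ (q.net.toReal.afterTrade q.v q.w T).totalAssets S q.v) : O.Accepts q := by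
  have hp := O.isClearingState_clr q
  have hr := O.fixedClearing_paid q
  unfold Network.totalAssets at hb
  rw [hp.clearing_eq q.valid] at hb
  obtain ⟨-, h1, h2, -, -, h3⟩ := hT.lower_level q.valid hp hb hb' hr
  rw [Network.toReal_transfer] at h1 h2 h3
  rw [Network.toReal_inflow, Network.toReal_inflow] at h1
  have hx : 0 < O.gap q := by exact_mod_cast h2
  have hgap : O.gap q = q.net.inflow (O.paid q) q.w - q.net.inflow (O.clr q.net) q.w := by
    exact_mod_cast h1
  have hr3 : ((∑ e ∈ T.claims, O.paid q e : ℚ) : ℝ)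
      = ∑ e ∈ T.claims, realPayments (O.paid q) e := by
    push_cast; rfl
  have h4 : O.gap q + ∑ e ∈ T.claims, O.paid q e ≤ q.net.external q.w := by
    have := h3.trans hT.1.affordable
    rw [← hr3, ← Rat.cast_add] at this
    exact Rat.cast_le.1 this
  have h5 : O.gap q + ∑ e ∈ T.claims, O.paid q e ≤ ∑ e ∈ T.claims, (q.net.liability e : ℚ) := by
    have h6 : q.net.toReal.tradeReturn T ≤ ∑ e ∈ T.claims, (q.net.liability e : ℝ) :=
      Finset.sum_le_sum fun e he =>
        mul_le_of_le_one_left (Nat.cast_nonneg _) (hT.1.rate_mem e he).2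
    have := h3.trans h6
    rw [← hr3] at this
    exact_mod_cast this
  refine ⟨hx, ?_, ?_⟩
  · rw [Network.wealth, budget, hgap]; linarith
  refine (knapsack_le q.m le_rfl _ T.claims (fun e he => ⟨?_, e.2⟩) ?_).trans ?_
  · simp only [eligible, mem_filter, mem_univ, true_and]
    exact ⟨hT.1.incoming e he, hT.1.debtor_ne e he⟩
  · -- rounding down loses less than one unit per claim
    have hm : (0 : ℚ) < q.m := by exact_mod_cast q.m_pos
    have hcard : (#T.claims : ℚ) ≤ q.m := by
      exact_mod_cast (by simpa using Finset.card_le_univ T.claims : #T.claims ≤ q.m)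
    have h6 : (q.m * (q.N + 1) : ℚ) ≤ ∑ e ∈ T.claims,
        ((q.net.liability e : ℚ) - O.paid q e) * (q.m * (q.N + 1)) / O.gap q := by
      rw [← Finset.sum_div, ← Finset.sum_mul, le_div_iff₀ hx, mul_comm, Finset.sum_sub_distrib]
      exact mul_le_mul_of_nonneg_right (by linarith) (by positivity)
    have h7 : ∑ e ∈ T.claims,
        ((q.net.liability e : ℚ) - O.paid q e) * (q.m * (q.N + 1)) / O.gap q
        ≤ ∑ e ∈ T.claims, ((O.weight q e : ℚ) + 1) :=
      Finset.sum_le_sum fun e _ => (Nat.lt_floor_add_one _).le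
    rw [Finset.sum_add_distrib, Finset.sum_const, nsmul_eq_mul, mul_one] at h7
    have h8 : ((q.m * q.N : ℕ) : ℚ) ≤ ((∑ e ∈ T.claims, O.weight q e : ℕ) : ℚ) := by
      push_cast
      linarith
    exact_mod_cast h8
  · rw [budget]; linarith

end Oracle

end Query


/-! ### A program that tests a level -/

section AnswerProgram

variable {S : PaymentScheme}

section Fields

variable {ι : Type} {μ : ι → ℕ} {Γ : ι → Data} {n m : ι → ℕ} {F : ∀ i, Network ℚ (n i) (m i)}
  {u : ∀ i, Fin (n i)}

theorem Comp.banks (hF : Comp μ Γ fun i => (F i).encode) :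
    Comp μ Γ fun i => vec fun u => .pair (.num ((F i).external u)) ((F i).rule u) :=
  Comp.fst hF

theorem Comp.claims (hF : Comp μ Γ fun i => (F i).encode) :
    Comp μ Γ fun i => vec fun e => .pair (.num (((F i).debtor e : ℕ) : ℚ))
      (.pair (.num (((F i).creditor e : ℕ) : ℚ)) (.num ((F i).liability e : ℚ))) :=
  Comp.snd hF

theorem Comp.external (hF : Comp μ Γ fun i => (F i).encode)
    (hu : Comp μ Γ fun i => .num ((u i : ℕ) : ℚ)) :
    Comp μ Γ fun i => .num ((F i).external (u i)) := by
  have hC := hF.banks.entryIdx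
  have hI := hF.banks.mapIdx (h := fun i u => .pair (.num ((u : ℕ) : ℚ))
    (.num ((F i).external u))) (hC.snd.fst.pair hC.snd.snd.fst)
  have hD := hI.entry
  refine (hI.sumFilter (c := fun i y => y = u i) (a := fun i y => (F i).external y)
    (Comp.finEq hD.snd.fst (hu.along _ hD.fst)) hD.snd.snd).congr fun i => ?_
  rw [Finset.sum_filter, Finset.sum_ite_eq' Finset.univ (u i), if_pos (mem_univ _)]

theorem Comp.inflow {r : ∀ i, Fin (m i) → ℚ} (hF : Comp μ Γ fun i => (F i).encode)
    (hr : Comp μ Γ fun i => vec fun e => .num (r i e))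
    (hu : Comp μ Γ fun i => .num ((u i : ℕ) : ℚ)) :
    Comp μ Γ fun i => .num ((F i).inflow (r i) (u i)) := by
  have hI := hF.claims.zip hr
  have hD := hI.entry
  exact hI.sumFilter (c := fun i e => (F i).creditor e = u i)
    (Comp.finEq hD.snd.fst.snd.fst (hu.along _ hD.fst)) hD.snd.snd

theorem Comp.wealth {r : ∀ i, Fin (m i) → ℚ} (hF : Comp μ Γ fun i => (F i).encode)
    (hr : Comp μ Γ fun i => vec fun e => .num (r i e))
    (hu : Comp μ Γ fun i => .num ((u i : ℕ) : ℚ)) :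
    Comp μ Γ fun i => .num ((F i).wealth (r i) (u i)) :=
  (hF.external hu).add (hF.inflow hr hu)

/-- The representation of a network in which two banks are held at given levels. -/
theorem Comp.fixed {v w : ∀ i, Fin (n i)} {b c : ι → ℚ} (hF : Comp μ Γ fun i => (F i).encode)
    (hv : Comp μ Γ fun i => .num ((v i : ℕ) : ℚ)) (hw : Comp μ Γ fun i => .num ((w i : ℕ) : ℚ))
    (hb : Comp μ Γ fun i => .num (b i)) (hc : Comp μ Γ fun i => .num (c i)) :
    Comp μ Γ fun i => ((F i).fixed {v i, w i} (partnerLevel (v i) (b i) (c i))).encode := by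
  have h0 := Comp.const hF.size_left (.num 0)
  have hB := hF.banks.mapIdx (h := fun i u => .pair (.num (if u ∈ ({v i, w i} : Finset _) then
      partnerLevel (v i) (b i) (c i) u else (F i).external u)) ((F i).rule u)) (by
    have hC := hF.banks.entryIdx
    refine (((Comp.finEq hC.snd.fst (hv.along _ hC.fst)).ite' (hb.along _ hC.fst)
      ((Comp.finEq hC.snd.fst (hw.along _ hC.fst)).ite' (hc.along _ hC.fst)
        hC.snd.snd.fst)).pair hC.snd.snd.snd).congr fun q => ?_
    by_cases h1 : q.2 = v q.1
    · simp [h1, partnerLevel]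
    · by_cases h2 : q.2 = w q.1
      · simp [h2, partnerLevel]
        simp [← h2, h1]
      · simp [h1, h2])
  have hE := hF.claims.map (h := fun i e => .pair (.num (((F i).debtor e : ℕ) : ℚ))
      (.pair (.num ((((F i).fixed {v i, w i} (partnerLevel (v i) (b i) (c i))).creditor e : ℕ) : ℚ))
        (.num ((F i).liability e : ℚ)))) (by
    have hC := hF.claims.entry
    refine (hC.snd.fst.pair ((((Comp.finEq hC.snd.snd.fst (hv.along _ hC.fst)).or
      (Comp.finEq hC.snd.snd.fst (hw.along _ hC.fst))).ite' (hF.banks.length.along _ hC.fst)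
      hC.snd.snd.fst).pair hC.snd.snd.snd)).congr fun q => ?_
    simp only [Network.fixed, mem_insert, mem_singleton]
    split_ifs <;> simp)
  refine ((hB.snoc (h0.pair h0)).pair hE).congr fun i => ?_
  rw [encode_eq]
  congr 2
  funext u
  induction u using Fin.lastCases with
  | last => simp [Network.fixed]
  | cast u => simp [Network.fixed]

end Fields

namespace Oracle

variable (O : Oracle S)

theorem comp_clr {ι : Type} {μ : ι → ℕ} {Γ : ι → Data} (G : ι → ValidNetwork S)
    (h : Comp μ Γ fun i => (G i).net.encode) :
    Comp μ Γ fun i => vec fun e => .num (O.clr (G i).net e) :=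
  O.comp.lift G h.size_right h

/-- The answers are computed in polynomial time. -/
theorem comp_answer {ι : Type} {μ : ι → ℕ} {Γ : ι → Data} (φ : ι → Query S)
    (hN : PolyBdd μ fun i => (φ i).N) (h : Comp μ Γ fun i => (φ i).data) :
    Comp μ Γ fun i => O.answer (φ i) := by
  classical
  have hF : Comp μ Γ fun i => (φ i).net.encode := h.fst
  have hv := h.snd.fst.fst
  have hw := h.snd.fst.snd
  have hNc := h.snd.snd.fst
  have hb := h.snd.snd.snd
  have hp := O.comp_clr (fun i => (φ i).toValidNetwork) hF
  have hA := hF.wealth hp hw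
  have hr : Comp μ Γ fun i => vec fun e => .num (O.paid (φ i) e) :=
    O.comp_clr (fun i => O.held (φ i)) (hF.fixed hv hw hb hA)
  have hgap : Comp μ Γ fun i => .num (O.gap (φ i)) :=
    (hb.sub (hF.external hv)).sub (hF.inflow hr hv)
  have hbud : Comp μ Γ fun i => .num (O.budget (φ i)) := (hF.external hw).sub hgap
  have h1 := Comp.const h.size_left (.num 1)
  have hm := hF.claims.length
  have hJ : Comp μ Γ fun i => .num (((φ i).m * (φ i).N : ℕ) : ℚ) :=
    (hm.mul hNc).congr fun i => by push_cast; rfl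
  have hzip := hF.claims.zip hr
  have hitems := hzip.map (h := fun i e => .pair (bit (e ∈ eligible (φ i)))
      (.pair (.num (O.paid (φ i) e))
        (.num ((min (O.weight (φ i) e) ((φ i).m * (φ i).N) : ℕ) : ℚ)))) (by
    have hC := hzip.entry
    have helig := (Comp.finEq hC.snd.fst.snd.fst (hv.along _ hC.fst)).and
      (Comp.finEq hC.snd.fst.fst (hw.along _ hC.fst)).not
    have hwt := (((hC.snd.fst.snd.snd.sub hC.snd.snd).mul
      ((hm.mul (hNc.add h1)).along _ hC.fst)).div (hgap.along _ hC.fst)).natFloor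
    refine (helig.pair (hC.snd.snd.pair (Comp.natMin hwt (hJ.along _ hC.fst)))).congr fun q => ?_
    simp [eligible, Oracle.weight])
  have hknap := Comp.knapsack (hF.claims.length_bdd.mul hN) hitems (hbud.add h1) hJ
  have hval : Comp μ Γ fun i => .num (O.choice (φ i)).1 := hknap.fst
  have hflags : Comp μ Γ fun i => vec fun e => bit (e ∈ (O.choice (φ i)).2) := hknap.snd
  have hall := hflags.zip hzip
  have hD := hall.entry
  have hρ : Comp μ Γ fun i =>
      .num (O.gap (φ i) + ∑ e ∈ (O.choice (φ i)).2, O.paid (φ i) e) :=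
    hgap.add (hall.sumMem hD.snd.fst hD.snd.snd.snd)
  have hℓ : Comp μ Γ fun i => .num (∑ e ∈ (O.choice (φ i)).2, ((φ i).net.liability e : ℚ)) :=
    hall.sumMem hD.snd.fst hD.snd.snd.fst.snd.snd
  have hrate := hρ.div hℓ
  have hoffer : Comp μ Γ fun i => (O.offer (φ i)).encode := by
    have hC := hflags.entry
    exact hflags.map (hC.snd.ite' ((h1.along _ hC.fst).pair (hrate.along _ hC.fst))
      (Comp.const hC.size_left (.num 0)))
  have hacc : Comp μ Γ fun i => bit (O.Accepts (φ i)) :=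
    ((Comp.const h.size_left (.num 0)).lt hgap).and
      ((hA.le (hbud.add (hF.inflow hr hw))).and (hval.le hbud))
  refine (hacc.ite' hoffer (Comp.const h.size_left (.num 0))).congr fun i => ?_
  unfold Oracle.answer
  congr

end Oracle

end AnswerProgram


/-! ### Searching for the best level -/

section Search

variable {S : PaymentScheme}

/-- An input of the trading problem, with the accuracies `1 / N` and `1 / D`. -/
structure Task (S : PaymentScheme) : Type extends TradeSetting S where
  N : ℕ
  N_pos : 0 < N
  D : ℕ
  D_pos : 0 < D

theorem TradeSetting.m_pos (I : TradeSetting S) : 0 < I.m := by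
  obtain ⟨T, hT⟩ := I.trade
  obtain ⟨p, hp⟩ := I.valid.exists_isClearingState
  have h := (hT.claims_slack I.valid hp).2
  by_contra! hcon
  have hC : T.claims = ∅ := eq_empty_of_forall_notMem fun e => by have := e.2; omega
  simp [hC] at h

namespace Task

/-- The representation of an input. -/
def data (I : Task S) : Data := encodeInstance I.net I.v I.w I.N I.D

/-- The size of an input; `N` counts in unary and `D` in binary. -/
def size (I : Task S) : ℕ := I.net.encode.size + I.N + I.D.size

/-- The question whether the level `b` can be reached. -/
def query (I : Task S) (b : ℚ) (hb : 0 ≤ b) : Query S where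
  toValidNetwork := I.toValidNetwork
  v := I.v
  w := I.w
  ne := I.ne
  N := I.N
  N_pos := I.N_pos
  m_pos := I.m_pos
  b := b
  b_nonneg := hb

theorem polyBdd_size_data : PolyBdd (size (S := S)) fun I => I.data.size :=
  (((PolyBdd.const _ 4).mul (PolyBdd.refl _)).add (PolyBdd.const _ 16)).mono fun I => by
    have h1 := size_num_natCast_le I.v
    have h2 := size_num_natCast_le I.w
    have h3 := size_num_natCast_le I.N
    have h4 := size_num_natCast_le I.D
    have h5 := Nat.size_le_self I.v
    have h6 := Nat.size_le_self I.w
    have h7 := Nat.size_le_self I.N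
    have h8 := I.v.2
    have h9 := I.w.2
    have h10 := (card_le_size I.net).1
    simp only [data, encodeInstance, Data.size, size] at h1 h2 h3 h4 ⊢
    omega

end Task

namespace Oracle

variable (O : Oracle S) (I : Task S)

/-- The level `b` is accepted. -/
def Test (b : ℚ) : Prop := ∃ hb : 0 ≤ b, O.Accepts (I.query b hb)

/-- The assets of `v` before the trade. -/
def base : ℚ := I.net.wealth (O.clr I.net) I.v

/-- The number of halvings after which the level `base + 1 / 2 ^ j` is accepted. There is such a
number by `Oracle.exists_start_bound`. -/
noncomputable def start : ℕ := sInf {j | O.Test I (O.base I + (2 ^ j : ℚ)⁻¹)}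

/-- The first accepted level. -/
noncomputable def low : ℚ := O.base I + (2 ^ O.start I : ℚ)⁻¹

/-- The length of the interval from the first accepted level up to the total debt of `v`, which no
exact creditor-positive trade exceeds. -/
noncomputable def width : ℚ := max (∑ e with I.net.debtor e = I.v,
    (I.net.liability e : ℚ) - O.low I) 0

open Classical in
/-- The number of the subinterval of length `width / 2 ^ j` that the bisection selects. -/
noncomputable def cut : ℕ → ℕ
  | 0 => 0
  | j + 1 => if O.Test I (O.low I + (2 * cut j + 1 : ℕ) * (O.width I / 2 ^ (j + 1)))
      then 2 * cut j + 1 else 2 * cut j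

/-- The number of bisections after which the interval has length at most `1 / D`. -/
noncomputable def rounds : ℕ := sInf {j | O.width I / 2 ^ j ≤ 1 / I.D}

/-- The left end of the selected interval. -/
noncomputable def level (j : ℕ) : ℚ := O.low I + O.cut I j * (O.width I / 2 ^ j)

theorem totalAssets_eq (u : Fin I.n) :
    I.net.toReal.totalAssets S u = ((I.net.wealth (O.clr I.net) u : ℚ) : ℝ) := by
  rw [Network.totalAssets, (O.isClearingState I.net I.valid).clearing_eq I.valid,
    Network.toReal_assets]

theorem base_nonneg : 0 ≤ O.base I := by
  have hp := O.isClearingState I.net I.valid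
  have := I.valid.assets_nonneg (hp.nonneg I.valid) I.v
  rw [Network.toReal_assets] at this
  exact_mod_cast this

theorem test_of_exact {T : MultiTrade ℝ I.m} (hT : I.net.toReal.IsExactPositive S I.v I.w T)
    {b : ℚ} (hb : O.base I < b)
    (hb' : (b : ℝ) ≤ (I.net.toReal.afterTrade I.v I.w T).totalAssets S I.v) : O.Test I b := by
  refine ⟨(O.base_nonneg I).trans hb.le, O.accepts_of_exact (I.query b _) hT ?_ hb'⟩
  change I.net.toReal.totalAssets S I.v < (b : ℝ)
  rw [O.totalAssets_eq]
  exact_mod_cast hb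

/-- The search for an accepted level succeeds after polynomially many halvings. -/
theorem exists_start_bound : ∃ K : Task S → ℕ, PolyBdd Task.size K ∧
    ∀ I, O.start I ≤ K I ∧ O.Test I (O.low I) := by
  obtain ⟨K, hK, h⟩ := O.exists_gain
  refine ⟨fun I => K I.toTradeSetting, (hK.comap fun I : Task S => I.toTradeSetting).trans
    ((PolyBdd.refl _).mono fun I => by simp only [Task.size]; omega), fun I => ?_⟩
  obtain ⟨T, hT, hle⟩ := h I.toTradeSetting
  have hmem : O.Test I (O.base I + (2 ^ K I.toTradeSetting : ℚ)⁻¹) := by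
    refine O.test_of_exact I hT (lt_add_of_pos_right _ (by positivity)) ?_
    rw [O.totalAssets_eq] at hle
    push_cast
    exact hle
  exact ⟨Nat.sInf_le hmem, Nat.sInf_mem (s := {j | O.Test I (O.base I + (2 ^ j : ℚ)⁻¹)}) ⟨_, hmem⟩⟩

theorem low_nonneg : 0 ≤ O.low I := add_nonneg (O.base_nonneg I) (by positivity)

theorem width_nonneg : 0 ≤ O.width I := le_max_right _ _

theorem mid_nonneg (a b : ℕ) : 0 ≤ O.low I + a * (O.width I / 2 ^ b) :=
  add_nonneg (O.low_nonneg I) (mul_nonneg (Nat.cast_nonneg _)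
    (div_nonneg (O.width_nonneg I) (by positivity)))

theorem base_lt_mid (a b : ℕ) : O.base I < O.low I + a * (O.width I / 2 ^ b) := by
  have h1 : (0 : ℚ) ≤ a * (O.width I / 2 ^ b) := mul_nonneg (Nat.cast_nonneg _)
    (div_nonneg (O.width_nonneg I) (by positivity))
  have h2 : (0 : ℚ) < (2 ^ O.start I : ℚ)⁻¹ := by positivity
  rw [low]
  linarith

theorem cut_succ (j : ℕ) :
    (O.Test I (O.low I + (2 * O.cut I j + 1 : ℕ) * (O.width I / 2 ^ (j + 1))) ∧
      O.cut I (j + 1) = 2 * O.cut I j + 1) ∨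
    (¬O.Test I (O.low I + (2 * O.cut I j + 1 : ℕ) * (O.width I / 2 ^ (j + 1))) ∧
      O.cut I (j + 1) = 2 * O.cut I j) := by
  rw [cut]
  split_ifs with h
  · exact .inl ⟨h, rfl⟩
  · exact .inr ⟨h, rfl⟩

theorem cut_lt (j : ℕ) : O.cut I j < 2 ^ j := by
  induction j with
  | zero => simp [cut]
  | succ j ih =>
    rw [pow_succ]
    rcases O.cut_succ I j with ⟨-, h⟩ | ⟨-, h⟩ <;> rw [h] <;> omega

/-- The selected interval starts at an accepted level. -/
theorem test_level (h0 : O.Test I (O.low I)) (j : ℕ) : O.Test I (O.level I j) := by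
  induction j with
  | zero => simpa [level, cut] using h0
  | succ j ih =>
    rcases O.cut_succ I j with ⟨h, h'⟩ | ⟨-, h'⟩
    · rw [level, h']; exact h
    · have : O.level I (j + 1) = O.level I j := by
        rw [level, level, h', pow_succ]
        push_cast
        field_simp
      rw [this]; exact ih

/-- No exact creditor-positive trade gets beyond the selected interval. -/
theorem exact_le_level {T : MultiTrade ℝ I.m} (hT : I.net.toReal.IsExactPositive S I.v I.w T)
    (j : ℕ) : (I.net.toReal.afterTrade I.v I.w T).totalAssets S I.v
      ≤ ((O.level I j + O.width I / 2 ^ j : ℚ) : ℝ) := by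
  induction j with
  | zero =>
    have hp := O.isClearingState I.net I.valid
    have hlt := hT.2.1
    have hb0 : 0 ≤ (I.net.toReal.afterTrade I.v I.w T).totalAssets S I.v := by
      rw [O.totalAssets_eq] at hlt
      exact (show (0 : ℝ) ≤ ((O.base I : ℚ) : ℝ) by exact_mod_cast O.base_nonneg I).trans hlt.le
    rw [Network.totalAssets, hp.clearing_eq I.valid] at hlt
    obtain ⟨r, hr⟩ := I.valid.exists_fixedClearing (S := S) {I.v, I.w}
      (partnerLevel I.v ((I.net.toReal.afterTrade I.v I.w T).totalAssets S I.v)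
        (I.net.toReal.assets (realPayments (O.clr I.net)) I.w))
      fun u _ => partnerLevel_nonneg I.valid (hp.nonneg I.valid) I.v I.w hb0 u
    obtain ⟨-, -, -, hdebt, -⟩ := hT.lower_level I.valid hp hlt le_rfl hr
    have h1 : ∑ e with I.net.debtor e = I.v, (I.net.liability e : ℚ) - O.low I ≤ O.width I :=
      le_max_left _ _
    have h2 : ∑ e with I.net.debtor e = I.v, (I.net.liability e : ℚ)
        ≤ O.level I 0 + O.width I / 2 ^ 0 := by
      simp only [level, cut, pow_zero, div_one, Nat.cast_zero, zero_mul, add_zero]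
      linarith
    refine hdebt.trans (le_trans (le_of_eq ?_) (Rat.cast_le.2 h2))
    push_cast
    rfl
  | succ j ih =>
    rcases O.cut_succ I j with ⟨-, h'⟩ | ⟨h, h'⟩
    · refine ih.trans_eq (congrArg _ ?_)
      rw [level, level, h', pow_succ]
      push_cast
      field_simp
      ring
    · by_contra! hcon
      have e : O.level I (j + 1) + O.width I / 2 ^ (j + 1)
          = O.low I + (2 * O.cut I j + 1 : ℕ) * (O.width I / 2 ^ (j + 1)) := by
        rw [level, h']
        push_cast
        ring
      rw [e] at hcon
      exact h (O.test_of_exact I hT (O.base_lt_mid I _ _) hcon.le)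

/-- The interval has length at most `1 / D` after polynomially many bisections. -/
theorem exists_rounds_bound : ∃ J : Task S → ℕ, PolyBdd Task.size J ∧
    ∀ I, O.rounds I ≤ J I ∧ O.width I / 2 ^ O.rounds I ≤ 1 / I.D := by
  let L : Task S → ℚ := fun I => ∑ e with I.net.debtor e = I.v, (I.net.liability e : ℚ)
  have hμ : PolyBdd Task.size fun I : Task S => I.net.encode.size :=
    (PolyBdd.refl _).mono fun I => by simp only [Task.size]; omega
  have hL : PolyBdd Task.size fun I => (Data.num (L I)).size :=
    PolyBdd.sum (fun I : Task S => {e | I.net.debtor e = I.v})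
      (hμ.mono fun I => (card_le_size I.net).2)
      ((hμ.comap fun q : Entry fun I : Task S => I.m => q.1).mono fun q =>
        size_liability_le q.1.net q.2)
  refine ⟨fun I => (Data.num (L I)).size + I.D.size, hL.add
    ((PolyBdd.refl _).mono fun I => by simp only [Task.size]; omega), fun I => ?_⟩
  have hD : (0 : ℚ) < I.D := by exact_mod_cast I.D_pos
  have hmem : O.width I / 2 ^ ((Data.num (L I)).size + I.D.size) ≤ 1 / I.D := by
    have h1 : O.width I ≤ 2 ^ (Data.num (L I)).size := by
      refine max_le ?_ (by positivity)
      have h2 := (le_abs_self _).trans (abs_le_two_pow_size (L I))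
      have h3 := O.low_nonneg I
      simp only [L] at h2 ⊢
      linarith
    have h4 : (I.D : ℚ) ≤ 2 ^ I.D.size := by exact_mod_cast (Nat.lt_size_self _).le
    rw [div_le_div_iff₀ (by positivity) hD, pow_add, one_mul]
    exact mul_le_mul h1 h4 hD.le (by positivity)
  exact ⟨Nat.sInf_le hmem, Nat.sInf_mem (s := {j | O.width I / 2 ^ j ≤ 1 / (I.D : ℚ)}) ⟨_, hmem⟩⟩

section Programs

variable {ι : Type} {μ : ι → ℕ} {Γ : ι → Data} {τ : ι → Task S} {b : ι → ℚ}

theorem comp_query (hτ : PolyBdd μ fun i => (τ i).size) (h : Comp μ Γ fun i => (τ i).data)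
    (hb : Comp μ Γ fun i => .num (b i)) (hb0 : ∀ i, 0 ≤ b i) :
    Comp μ Γ fun i => O.answer ((τ i).query (b i) (hb0 i)) :=
  O.comp_answer (fun i => (τ i).query (b i) (hb0 i))
    (hτ.mono fun i => by simp only [Task.size, Task.query]; omega)
    (h.fst.pair (h.snd.fst.pair (h.snd.snd.fst.pair hb)))

/-- Trades are told from the leaf `0` by their shape, as there is at least one claim. -/
theorem isPair_answer (q : Query S) : Op.isPair.eval (O.answer q) = bit (O.Accepts q) := by
  unfold answer
  split_ifs with h
  · rw [bit_true h, MultiTrade.encode]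
    have hm := q.m_pos
    cases hl : List.ofFn fun e => if e ∈ (O.offer q).claims then
        Data.pair (.num 1) (.num ((O.offer q).rate e)) else .num 0 with
    | nil =>
      have := congrArg List.length hl
      simp at this
      omega
    | cons a l => rfl
  · rw [bit_false h]; rfl

theorem comp_test (hτ : PolyBdd μ fun i => (τ i).size) (h : Comp μ Γ fun i => (τ i).data)
    (hb : Comp μ Γ fun i => .num (b i)) (hb0 : ∀ i, 0 ≤ b i) :
    Comp μ Γ fun i => bit (O.Test (τ i) (b i)) :=
  ((O.comp_query hτ h hb hb0).op .isPair ((PolyBdd.const _ 3).mono fun i => by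
    rw [isPair_answer]; exact size_bit_le _)).congr fun i => by
      rw [isPair_answer]
      exact congrArg bit (propext ⟨fun h => ⟨hb0 i, h⟩, fun ⟨_, h⟩ => h⟩)

theorem comp_base (h : Comp μ Γ fun i => (τ i).data) : Comp μ Γ fun i => .num (O.base (τ i)) :=
  Comp.wealth h.fst (O.comp_clr (fun i => (τ i).toValidNetwork) h.fst) h.snd.fst.fst

theorem size_inv_two_pow_le (j : ℕ) : (Data.num (2 ^ j : ℚ)⁻¹).size ≤ j + 5 := by
  refine (size_inv_le _).trans ?_
  have h1 := size_num_natCast_le (2 ^ j)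
  rw [Nat.size_pow] at h1
  push_cast at h1
  omega

/-- The first accepted level is found by halving the distance to the assets before the trade. -/
theorem comp_low : Comp Task.size (Task.data (S := S)) fun I => .num (O.low I) := by
  obtain ⟨K, hK, hbound⟩ := O.exists_start_bound
  have hn : PolyBdd Task.size O.start := hK.mono fun I => (hbound I).1
  have hI := Comp.refl (Task.polyBdd_size_data (S := S))
  let s : Task S → ℕ → Data := fun I j => .pair I.data (.num (2 ^ j : ℚ)⁻¹)
  have hs : PolyBdd (fun q : Upto O.start => q.1.1.size) fun q => (s q.1.1 q.1.2).size :=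
    (((Task.polyBdd_size_data.add hn).add (PolyBdd.const _ 6)).comap
      fun q : Upto O.start => q.1.1).mono fun q => by
        have h1 := size_inv_two_pow_le q.1.2
        have h2 := q.2
        simp only [s]
        rw [Data.size]
        omega
  have hs' : PolyBdd (fun q : Below O.start => q.1.1.size) fun q => (s q.1.1 q.1.2).size :=
    hs.comap fun q : Below O.start => (⟨q.1, q.2.le⟩ : Upto O.start)
  have hC := Comp.refl hs
  have htest := (O.comp_test (τ := fun q : Upto O.start => q.1.1) (PolyBdd.refl _) hC.fst
    ((O.comp_base hC.fst).add hC.snd) fun q => add_nonneg (O.base_nonneg _) (by positivity)).not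
  have hC' := Comp.refl hs'
  have hloop := Comp.loop hn (htest.congr fun q => congrArg bit (propext ⟨fun h => ?_, fun h =>
    ?_⟩))
    ((hC'.fst.pair (hC'.snd.div (Comp.const hs' (.num 2)))).congr fun q => by
      simp only [s]; rw [pow_succ, mul_inv, div_eq_mul_inv])
  · have hstart : Comp Task.size (Task.data (S := S)) fun I => s I 0 :=
      (hI.pair (Comp.const hI.size_left (.num 1))).congr fun I => by simp [s]
    exact (O.comp_base hI).add (hstart.trans hloop).snd
  · refine lt_of_le_of_ne q.2 fun h' => h ?_
    rw [h']
    exact (hbound q.1.1).2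
  · exact Nat.notMem_of_lt_sInf h

/-- The length of the initial interval is computed in polynomial time. -/
theorem comp_width : Comp Task.size (Task.data (S := S)) fun I => .num (O.width I) := by
  have hI := Comp.refl (Task.polyBdd_size_data (S := S))
  have hcl := Comp.claims (F := fun I : Task S => I.net) hI.fst
  have hC := hcl.entry
  have hL : Comp Task.size (Task.data (S := S)) fun I =>
      .num (∑ e with I.net.debtor e = I.v, (I.net.liability e : ℚ)) :=
    hcl.sumFilter (c := fun I e => I.net.debtor e = I.v)
      (Comp.finEq (b := fun q : Entry fun I : Task S => I.m =>
        q.1.v) hC.snd.fst ((hI.snd.fst.fst).along _ hC.fst)) hC.snd.snd.snd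
  have h0 := Comp.const hI.size_left (.num 0)
  have hsub := hL.sub O.comp_low
  refine ((h0.le hsub).ite' hsub h0).congr fun I => ?_
  unfold width
  split_ifs with h
  · rw [max_eq_left h]
  · rw [max_eq_right (not_le.1 h).le]

/-- The left end of the last interval is found by bisection. Intervals are represented by their
number and their length, so that their sizes stay small. -/
theorem comp_level : Comp Task.size (Task.data (S := S)) fun I => .num (O.level I (O.rounds I)) :=
    by
  classical
  obtain ⟨J, hJ, hbound⟩ := O.exists_rounds_bound
  have hn : PolyBdd Task.size O.rounds := hJ.mono fun I => (hbound I).1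
  have hI := Comp.refl (Task.polyBdd_size_data (S := S))
  have hlow := O.comp_low
  have hwidth := O.comp_width
  let s : Task S → ℕ → Data := fun I j => .pair (.pair I.data (.num (O.low I)))
    (.pair (.num (O.width I / 2 ^ j)) (.num (O.cut I j : ℚ)))
  have hs : PolyBdd (fun q : Upto O.rounds => q.1.1.size) fun q => (s q.1.1 q.1.2).size :=
    (((((Task.polyBdd_size_data.add hlow.size_right).add
      ((PolyBdd.const _ 3).mul (hwidth.size_right.add hn))).add hn).add (PolyBdd.const _ 40)).comap
      fun q : Upto O.rounds => q.1.1).mono fun q => by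
        obtain ⟨⟨I, j⟩, hj⟩ := q
        have h1 := size_inv_two_pow_le j
        have h2 := size_mul_le (O.width I) (2 ^ j : ℚ)⁻¹
        have h3 := size_num_natCast_le (O.cut I j)
        have h4 : (O.cut I j).size ≤ j := Nat.size_le.2 (O.cut_lt I j)
        rw [← div_eq_mul_inv] at h2
        have h5 : (s I j).size = (I.data.size + (Data.num (O.low I)).size + 1)
          + ((Data.num (O.width I / 2 ^ j)).size + (Data.num (O.cut I j : ℚ)).size + 1) + 1 := rfl
        simp only at hj ⊢
        omega
  have hs' : PolyBdd (fun q : Below O.rounds => q.1.1.size) fun q => (s q.1.1 q.1.2).size :=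
    hs.comap fun q : Below O.rounds => (⟨q.1, q.2.le⟩ : Upto O.rounds)
  have hC := Comp.refl hs
  have htest := (Comp.const hs (.num 1)).div hC.fst.fst.snd.snd.snd |>.lt hC.snd.fst
  have hC' := Comp.refl hs'
  have hhalf := hC'.snd.fst.div (Comp.const hs' (.num 2))
  have heven := (Comp.const hs' (.num 2)).mul hC'.snd.snd
  have hodd := heven.add (Comp.const hs' (.num 1))
  have hmid : Comp (fun q : Below O.rounds => q.1.1.size) (fun q => s q.1.1 q.1.2) fun q =>
      .num (O.low q.1.1 + (2 * O.cut q.1.1 q.1.2 + 1 : ℕ) * (O.width q.1.1 / 2 ^ (q.1.2 + 1))) :=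
    (hC'.fst.snd.add (hodd.mul hhalf)).congr fun q => by
      congr 1
      rw [pow_succ]
      push_cast
      field_simp
  have hcut := (O.comp_test (τ := fun q : Below O.rounds => q.1.1) (PolyBdd.refl _) hC'.fst.fst
    hmid fun q => O.mid_nonneg _ _ _).ite' hodd heven
  have hloop := Comp.loop hn (htest.congr fun q => congrArg bit (propext ⟨fun h => ?_, fun h =>
    ?_⟩))
    ((hC'.fst.pair (hhalf.pair hcut)).congr fun q => ?_)
  · have hstart : Comp Task.size (Task.data (S := S)) fun I => s I 0 :=
      ((hI.pair hlow).pair (hwidth.pair (Comp.const hI.size_left (.num 0)))).congr fun I => by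
        simp [s, cut]
    have hend := hstart.trans hloop
    exact hend.fst.snd.add (hend.snd.snd.mul hend.snd.fst)
  · refine lt_of_le_of_ne q.2 fun h' => absurd h (not_lt.2 ?_)
    rw [h']
    exact (hbound q.1.1).2
  · exact not_le.1 (Nat.notMem_of_lt_sInf (s := {j | O.width q.1.1 / 2 ^ j ≤ 1 / (q.1.1.D : ℚ)}) h)
  · simp only [s]
    rw [div_div, ← pow_succ]
    rcases O.cut_succ q.1.1 q.1.2 with ⟨h, h'⟩ | ⟨h, h'⟩
    · rw [if_pos h, h']; push_cast; rfl
    · rw [if_neg h, h']; push_cast; rfl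

theorem level_nonneg (I : Task S) (j : ℕ) : 0 ≤ O.level I j := O.mid_nonneg I _ _

/-- The trade offered at the last level is computed in polynomial time. -/
theorem comp_solution : Comp Task.size (Task.data (S := S)) fun I =>
    (O.offer (I.query (O.level I (O.rounds I)) (O.level_nonneg I _))).encode := by
  obtain ⟨K, hK, hbound⟩ := O.exists_start_bound
  refine (O.comp_query (PolyBdd.refl _) (Comp.refl (Task.polyBdd_size_data (S := S)))
    O.comp_level fun I => O.level_nonneg I _).congr fun I => ?_
  obtain ⟨_, h⟩ := O.test_level I (hbound I).2 (O.rounds I)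
  rw [answer, if_pos h]

end Programs

end Oracle

/-- The binary length of `⌈1 / δ⌉` is logarithmic in `1 / δ`. -/
theorem size_ceil_le {δ : ℝ} (hδ : 0 < δ) :
    ((⌈1 / δ⌉₊.size : ℕ) : ℝ) ≤ 3 + 2 * max 0 (Real.log (1 / δ)) := by
  set M := max 0 (Real.log (1 / δ)) with hM
  have hpos : 0 < 1 / δ := by positivity
  have hD : 0 < ⌈1 / δ⌉₊ := Nat.ceil_pos.2 hpos
  have h1 : 2 ^ (⌈1 / δ⌉₊.size - 1) ≤ ⌈1 / δ⌉₊ :=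
    Nat.lt_size.1 (Nat.sub_lt (Nat.size_pos.2 hD) one_pos)
  have h2 : (⌈1 / δ⌉₊ : ℝ) ≤ 2 * Real.exp M := by
    have h3 := (Nat.ceil_lt_add_one hpos.le).le
    have h4 : 1 / δ ≤ Real.exp M := by
      rw [← Real.exp_log hpos]; exact Real.exp_le_exp.2 (le_max_right _ _)
    have h5 : 1 ≤ Real.exp M := Real.one_le_exp (le_max_left _ _)
    linarith
  have h3 : (2 : ℝ) ^ (⌈1 / δ⌉₊.size - 1) ≤ 2 * Real.exp M :=
    le_trans (by exact_mod_cast h1) h2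
  have h4 := Real.log_le_log (by positivity) h3
  rw [Real.log_pow, Real.log_mul (by norm_num) (Real.exp_pos _).ne', Real.log_exp] at h4
  have hl := Real.log_two_gt_d9
  have hl' := Real.log_two_lt_d9
  have h5 : ((⌈1 / δ⌉₊.size - 1 : ℕ) : ℝ) ≤ 2 + 2 * M := by
    have hM0 : 0 ≤ M := le_max_left _ _
    have hk : (0 : ℝ) ≤ ((⌈1 / δ⌉₊.size - 1 : ℕ) : ℝ) := Nat.cast_nonneg _
    nlinarith
  rw [Nat.cast_sub (Nat.size_pos.2 hD)] at h5
  push_cast at h5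
  linarith

end Search

end ClaimsTrade

theorem theorem4p3 (S : ClaimsTrade.PaymentScheme) (hS : ClaimsTrade.HasClearingOracle S) :
    ∃ (prog : ClaimsTrade.Code) (c k : ℕ),
      ∀ (n m : ℕ) (F : ClaimsTrade.Network ℚ n m) (v w : Fin n) (ε δ : ℝ),
        F.toReal.Valid S → v ≠ w → 0 < ε → 0 < δ →
        (∃ T : ClaimsTrade.MultiTrade ℝ m, F.toReal.IsExactPositive S v w T) →
        ∃ (T : ClaimsTrade.MultiTrade ℚ m) (t : ℕ),
          ClaimsTrade.Run prog (ClaimsTrade.encodeInstance F v w ⌈1 / ε⌉₊ ⌈1 / δ⌉₊) T.encode t ∧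
          (t : ℝ) ≤ c * ((F.encode.size : ℝ) + 1 / ε + max 0 (Real.log (1 / δ))) ^ k ∧
          F.toReal.IsApproxTrade v w ε T.toReal ∧
          F.toReal.IsDeltaOptimal S v w δ T.toReal ∧
          ((∃ T' : ClaimsTrade.MultiTrade ℝ m, F.toReal.IsExactPositive S v w T' ∧
              F.toReal.totalAssets S v + δ ≤ (F.toReal.afterTrade v w T').totalAssets S v) →
            F.toReal.CreditorPositive S v w T.toReal) := by
  obtain ⟨O⟩ := hS.exists_oracle
  obtain ⟨P, k, hP⟩ := O.comp_solution
  obtain ⟨K, -, hstart⟩ := O.exists_start_bound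
  obtain ⟨J, -, hrounds⟩ := O.exists_rounds_bound
  refine ⟨P, 8 ^ k, k, fun n m F v w ε δ hF hvw hε hδ hT => ?_⟩
  let I : ClaimsTrade.Task S :=
    { n := n, m := m, net := F, valid := hF, v := v, w := w, ne := hvw, trade := hT
      N := ⌈1 / ε⌉₊, N_pos := Nat.ceil_pos.2 (by positivity)
      D := ⌈1 / δ⌉₊, D_pos := Nat.ceil_pos.2 (by positivity) }
  obtain ⟨t, ht, hrun⟩ := hP I
  obtain ⟨hb0, hacc⟩ := O.test_level I (hstart I).2 (O.rounds I)
  have hN : 1 / (⌈1 / ε⌉₊ : ℝ) ≤ ε := by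
    rw [one_div_le (by exact_mod_cast I.N_pos) hε]; exact Nat.le_ceil _
  have hD : 1 / (⌈1 / δ⌉₊ : ℝ) ≤ δ := by
    rw [one_div_le (by exact_mod_cast I.D_pos) hδ]; exact Nat.le_ceil _
  obtain ⟨hM, hv, hw⟩ := hacc.sound (ε := ε) hN
  refine ⟨_, t, hrun, ?_, hM, fun T' hT' => ?_, fun _ => ⟨?_, hw⟩⟩
  · have h1 : (t : ℝ) ≤ ((I.size + 2 : ℕ) : ℝ) ^ k := by exact_mod_cast ht
    refine h1.trans ?_
    push_cast
    rw [← mul_pow]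
    refine pow_le_pow_left₀ (by positivity) ?_ k
    have h2 := ClaimsTrade.size_ceil_le hδ
    have h3 := (Nat.ceil_lt_add_one (show 0 ≤ 1 / ε by positivity)).le
    have h4 : (1 : ℝ) ≤ F.encode.size := by exact_mod_cast F.encode.size_pos
    have h5 : (0 : ℝ) ≤ max 0 (Real.log (1 / δ)) := le_max_left _ _
    have h6 : 0 ≤ 1 / ε := by positivity
    have h7 : ((I.size : ℕ) : ℝ) = (F.encode.size : ℝ) + ⌈1 / ε⌉₊ + (⌈1 / δ⌉₊.size : ℕ) := by
      simp [ClaimsTrade.Task.size, I]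
    -- `size + 2` is at most `8` times the measure of the theorem, as networks have positive size
    rw [h7]
    linarith
  · have h1 := O.exact_le_level I hT' (O.rounds I)
    have h2 : ((O.width I / 2 ^ O.rounds I : ℚ) : ℝ) ≤ 1 / (⌈1 / δ⌉₊ : ℝ) := by
      have h3 := (hrounds I).2
      have h4 : ((O.width I / 2 ^ O.rounds I : ℚ) : ℝ) ≤ ((1 / I.D : ℚ) : ℝ) := Rat.cast_le.2 h3
      push_cast at h4 ⊢
      exact h4
    rw [Rat.cast_add] at h1
    have h1' : (F.toReal.afterTrade v w T').totalAssets S v ≤ _ := h1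
    refine le_trans ?_ hv
    change _ ≤ ((O.level I (O.rounds I) : ℚ) : ℝ)
    linarith
  · refine lt_of_lt_of_le ?_ hv
    change F.toReal.totalAssets S v < ((O.level I (O.rounds I) : ℚ) : ℝ)
    have h1 := O.totalAssets_eq I v
    have h2 : ((O.base I : ℚ) : ℝ) < ((O.level I (O.rounds I) : ℚ) : ℝ) :=
      Rat.cast_lt.2 (O.base_lt_mid I _ _)
    exact h1.trans_lt h2
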